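/- **Theorem.** *Model.* Let $J\ge 1$ be an integer, $p_0\in\mathbb R$, $\sigma_v,\sigma_1,\sigma_{1_+},\sigma_2>0$ and $\sigma_\varepsilon,\sigma_z\ge 0$. Let $v\sim N(p_0,\sigma_v^2)$, $z\sim N(0,\sigma_z^2)$, $u_1\sim N(0,\sigma_1^2)$, $u_{1_+}\sim N(0,\sigma_{1_+}^2)$, $u_2\sim N(0,\sigma_2^2)$ and $\varepsilon_1,\dots,\varepsilon_J\sim N(0,\sigma_\varepsilon^2)$ be independent random variables on a standard Borel probability space. An informed trader (IT) places orders $i_1=i_1(v,z)$ (where $z$ is her own randomisation) and $i_2=i_2(v,i_1,y_1)$. For $1\le j\le J$, the $j$-th high-frequency trader (HFT) receives the signal $\tilde i_{1j}=i_1+\varepsilon_j$ and places orders $x_{1j}=x_{1j}(\tilde i_{1j},y_1)$ and $x_{2j}=x_{2j}(\tilde i_{1j},y_1,y_{1_+})$, where $x_{2j}$ may also depend on her own previous order $x_{1j}$. The order flows are $$y_1=i_1+u_1,\qquad y_{1_+}=\sum_j x_{1j}+u_{1_+},\qquad y_2=i_2+\sum_j x_{2j}+u_2,$$ and dealers quote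 prices $p_1(y_1)$, $p_{1_+}(y_1,y_{1_+})$, $p_2(y_1,y_{1_+},y_2)$. All strategies are measurable. Put $\pi^{IT}_1=i_1(v-p_1)$, $\pi_2^{IT}=(v-p_2)i_2$, $\pi_{1j}=(v-p_{1_+})x_{1j}$ and $\pi_{2j}=(v-p_2)x_{2j}$; the HFTs bear no inventory cost ($\Gamma=0$: "Small-ITs"). An *equilibrium* is a collection of strategies such that: 1. almost surely $p_1=\mathbb E(v\mid y_1)$, $p_{1_+}=\mathbb E(v\mid y_1,y_{1_+})$ and $p_2=\mathbb E(v\mid y_1,y_{1_+},y_2)$; 2. given the other strategies, (a) after any first order (any measurable function of $v$ and $z$), $i_2$ is the unique maximiser of $\mathbb E(\pi_2^{IT}\mid v,i_1,y_1)$ over measurable functions of $(v,i_1,y_1)$; (b) in a *mixed-strategy* equilibrium, $\mathbb E(\pi_1^{IT}+\pi_2^{IT}\mid v)$ is the same for all measurable pure first orders $i_1=i_1(v)$; in a *pure-strategy* equilibrium, $i_1$ is a function of $v$ and is the unique maximiser of $\mathbb E(\pi_1^{IT}+\pi_2^{IT}\mid v)$ over measurable functions of $v$; 3. given the other strategies,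 for every $j$: (a) after any own first order (any measurable function of $\tilde i_{1j}$ and $y_1$), $x_{2j}$ is the unique maximiser of $\mathbb E(\pi_{2j}\mid \tilde i_{1j},y_1,y_{1_+})$ over measurable functions of $(\tilde i_{1j},y_1,y_{1_+})$; (b) $x_{1j}$ is the unique maximiser of $\mathbb E(\pi_{1j}+\pi_{2j}\mid\tilde i_{1j},y_1)$ over measurable functions of $(\tilde i_{1j},y_1)$. In (2b) and (3b) the trader's own second order follows her strategy. Maximisers are unique up to null sets. Consider *linear* strategies, with real coefficients: $$p_1=p_0+\lambda_1y_1,\quad p_{1_+}=p_1+\lambda_{1_+}y_{1_+},\quad p_2=p_1+\lambda_{21}y_{1_+}+\lambda_{22}y_2,$$ $$i_1=\alpha_1(v-p_0)+z,\qquad i_2=\alpha_{21}\bigl(v-\mathbb E(v|y_1)\bigr)+\alpha_{22}\bigl(i_1-\mathbb E(i_1|y_1)\bigr),$$ $$x_{1j}=\beta_{11}\bigl(\tilde i_{1j}-\mathbb E(\tilde i_{1j}|y_1)\bigr),\qquad x_{2j}=\beta_{21}\bigl(\tilde i_{1j}-\mathbb E(\tilde i_{1j}|y_1)\bigr)+\beta_{22}(y_{1_+}-x_{1j})+\beta_{23}x_{1j},$$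 where $\mathbb E(\cdot|y_1)$ stands for the continuous regression function (along the linear profile) evaluated at $y_1$. Put $\theta_{1_+}=\sigma_{1_+}^2/\sigma_1^2$, $\theta_2=\sigma_2^2/\sigma_1^2$, $\theta_\varepsilon=\sigma_\varepsilon^2/\sigma_1^2$, $\theta_z=\sigma_z^2/\sigma_1^2$, $\Lambda_\bullet=\lambda_\bullet\sigma_1/\sigma_v$ for each of $\lambda_1,\lambda_{1_+},\lambda_{21},\lambda_{22}$, $A_1=\alpha_1\sigma_v/\sigma_1$, $A_{21}=\alpha_{21}\sigma_v/\sigma_1$ and $(J-2)^+=\max(J-2,0)$. **(i) Mixed strategies.** Let $\sigma_z>0$. The linear profile is a mixed-strategy equilibrium if and only if $(A_1,\theta_z,\beta_{11},\beta_{21},\beta_{22},\beta_{23})$ satisfies (M1)–(M7) and the other coefficients are given by (M8). (M1) $0=J\bigl(\theta_\varepsilon(A_1^2+\theta_z+1)P_{2}+JQ_{2}\bigr)\beta_{11}^2-J\theta_{1_+}(\beta_{23}P_1+\beta_{22}Q_1)\beta_{11}-\beta_{11}^3(\beta_{23}+\beta_{22}(J-1))J^2P_3+P_0$, where $$P_0=\theta_{1_+}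 (A_1^{2}-\beta_{21} J+\theta_z+1) (A_1^{8}+(3 \theta_z-4 \beta_{21} J) A_1^{6}+(4 J (\theta_\varepsilon+J) \beta_{21}^{2}-8 J \theta_z \beta_{21}+3 \theta_z^{2}+4 \theta_2+\theta_z-2) A_1^{4}+(4 J (\theta_z \theta_\varepsilon+\theta_\varepsilon+J \theta_z) \beta_{21}^{2}-4 J (\theta_z^{2}-1) \beta_{21}+(\theta_z+1) (\theta_z^{2}+\theta_z+4 \theta_2)) A_1^{2}+(\theta_z+1)^{3}),$$ $$P_1=5 A_1^{8}+(-8 \beta_{21} (\theta_\varepsilon+2 J)+15 \theta_z+4) A_1^{6}+(12 J (\theta_\varepsilon+J) \beta_{21}^{2}-8 (4 \theta_z J+J+2 \theta_\varepsilon (\theta_z+1)) \beta_{21}+15 \theta_z^{2}+4 \theta_2+9 \theta_z-6) A_1^{4}+(12 J (\theta_z \theta_\varepsilon+\theta_\varepsilon+J \theta_z) \beta_{21}^{2}-8 (\theta_z+1) (\theta_z \theta_\varepsilon+\theta_\varepsilon-J+2 J \theta_z) \beta_{21}+(\theta_z+1) (5 \theta_z^{2}+\theta_z+4 \theta_2-4))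 A_1^{2}+(\theta_z+1)^{3},$$ $$Q_1=(J-5) A_1^{8}+(8 \beta_{21} \theta_\varepsilon-4 \beta_{21} (J-4) J-15 \theta_z+J (3 \theta_z+2)-4) A_1^{6}+(4 (J-3) J (\theta_\varepsilon+J) \beta_{21}^{2}+4 (4 \theta_\varepsilon (\theta_z+1)-J (2 \theta_z J+J-8 \theta_z-2)) \beta_{21}+4 (J-1) \theta_2+3 (\theta_z+1) ((J-5) \theta_z+2)) A_1^{4}+(4 (J-3) J (\theta_z \theta_\varepsilon+\theta_\varepsilon+J \theta_z) \beta_{21}^{2}+4 (\theta_z+1) (2 \theta_\varepsilon (\theta_z+1)-J ((J-4) \theta_z+2)) \beta_{21}+(\theta_z+1) (-5 \theta_z^{2}-\theta_z-4 \theta_2+J (\theta_z^{2}-\theta_z+4 \theta_2-2)+4)) A_1^{2}-(J+1) (\theta_z+1)^{3},$$ $$P_2=A_1^{8}+(3 \theta_z-\beta_{21} J) A_1^{6}+A_1^{4} (4 \theta_{1_+} \beta_{22}^{2}-8 \beta_{23} \theta_{1_+} \beta_{22}+3 \theta_z^{2}+4 \beta_{23}^{2} \theta_{1_+}+4 \theta_2+\theta_z-\beta_{21}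 (2 \theta_z J+J)-2)+(\beta_{21} J (4 (2 J-3) \theta_{1_+} \beta_{22}^{2}-8 \beta_{23} (J-3) \theta_{1_+} \beta_{22}-\theta_z^{2}-12 \beta_{23}^{2} \theta_{1_+}-4 \theta_2+1)+(\theta_z+1) (4 \theta_{1_+} \beta_{22}^{2}-8 \beta_{23} \theta_{1_+} \beta_{22}+\theta_z^{2}+4 \beta_{23}^{2} \theta_{1_+}+4 \theta_2+\theta_z)) A_1^{2}+(\theta_z+1)^{2} (\beta_{21} J+\theta_z+1),$$ $$Q_2=4 (-(J-2) \theta_{1_+} \beta_{22}^{2}+\beta_{23} (J-4) \theta_{1_+} \beta_{22}+2 \beta_{23}^{2} \theta_{1_+}+\theta_2) A_1^{6}+(4 \theta_{1_+} (2 \beta_{21} J^{2}-(3 \beta_{21}+2 \theta_z+1) J+4 \theta_z+1) \beta_{22}^{2}-4 \beta_{23} \theta_{1_+} (2 \beta_{21} J^{2}-(6 \beta_{21}+2 \theta_z+1) J+8 \theta_z+2) \beta_{22}-4 \beta_{21} J \theta_2+\beta_{21} J \theta_z+8 \theta_2 \theta_z+4 \beta_{23}^{2} \theta_{1_+} (-3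 \beta_{21} J+4 \theta_z+1)) A_1^{4}+2 (-2 \theta_{1_+} ((J-2) \theta_z^{2}+(-2 \beta_{21} J^{2}+3 \beta_{21} J+J-1) \theta_z+1) \beta_{22}^{2}+2 \beta_{22} \beta_{23} \theta_{1_+} ((J-4) \theta_z^{2}+(-2 \beta_{21} J^{2}+6 \beta_{21} J+J-2) \theta_z+2)+\beta_{21} J \theta_z^{2}+2 \theta_2 \theta_z^{2}-2 \theta_2+\beta_{21} J \theta_z-2 \beta_{21} J \theta_2 \theta_z+2 \beta_{23}^{2} \theta_{1_+} (2 \theta_z^{2}-3 \beta_{21} J \theta_z+\theta_z-1)) A_1^{2}+\beta_{21} J \theta_z (\theta_z+1)^{2},$$ $$P_3=J ((4 \theta_{1_+} \beta_{22}^{2}-8 \beta_{23} \theta_{1_+} \beta_{22}+4 \beta_{23}^{2} \theta_{1_+}+4 \theta_2-\theta_z) A_1^{4}-2 \theta_z (-2 \theta_{1_+} \beta_{22}^{2}+4 \beta_{23} \theta_{1_+} \beta_{22}-2 \beta_{23}^{2} \theta_{1_+}-2 \theta_2+\theta_z+1) A_1^{2}-\theta_z (\theta_z+1)^{2})+\theta_\varepsilon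 (A_1^{2}+\theta_z+1) (A_1^{6}+(2 \theta_z+1) A_1^{4}+(4 \theta_{1_+} \beta_{22}^{2}-8 \beta_{23} \theta_{1_+} \beta_{22}+\theta_z^{2}+4 \beta_{23}^{2} \theta_{1_+}+4 \theta_2-1) A_1^{2}-(\theta_z+1)^{2}),$$ (M2) $$0=4 A_1^{2} \beta_{11} J \theta_{1_+} (\beta_{22}-\beta_{23}) (A_1^{4}+A_1^{2} (-2 \beta_{21} (\theta_\varepsilon+J)+2 \theta_z+1)-2 \beta_{21} (\theta_\varepsilon \theta_z+\theta_\varepsilon+J \theta_z)+\theta_z (\theta_z+1))+\beta_{11}^{2} J (J (A_1^{4} (4 \beta_{22}^{2} \theta_{1_+}-8 \beta_{22} \beta_{23} \theta_{1_+}+4 \beta_{23}^{2} \theta_{1_+}+4 \theta_2-\theta_z)-2 A_1^{2} \theta_z (-2 \beta_{22}^{2} \theta_{1_+}+4 \beta_{22} \beta_{23} \theta_{1_+}-2 \beta_{23}^{2} \theta_{1_+}-2 \theta_2+\theta_z+1)-\theta_z (\theta_z+1)^{2})+\theta_\varepsilon (A_1^{2}+\theta_z+1) (A_1^{6}+A_1^{4}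 (2 \theta_z+1)+A_1^{2} (4 \beta_{22}^{2} \theta_{1_+}-8 \beta_{22} \beta_{23} \theta_{1_+}+4 \beta_{23}^{2} \theta_{1_+}+4 \theta_2+\theta_z^{2}-1)-(\theta_z+1)^{2}))+\theta_{1_+} (A_1^{8}+A_1^{6} (-4 \beta_{21} J+3 \theta_z+2)+A_1^{4} (4 \beta_{21}^{2} J (\theta_\varepsilon+J)-4 \beta_{21} (2 J \theta_z+J)+4 \theta_2+3 \theta_z (\theta_z+1))+A_1^{2} (4 \beta_{21}^{2} J (\theta_\varepsilon \theta_z+\theta_\varepsilon+J \theta_z)-4 \beta_{21} J \theta_z (\theta_z+1)+(\theta_z+1) (4 \theta_2+\theta_z^{2}-\theta_z-2))-(\theta_z+1)^{3});$$ (M3) $$0=2 A_1 \beta_{11} \beta_{22} (J-1) \theta_{1_+} (A_1^{2}+\theta_z) (J-2)^+ -A_1^{5} (\beta_{11}^{2} \theta_\varepsilon (J-1)+\theta_{1_+})+2 A_1^{3} (\beta_{11}^{2} \theta_\varepsilon (J-1) (2 \beta_{21} (\theta_\varepsilon+J)-\theta_z-1)+\beta_{11} (J-1) \theta_{1_+}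 (\beta_{22} (-J)+\beta_{22}+\beta_{23})+\theta_{1_+} (\beta_{21} (2 \theta_\varepsilon+J+1)-\theta_z-1))+A_1 (\beta_{11}^{2} \theta_\varepsilon (J-1) (4 \beta_{21} (\theta_\varepsilon \theta_z+\theta_\varepsilon+J \theta_z)-(\theta_z+1)^{2})+2 \beta_{11} (J-1) \theta_{1_+} \theta_z (\beta_{22} (-J)+\beta_{22}+\beta_{23})+\theta_{1_+} (4 \beta_{21} \theta_\varepsilon (\theta_z+1)+2 \beta_{21} (J+1) \theta_z-(\theta_z+1)^{2}));$$ (M4) $$0=2 A_1 \beta_{11}^{3} \beta_{22} \theta_\varepsilon (J-1) J (J-2)^+ (\theta_\varepsilon (A_1^{2}+\theta_z+1)+J (A_1^{2}+\theta_z))+A_1^{5} (\beta_{11}^{2} \theta_\varepsilon (J-1) (2 \theta_\varepsilon+J)+2 (\theta_\varepsilon+1) \theta_{1_+})-2 A_1^{3} (\beta_{11}^{3} \beta_{22} \theta_\varepsilon (J-3) (J-1) J (\theta_\varepsilon+J)-\beta_{11}^{2} \theta_\varepsilon (J-1) (2 \theta_\varepsilon (\theta_z+1)+J \theta_z)-\beta_{11}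 (\theta_\varepsilon+1) J \theta_{1_+} (2 \beta_{22}-\beta_{23})+\theta_{1_+} (\beta_{21} \theta_\varepsilon J+\beta_{21} J-2 (\theta_\varepsilon+1) \theta_z-2 \theta_\varepsilon-1))+A_1 (-2 \beta_{11}^{3} \beta_{22} \theta_\varepsilon (J-3) (J-1) J (\theta_z (\theta_\varepsilon+J)+\theta_\varepsilon)+\beta_{11}^{2} \theta_\varepsilon (J-1) (\theta_z+1) (2 \theta_\varepsilon (\theta_z+1)+J (\theta_z-1))+2 \beta_{11} J \theta_{1_+} (2 \beta_{22}-\beta_{23}) (\theta_\varepsilon \theta_z+\theta_\varepsilon+\theta_z)-2 \theta_{1_+} (\theta_\varepsilon \theta_z+\theta_\varepsilon+\theta_z) (\beta_{21} J-\theta_z-1));$$ (M5) $$0=A_1^3+A_1(\beta_{11}\beta_{23}J-\beta_{21}J+\theta_z+1);$$ (M6) $$0=\beta_{11}-\frac{N}{2\,(A_1^2(\theta_\varepsilon+1)+\theta_\varepsilon\theta_z+\theta_\varepsilon+\theta_z)\,S},$$ where, with $W=\beta_{11}^2J(\theta_\varepsilon(A_1^2+\theta_z+1)+J(A_1^2+\theta_z))+\theta_{1_+}(A_1^2+\theta_z+1)$,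 $$S=\frac{A_1\beta_{11}J}{W}-\frac{A_1\beta_{23}^2}{A_1^2+\theta_z+1},$$ $$N=-\frac{A_1\beta_{11}^2(J-1)J(A_1^2+\theta_z)}{W}+\frac{2A_1\beta_{23}\bigl[A_1^2(\beta_{11}\beta_{22}(J-1)+\beta_{21}(\theta_\varepsilon+1))+\beta_{11}\beta_{22}(J-1)\theta_z+\beta_{21}(\theta_\varepsilon\theta_z+\theta_\varepsilon+\theta_z)\bigr]}{A_1^2+\theta_z+1}+A_1;$$ (M7) $$0<S,\qquad 0<A_1,\qquad 0<\theta_z;$$ (M8) $$\Lambda_1=\frac{A_1}{A_1^2+\theta_z+1},\quad \Lambda_{1_+}=\frac{A_1\beta_{11}J}{W},\quad \Lambda_{21}=\frac{A_1-\frac{A_1J[\beta_{11}(\beta_{22}(J-1)+\beta_{23})+\beta_{21}]}{A_1^2+\theta_z+1}}{\beta_{11}J},\quad \Lambda_{22}=\Lambda_1,\quad A_{21}=\frac1{2\Lambda_{22}},\quad \alpha_{22}=-\frac{A_1^2+\theta_z+1}{2}.$$ **(ii) Pure strategies.** Let $\sigma_z=0$. The linear profile is a pure-strategy equilibrium if and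 only if $(\Lambda_{21},\Lambda_{22},A_1,\beta_{11},\beta_{21},\beta_{22})$ satisfies (P1)–(P7) and the other coefficients are given by (P8). Write $H=\beta_{22}(J-1)\Lambda_{22}+\Lambda_{21}$ and $V=\beta_{11}^2J(A_1^2\theta_\varepsilon+A_1^2J+\theta_\varepsilon)+(A_1^2+1)\theta_{1_+}$. (P1) $$0=-A_1^{2} \beta_{11}^{4} \theta_\varepsilon J^{3} \Lambda_{21} (\Lambda_{22} H)^{2}-\beta_{11}^{2} J (4 \theta_\varepsilon (\Lambda_{22}^{2} (\beta_{22} \Lambda_{22} (2 (A_1^{2}+1) (J+1) \Lambda_{21}^{2} \theta_{1_+}-2 A_1 \beta_{21} (J-1) J \Lambda_{22}+J-1)+\Lambda_{21} (4 (A_1^{2}+1) \Lambda_{22}^{2} \theta_2+A_1 (\beta_{21} J \Lambda_{22} (A_1 \beta_{21} J \Lambda_{22}-2)+A_1 \Lambda_{21}^{2} \theta_{1_+})+\Lambda_{21}^{2} \theta_{1_+})+(A_1^{2}+1) \beta_{22}^{2} (J+1)^{2} \Lambda_{21} \Lambda_{22}^{2} \theta_{1_+}))+A_1^{2} J \Lambda_{21}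 (\theta_{1_+} (\Lambda_{22} (3 \beta_{22} J \Lambda_{22}+\beta_{22} \Lambda_{22}+3 \Lambda_{21}))^{2}+16 \Lambda_{22}^{4} \theta_2))+4 \beta_{11} J \Lambda_{22} (\beta_{21} \Lambda_{22} (4 (A_1^{2}+1) \theta_\varepsilon \Lambda_{21} \Lambda_{22} \theta_{1_+} (\beta_{22} (J+1) \Lambda_{22}+\Lambda_{21})+A_1^{2} J \Lambda_{21} \theta_{1_+} (\Lambda_{22} (3 \beta_{22} J \Lambda_{22}+\beta_{22} \Lambda_{22}+3 \Lambda_{21}))-2 \theta_\varepsilon \Lambda_{22})+2 A_1 \beta_{21}^{2} \theta_\varepsilon J \Lambda_{22}^{3}+A_1 \theta_{1_+} (\beta_{22} J \Lambda_{22}+\Lambda_{21}) (\Lambda_{22} (3 \beta_{22} J \Lambda_{22}+\beta_{22} \Lambda_{22}+3 \Lambda_{21}))+4 A_1 \Lambda_{22}^{3} \theta_2)-4 \theta_{1_+} \Lambda_{22}^{2} (\Lambda_{21} \Lambda_{22} (4 (A_1^{2}+1) \Lambda_{22} \theta_2+\beta_{21} J (A_1 (A_1 \beta_{21} \Lambda_{22}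 (4 \theta_\varepsilon+J)+2)+4 \beta_{21} \theta_\varepsilon \Lambda_{22}))+2 \beta_{22} J \Lambda_{22} (A_1 \beta_{21} J \Lambda_{22}+1)+\Lambda_{21})-2 A_1 \beta_{11}^{3} \theta_\varepsilon J^{2} (\Lambda_{22} H) (\Lambda_{22}^{2} (2 A_1 \beta_{21} J \Lambda_{21}+\beta_{22} (-J)+\beta_{22})-\Lambda_{21} \Lambda_{22});$$ (P2) $$0=-A_1^{2} \beta_{11}^{4} \theta_\varepsilon J^{3} (\Lambda_{22} H)^{2}-4 A_1^{2} \beta_{11}^{3} \beta_{21} \theta_\varepsilon J^{3} \Lambda_{22}^{3} H-\beta_{11}^{2} J (4 \theta_\varepsilon (\Lambda_{22}^{2} (A_1^{2} (\beta_{21}^{2} J^{2} \Lambda_{22}^{2}+\theta_{1_+} (\beta_{22} (J+1) \Lambda_{22}+\Lambda_{21})^{2}+4 \Lambda_{22}^{2} \theta_2)+\theta_{1_+} (\beta_{22} (J+1) \Lambda_{22}+\Lambda_{21})^{2}+4 \Lambda_{22}^{2} \theta_2-1))+A_1^{2} J (\theta_{1_+} (\Lambda_{22} (3 \beta_{22}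 J \Lambda_{22}+\beta_{22} \Lambda_{22}+3 \Lambda_{21}))^{2}+16 \Lambda_{22}^{4} \theta_2))+4 \beta_{11} \beta_{21} J \Lambda_{22}^{2} \theta_{1_+} (\Lambda_{22} (4 (A_1^{2}+1) \theta_\varepsilon \Lambda_{21}+3 A_1^{2} J \Lambda_{21})+\beta_{22} \Lambda_{22}^{2} (4 (A_1^{2}+1) \theta_\varepsilon (J+1)+A_1^{2} J (3 J+1)))-4 \theta_{1_+} \Lambda_{22}^{2} (\Lambda_{22}^{2} (\beta_{21}^{2} J (4 (A_1^{2}+1) \theta_\varepsilon+A_1^{2} J)+4 (A_1^{2}+1) \theta_2)-1);$$ (P3) $$0=\frac{-4A_1^2\Lambda_{22}^2+2A_1\Lambda_{22}+\beta_{11}J\Lambda_{22}H+2\Lambda_{22}^2(\beta_{21}J-2)}{8(A_1^2+1)\Lambda_{22}^2\,T}+A_1,\qquad T=\frac{A_1}{A_1^2+1}-\frac{\bigl(2A_1\Lambda_{22}+J(\beta_{11}\Lambda_{22}H+2\beta_{21}\Lambda_{22}^2)\bigr)^2}{16(A_1^2+1)^2\Lambda_{22}^3};$$ (P4) $$0=4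 A_1^{2} \beta_{11} \beta_{22} (J-1) \Lambda_{22}^{2} \theta_{1_+} (J-2)^+ +A_1^{2} (-\beta_{11}^{3} \theta_\varepsilon (J-1) J (\Lambda_{22} H)+2 \beta_{11}^{2} \beta_{21} \theta_\varepsilon (J-1) \Lambda_{22} (4 \theta_\varepsilon \Lambda_{22}+3 J \Lambda_{22})-\beta_{11} \theta_{1_+} (\Lambda_{22} (\beta_{22} (7 J^{2}-13 J+6) \Lambda_{22}+(3 J-2) \Lambda_{21}))+2 \beta_{21} \theta_{1_+} \Lambda_{22}^{2} (4 \theta_\varepsilon+J+2))-2 A_1 \Lambda_{22} (\beta_{11}^{2} \theta_\varepsilon (J-1)+\theta_{1_+})+8 \beta_{21} \theta_\varepsilon \Lambda_{22}^{2} (\beta_{11}^{2} \theta_\varepsilon (J-1)+\theta_{1_+});$$ (P5) $$0=4 \beta_{11}^{2} \beta_{22} \theta_\varepsilon (J-1) \Lambda_{22}^{2} (J-2)^+ (A_1^{2} \theta_\varepsilon+A_1^{2} J+\theta_\varepsilon)+A_1^{2} (\beta_{11}^{2} \theta_\varepsilon (J-1) (\beta_{22} (\Lambda_{22}^{2} ((11-3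 J) J-2 \theta_\varepsilon (J-5)))+\Lambda_{21} \Lambda_{22} (2 \theta_\varepsilon+J))+2 \beta_{11} \beta_{21} \theta_\varepsilon (J-1) \Lambda_{22}^{2} (2 \theta_\varepsilon+J)+4 (\theta_\varepsilon+1) \theta_{1_+} \Lambda_{22} (\beta_{22} (J \Lambda_{22}+\Lambda_{22})+\Lambda_{21}))-2 A_1 \beta_{11} \theta_\varepsilon (J-1) \Lambda_{22}+2 \theta_\varepsilon (\beta_{11}^{2} \theta_\varepsilon (J-1) (\Lambda_{22} \Lambda_{21}-\beta_{22} (J-5) \Lambda_{22}^{2})+2 \beta_{11} \beta_{21} \theta_\varepsilon (J-1) \Lambda_{22}^{2}+2 \theta_{1_+} \Lambda_{22} (\beta_{22} (J+1) \Lambda_{22}+\Lambda_{21}));$$ (P6) $$0=\beta_{11}-\frac{2\left(-H\,[A_1^2(\beta_{11}\beta_{22}(J-1)+\beta_{21}(\theta_\varepsilon+1))+\beta_{21}\theta_\varepsilon]-\frac{A_1^3\beta_{11}^2(J-1)J}{V}+A_1\right)}{(A_1^2(\theta_\varepsilon+1)+\theta_\varepsilon)\,U},\qquad U=\frac{4A_1\beta_{11}J}{V}-\frac{H^2}{\Lambda_{22}};$$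 (P7) $$0<\Lambda_{22},\qquad 0<T,\qquad 0<U;$$ (P8) $$\Lambda_1=\frac{A_1}{A_1^2+1},\quad \Lambda_{1_+}=\frac{A_1\beta_{11}J}{V},\quad A_{21}=\frac1{2\Lambda_{22}},\quad \beta_{23}=-\frac{H}{2\Lambda_{22}},\quad \alpha_{22}=-\frac{\beta_{11}J\Lambda_{21}+J\Lambda_{22}[\beta_{21}+\beta_{23}\beta_{11}+(J-1)\beta_{22}\beta_{11}]}{2\Lambda_{22}}.$$ -/

import Mathlib

open MeasureTheory ProbabilityTheory

/-- The primitive random variables: the asset value `v`, the informed trader's private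
randomisation `z`, the noise orders `u1`, `u1p`, `u2` at times `1`, `1₊`, `2`, and the signal
noises `ε j` of the `J` high-frequency traders. -/
structure Shocks (Ω : Type*) (J : ℕ) where
  v : Ω → ℝ
  z : Ω → ℝ
  u1 : Ω → ℝ
  u1p : Ω → ℝ
  u2 : Ω → ℝ
  ε : Fin J → Ω → ℝ

/-- All the primitive random variables as one family. -/
def Shocks.family {Ω : Type*} {J : ℕ} (S : Shocks Ω J) : Fin 5 ⊕ Fin J → Ω → ℝ :=
  Sum.elim ![S.v, S.z, S.u1, S.u1p, S.u2] S.ε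

/-- The primitive random variables are independent and normal: `v ~ N(p0, σv²)`, `z ~ N(0, σz²)`,
`u1 ~ N(0, σ1²)`, `u1p ~ N(0, σ1p²)`, `u2 ~ N(0, σ2²)` and `ε j ~ N(0, σε²)`.
A normal law of variance zero is a point mass. -/
structure Shocks.HasNormalLaws {Ω : Type*} [MeasurableSpace Ω] {J : ℕ} (S : Shocks Ω J)
    (μ : Measure Ω) (p0 σv σz σ1 σ1p σ2 σε : ℝ) : Prop where
  meas : ∀ k, Measurable (S.family k)
  indep : iIndepFun S.family μ
  law_v : μ.map S.v = gaussianReal p0 (Real.toNNReal (σv ^ 2))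
  law_z : μ.map S.z = gaussianReal 0 (Real.toNNReal (σz ^ 2))
  law_u1 : μ.map S.u1 = gaussianReal 0 (Real.toNNReal (σ1 ^ 2))
  law_u1p : μ.map S.u1p = gaussianReal 0 (Real.toNNReal (σ1p ^ 2))
  law_u2 : μ.map S.u2 = gaussianReal 0 (Real.toNNReal (σ2 ^ 2))
  law_ε : ∀ j, μ.map (S.ε j) = gaussianReal 0 (Real.toNNReal (σε ^ 2))

/-- A collection of strategies of the dealers, the informed trader (IT) and the `J`
high-frequency traders (HFTs), as functions of what each of them observes:
* the dealers' prices `p1 y₁`, `p1p y₁ y₁₊`, `p2 y₁ y₁₊ y₂`;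
* IT's orders `i1 v z` (where `z` is the randomisation) and `i2 v i₁ y₁`;
* the orders `x1 j s y₁` and `x2 j s y₁ y₁₊ x` of the `j`-th HFT, where `s` is her signal about
  `i₁` and `x` is her own earlier order. -/
structure Profile (J : ℕ) where
  p1 : ℝ → ℝ
  p1p : ℝ → ℝ → ℝ
  p2 : ℝ → ℝ → ℝ → ℝ
  i1 : ℝ → ℝ → ℝ
  i2 : ℝ → ℝ → ℝ → ℝ
  x1 : Fin J → ℝ → ℝ → ℝ
  x2 : Fin J → ℝ → ℝ → ℝ → ℝ → ℝ

/-- All strategies are measurable functions. -/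
structure Profile.IsMeasurable {J : ℕ} (s : Profile J) : Prop where
  p1 : Measurable s.p1
  p1p : Measurable fun a : ℝ × ℝ => s.p1p a.1 a.2
  p2 : Measurable fun a : ℝ × ℝ × ℝ => s.p2 a.1 a.2.1 a.2.2
  i1 : Measurable fun a : ℝ × ℝ => s.i1 a.1 a.2
  i2 : Measurable fun a : ℝ × ℝ × ℝ => s.i2 a.1 a.2.1 a.2.2
  x1 : ∀ j, Measurable fun a : ℝ × ℝ => s.x1 j a.1 a.2
  x2 : ∀ j, Measurable fun a : ℝ × ℝ × ℝ × ℝ => s.x2 j a.1 a.2.1 a.2.2.1 a.2.2.2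

/-! The random quantities that arise when a profile `s` is played. -/

section Play

variable {Ω : Type*} {J : ℕ} (S : Shocks Ω J) (s : Profile J)

/-- IT's order executed at time `1`. -/
def orderI1 (ω : Ω) : ℝ := s.i1 (S.v ω) (S.z ω)

/-- Order flow at time `1`. -/
def flow1 (ω : Ω) : ℝ := orderI1 S s ω + S.u1 ω

/-- The signal of the `j`-th HFT about IT's first order. -/
def signal (j : Fin J) (ω : Ω) : ℝ := orderI1 S s ω + S.ε j ω

/-- The order of the `j`-th HFT executed at time `1₊`. -/
def orderX1 (j : Fin J) (ω : Ω) : ℝ := s.x1 j (signal S s j ω) (flow1 S s ω)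

/-- Order flow at time `1₊`. -/
def flow1p (ω : Ω) : ℝ := (∑ j, orderX1 S s j ω) + S.u1p ω

/-- IT's order executed at time `2`. -/
def orderI2 (ω : Ω) : ℝ := s.i2 (S.v ω) (orderI1 S s ω) (flow1 S s ω)

/-- The order of the `j`-th HFT executed at time `2`. -/
def orderX2 (j : Fin J) (ω : Ω) : ℝ :=
  s.x2 j (signal S s j ω) (flow1 S s ω) (flow1p S s ω) (orderX1 S s j ω)

/-- Order flow at time `2`. -/
def flow2 (ω : Ω) : ℝ := orderI2 S s ω + (∑ j, orderX2 S s j ω) + S.u2 ω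

/-- Transaction price at time `1`. -/
def price1 (ω : Ω) : ℝ := s.p1 (flow1 S s ω)

/-- Transaction price at time `1₊`. -/
def price1p (ω : Ω) : ℝ := s.p1p (flow1 S s ω) (flow1p S s ω)

/-- Transaction price at time `2`. -/
def price2 (ω : Ω) : ℝ := s.p2 (flow1 S s ω) (flow1p S s ω) (flow2 S s ω)

/-- IT's profit from her first order. -/
def profitI1 (ω : Ω) : ℝ := orderI1 S s ω * (S.v ω - price1 S s ω)

/-- IT's profit from her second order. -/
def profitI2 (ω : Ω) : ℝ := (S.v ω - price2 S s ω) * orderI2 S s ω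

/-- Profit of the `j`-th HFT from her first order. -/
def profitX1 (j : Fin J) (ω : Ω) : ℝ := (S.v ω - price1p S s ω) * orderX1 S s j ω

/-- Profit of the `j`-th HFT from her second order. -/
def profitX2 (j : Fin J) (ω : Ω) : ℝ := (S.v ω - price2 S s ω) * orderX2 S s j ω

/-- The inventory penalty of the `j`-th HFT, with inventory aversion `γ j`. -/
def penalty (γ : Fin J → ℝ) (j : Fin J) (ω : Ω) : ℝ :=
  γ j * (orderX1 S s j ω + orderX2 S s j ω) ^ 2

/-- What IT knows when she chooses her second order. -/
def infoI2 (ω : Ω) : ℝ × ℝ × ℝ := (S.v ω, orderI1 S s ω, flow1 S s ω)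

/-- What the `j`-th HFT knows when she chooses her first order. -/
def infoX1 (j : Fin J) (ω : Ω) : ℝ × ℝ := (signal S s j ω, flow1 S s ω)

/-- What the `j`-th HFT knows when she chooses her second order. -/
def infoX2 (j : Fin J) (ω : Ω) : ℝ × ℝ × ℝ := (signal S s j ω, flow1 S s ω, flow1p S s ω)

/-- The same profile, except that IT's first order is `f v z`. -/
def withI1 (f : ℝ → ℝ → ℝ) : Profile J := { s with i1 := f }

/-- The same profile, except that IT's second order is `g v i₁ y₁`. -/
def withI2 (g : ℝ → ℝ → ℝ → ℝ) : Profile J := { s with i2 := g }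

/-- The same profile, except that the first order of the `j`-th HFT is `f s y₁`. -/
def withX1 (j : Fin J) (f : ℝ → ℝ → ℝ) : Profile J := { s with x1 := Function.update s.x1 j f }

/-- The same profile, except that the second order of the `j`-th HFT is `g s y₁ y₁₊`. -/
def withX2 (j : Fin J) (g : ℝ → ℝ → ℝ → ℝ) : Profile J :=
  { s with x2 := Function.update s.x2 j fun a b c _ => g a b c }

end Play

section Equilibrium

variable {Ω : Type*} [MeasurableSpace Ω] [StandardBorelSpace Ω] {J : ℕ}

/-- The conditional expectation of `X` given `info`, as the integral of `X` against the regular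
conditional distribution. It is meaningful also if `X` is integrable only conditionally on `info`,
so that no integrability has to be imposed on the strategies. -/
noncomputable def condMean (μ : Measure Ω) [IsFiniteMeasure μ] {β : Type*} [MeasurableSpace β]
    (info : Ω → β) (X : Ω → ℝ) (ω : Ω) : ℝ :=
  ∫ ω', X ω' ∂(condExpKernel μ (MeasurableSpace.comap info inferInstance) ω)

/-- The dealers' weak-efficiency rule. -/
def DealersEfficient (μ : Measure Ω) (S : Shocks Ω J) (s : Profile J) : Prop :=
  price1 S s =ᵐ[μ] μ[S.v | MeasurableSpace.comap (flow1 S s) inferInstance] ∧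
  price1p S s =ᵐ[μ]
    μ[S.v | MeasurableSpace.comap (fun ω => (flow1 S s ω, flow1p S s ω)) inferInstance] ∧
  price2 S s =ᵐ[μ]
    μ[S.v | MeasurableSpace.comap
      (fun ω => (flow1 S s ω, flow1p S s ω, flow2 S s ω)) inferInstance]

/-- Whatever her first order was, IT's second order is the unique maximiser of her conditional
expected second-stage profit, over all measurable functions of `(v, i₁, y₁)`. -/
def ITSecondOptimal (μ : Measure Ω) [IsFiniteMeasure μ] (S : Shocks Ω J) (s : Profile J) : Prop :=
  ∀ f : ℝ → ℝ → ℝ, Measurable (fun a : ℝ × ℝ => f a.1 a.2) →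
  ∀ g : ℝ → ℝ → ℝ → ℝ, Measurable (fun a : ℝ × ℝ × ℝ => g a.1 a.2.1 a.2.2) →
    let t := withI1 s f
    ∀ᵐ ω ∂μ, orderI2 S (withI2 t g) ω ≠ orderI2 S t ω →
      condMean μ (infoI2 S t) (profitI2 S (withI2 t g)) ω <
        condMean μ (infoI2 S t) (profitI2 S t) ω

/-- IT is indifferent among all pure first orders `i₁ = f v`, given `v`. -/
def ITFirstIndifferent (μ : Measure Ω) [IsFiniteMeasure μ] (S : Shocks Ω J) (s : Profile J) :
    Prop :=
  ∀ f g : ℝ → ℝ, Measurable f → Measurable g →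
    let a := withI1 s fun v _ => f v
    let b := withI1 s fun v _ => g v
    condMean μ S.v (fun ω => profitI1 S a ω + profitI2 S a ω) =ᵐ[μ]
      condMean μ S.v (fun ω => profitI1 S b ω + profitI2 S b ω)

/-- IT's first order is a function of `v` alone, and it is the unique maximiser of her conditional
expected total profit, over all measurable functions of `v`. -/
def ITFirstOptimal (μ : Measure Ω) [IsFiniteMeasure μ] (S : Shocks Ω J) (s : Profile J) : Prop :=
  (∃ h : ℝ → ℝ, Measurable h ∧ orderI1 S s =ᵐ[μ] fun ω => h (S.v ω)) ∧
  ∀ f : ℝ → ℝ, Measurable f →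
    let t := withI1 s fun v _ => f v
    ∀ᵐ ω ∂μ, orderI1 S t ω ≠ orderI1 S s ω →
      condMean μ S.v (fun ω' => profitI1 S t ω' + profitI2 S t ω') ω <
        condMean μ S.v (fun ω' => profitI1 S s ω' + profitI2 S s ω') ω

/-- Whatever her first order was, the second order of the `j`-th HFT is the unique maximiser of her
conditional expected penalised second-stage profit, over all measurable functions of
`(signal, y₁, y₁₊)`. -/
def HFTSecondOptimal (μ : Measure Ω) [IsFiniteMeasure μ] (S : Shocks Ω J) (γ : Fin J → ℝ)
    (s : Profile J) (j : Fin J) : Prop :=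
  ∀ f : ℝ → ℝ → ℝ, Measurable (fun a : ℝ × ℝ => f a.1 a.2) →
  ∀ g : ℝ → ℝ → ℝ → ℝ, Measurable (fun a : ℝ × ℝ × ℝ => g a.1 a.2.1 a.2.2) →
    let t := withX1 s j f
    let t' := withX2 t j g
    ∀ᵐ ω ∂μ, orderX2 S t' j ω ≠ orderX2 S t j ω →
      condMean μ (infoX2 S t j) (fun ω' => profitX2 S t' j ω' - penalty S t' γ j ω') ω <
        condMean μ (infoX2 S t j) (fun ω' => profitX2 S t j ω' - penalty S t γ j ω') ω

/-- The first order of the `j`-th HFT is the unique maximiser of her conditional expected penalised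
total profit, over all measurable functions of `(signal, y₁)`. -/
def HFTFirstOptimal (μ : Measure Ω) [IsFiniteMeasure μ] (S : Shocks Ω J) (γ : Fin J → ℝ)
    (s : Profile J) (j : Fin J) : Prop :=
  ∀ f : ℝ → ℝ → ℝ, Measurable (fun a : ℝ × ℝ => f a.1 a.2) →
    let t := withX1 s j f
    ∀ᵐ ω ∂μ, orderX1 S t j ω ≠ orderX1 S s j ω →
      condMean μ (infoX1 S s j)
          (fun ω' => profitX1 S t j ω' + profitX2 S t j ω' - penalty S t γ j ω') ω <
        condMean μ (infoX1 S s j)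
          (fun ω' => profitX1 S s j ω' + profitX2 S s j ω' - penalty S s γ j ω') ω

/-- The conditions that are common to mixed-strategy and pure-strategy equilibria. -/
structure IsCommonEquilibrium (μ : Measure Ω) [IsFiniteMeasure μ] (S : Shocks Ω J)
    (γ : Fin J → ℝ) (s : Profile J) : Prop where
  measurable : s.IsMeasurable
  dealers : DealersEfficient μ S s
  it_second : ITSecondOptimal μ S s
  hft_second : ∀ j, HFTSecondOptimal μ S γ s j
  hft_first : ∀ j, HFTFirstOptimal μ S γ s j

/-- Mixed-strategy equilibrium. -/
def IsMixedEquilibrium (μ : Measure Ω) [IsFiniteMeasure μ] (S : Shocks Ω J)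
    (γ : Fin J → ℝ) (s : Profile J) : Prop :=
  IsCommonEquilibrium μ S γ s ∧ ITFirstIndifferent μ S s

/-- Pure-strategy equilibrium. -/
def IsPureEquilibrium (μ : Measure Ω) [IsFiniteMeasure μ] (S : Shocks Ω J)
    (γ : Fin J → ℝ) (s : Profile J) : Prop :=
  IsCommonEquilibrium μ S γ s ∧ ITFirstOptimal μ S s

/-- The function `m` is the (continuous) regression function of `X` on `Y`: `E(X | Y) = m(Y)`. -/
def IsRegression (μ : Measure Ω) (X Y : Ω → ℝ) (m : ℝ → ℝ) : Prop :=
  Continuous m ∧ (fun ω => m (Y ω)) =ᵐ[μ] μ[X | MeasurableSpace.comap Y inferInstance]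

end Equilibrium

/-- The coefficients of a linear profile in which all HFTs use the same strategy. -/
structure Coeffs where
  lam1 : ℝ
  lam1p : ℝ
  lam21 : ℝ
  lam22 : ℝ
  α1 : ℝ
  α21 : ℝ
  α22 : ℝ
  β11 : ℝ
  β21 : ℝ
  β22 : ℝ
  β23 : ℝ

/-- The profile `s` is linear with the given coefficients:
`p₁ = p0 + λ₁ y₁`, `p₁₊ = p₁ + λ₁₊ y₁₊`, `p₂ = p₁ + λ₂₁ y₁₊ + λ₂₂ y₂`, `i₁ = α₁ (v - p0) + z`,
`i₂ = α₂₁ (v - E(v | y₁)) + α₂₂ (i₁ - E(i₁ | y₁))`, `x₁ⱼ = β₁₁ (sⱼ - E(sⱼ | y₁))` and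
`x₂ⱼ = β₂₁ (sⱼ - E(sⱼ | y₁)) + β₂₂ (y₁₊ - x₁ⱼ) + β₂₃ x₁ⱼ`, where `sⱼ` is the signal of the `j`-th
HFT, and `y₁₊ - x₁ⱼ` is the sum of the other HFTs' orders and the noise order at time `1₊`. -/
def IsLinearProfile {Ω : Type*} [MeasurableSpace Ω] (μ : Measure Ω) {J : ℕ} (S : Shocks Ω J)
    (p0 : ℝ) (c : Coeffs) (s : Profile J) : Prop :=
  ∃ (mv mi : ℝ → ℝ) (ms : Fin J → ℝ → ℝ),
    IsRegression μ S.v (flow1 S s) mv ∧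
    IsRegression μ (orderI1 S s) (flow1 S s) mi ∧
    (∀ j, IsRegression μ (signal S s j) (flow1 S s) (ms j)) ∧
    s = { p1 := fun y1 => p0 + c.lam1 * y1
          p1p := fun y1 y1p => (p0 + c.lam1 * y1) + c.lam1p * y1p
          p2 := fun y1 y1p y2 => (p0 + c.lam1 * y1) + c.lam21 * y1p + c.lam22 * y2
          i1 := fun v z => c.α1 * (v - p0) + z
          i2 := fun v i1 y1 => c.α21 * (v - mv y1) + c.α22 * (i1 - mi y1)
          x1 := fun j sig y1 => c.β11 * (sig - ms j y1)
          x2 := fun j sig y1 y1p x1 =>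
            c.β21 * (sig - ms j y1) + c.β22 * (y1p - x1) + c.β23 * x1 }

/-! The dimensionless systems. The number `J` of HFTs is cast to a real number. -/

/-- Coefficient of `β11 ^ 0` in the first polynomial of the mixed-strategy system. -/
noncomputable def mixed1_coeff0 (J θ1p θ2 θε A θz β21 : ℝ) : ℝ :=
  θ1p * (A ^ 2 - β21 * J + θz + 1) * (A ^ 8 + (3 * θz - 4 * β21 * J) * A ^ 6 + (4 * J * (θε + J) *
  β21 ^ 2 - 8 * J * θz * β21 + 3 * θz ^ 2 + 4 * θ2 + θz - 2) * A ^ 4 + (4 * J * (θz * θε + θε + J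
  * θz) * β21 ^ 2 - 4 * J * (θz ^ 2 - 1) * β21 + (θz + 1) * (θz ^ 2 + θz + 4 * θ2)) * A ^ 2 + (θz
  + 1) ^ 3)

/-- The part of the coefficient of `β11 ^ 1` in the first polynomial of the mixed-strategy system
that is multiplied by `-J θ1p β23`. -/
noncomputable def mixed1_coeff1_β23 (J θ2 θε A θz β21 : ℝ) : ℝ :=
  5 * A ^ 8 + (-8 * β21 * (θε + 2 * J) + 15 * θz + 4) * A ^ 6 + (12 * J * (θε + J) * β21 ^ 2 - 8 *
  (4 * θz * J + J + 2 * θε * (θz + 1)) * β21 + 15 * θz ^ 2 + 4 * θ2 + 9 * θz - 6) * A ^ 4 + (12 *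
  J * (θz * θε + θε + J * θz) * β21 ^ 2 - 8 * (θz + 1) * (θz * θε + θε - J + 2 * J * θz) * β21 +
  (θz + 1) * (5 * θz ^ 2 + θz + 4 * θ2 - 4)) * A ^ 2 + (θz + 1) ^ 3

/-- The part of the coefficient of `β11 ^ 1` in the first polynomial of the mixed-strategy system
that is multiplied by `-J θ1p β22`. -/
noncomputable def mixed1_coeff1_β22 (J θ2 θε A θz β21 : ℝ) : ℝ :=
  (J - 5) * A ^ 8 + (8 * β21 * θε - 4 * β21 * (J - 4) * J - 15 * θz + J * (3 * θz + 2) - 4) *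
  A ^ 6 + (4 * (J - 3) * J * (θε + J) * β21 ^ 2 + 4 * (4 * θε * (θz + 1) - J * (2 * θz * J + J - 8
  * θz - 2)) * β21 + 4 * (J - 1) * θ2 + 3 * (θz + 1) * ((J - 5) * θz + 2)) * A ^ 4 + (4 * (J - 3)
  * J * (θz * θε + θε + J * θz) * β21 ^ 2 + 4 * (θz + 1) * (2 * θε * (θz + 1) - J * ((J - 4) * θz
  + 2)) * β21 + (θz + 1) * (-5 * θz ^ 2 - θz - 4 * θ2 + J * (θz ^ 2 - θz + 4 * θ2 - 2) + 4)) *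
  A ^ 2 - (J + 1) * (θz + 1) ^ 3

/-- The part of the coefficient of `β11 ^ 2` in the first polynomial of the mixed-strategy system
that is multiplied by `J θε (A ^ 2 + θz + 1)`. -/
noncomputable def mixed1_coeff2_θε (J θ1p θ2 A θz β21 β22 β23 : ℝ) : ℝ :=
  A ^ 8 + (3 * θz - β21 * J) * A ^ 6 + A ^ 4 * (4 * θ1p * β22 ^ 2 - 8 * β23 * θ1p * β22 + 3 *
  θz ^ 2 + 4 * β23 ^ 2 * θ1p + 4 * θ2 + θz - β21 * (2 * θz * J + J) - 2) + (β21 * J * (4 * (2 * J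
  - 3) * θ1p * β22 ^ 2 - 8 * β23 * (J - 3) * θ1p * β22 - θz ^ 2 - 12 * β23 ^ 2 * θ1p - 4 * θ2 + 1)
  + (θz + 1) * (4 * θ1p * β22 ^ 2 - 8 * β23 * θ1p * β22 + θz ^ 2 + 4 * β23 ^ 2 * θ1p + 4 * θ2 +
  θz)) * A ^ 2 + (θz + 1) ^ 2 * (β21 * J + θz + 1)

/-- The part of the coefficient of `β11 ^ 2` in the first polynomial of the mixed-strategy system
that is multiplied by `J ^ 2`. -/
noncomputable def mixed1_coeff2_J (J θ1p θ2 A θz β21 β22 β23 : ℝ) : ℝ :=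
  4 * (-(J - 2) * θ1p * β22 ^ 2 + β23 * (J - 4) * θ1p * β22 + 2 * β23 ^ 2 * θ1p + θ2) * A ^ 6 + (4
  * θ1p * (2 * β21 * J ^ 2 - (3 * β21 + 2 * θz + 1) * J + 4 * θz + 1) * β22 ^ 2 - 4 * β23 * θ1p *
  (2 * β21 * J ^ 2 - (6 * β21 + 2 * θz + 1) * J + 8 * θz + 2) * β22 - 4 * β21 * J * θ2 + β21 * J *
  θz + 8 * θ2 * θz + 4 * β23 ^ 2 * θ1p * (-3 * β21 * J + 4 * θz + 1)) * A ^ 4 + 2 * (-2 * θ1p *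
  ((J - 2) * θz ^ 2 + (-2 * β21 * J ^ 2 + 3 * β21 * J + J - 1) * θz + 1) * β22 ^ 2 + 2 * β22 * β23
  * θ1p * ((J - 4) * θz ^ 2 + (-2 * β21 * J ^ 2 + 6 * β21 * J + J - 2) * θz + 2) + β21 * J *
  θz ^ 2 + 2 * θ2 * θz ^ 2 - 2 * θ2 + β21 * J * θz - 2 * β21 * J * θ2 * θz + 2 * β23 ^ 2 * θ1p *
  (2 * θz ^ 2 - 3 * β21 * J * θz + θz - 1)) * A ^ 2 + β21 * J * θz * (θz + 1) ^ 2

/-- The part of the coefficient of `β11 ^ 3` in the first polynomial of the mixed-strategy system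
that is multiplied by `-(β23 + β22 (J - 1)) J ^ 2`. -/
noncomputable def mixed1_coeff3 (J θ1p θ2 θε A θz β22 β23 : ℝ) : ℝ :=
  J * ((4 * θ1p * β22 ^ 2 - 8 * β23 * θ1p * β22 + 4 * β23 ^ 2 * θ1p + 4 * θ2 - θz) * A ^ 4 - 2 *
  θz * (-2 * θ1p * β22 ^ 2 + 4 * β23 * θ1p * β22 - 2 * β23 ^ 2 * θ1p - 2 * θ2 + θz + 1) * A ^ 2 -
  θz * (θz + 1) ^ 2) + θε * (A ^ 2 + θz + 1) * (A ^ 6 + (2 * θz + 1) * A ^ 4 + (4 * θ1p * β22 ^ 2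
  - 8 * β23 * θ1p * β22 + θz ^ 2 + 4 * β23 ^ 2 * θ1p + 4 * θ2 - 1) * A ^ 2 - (θz + 1) ^ 2)

/-- First polynomial of the mixed-strategy system: the dealers' coefficient of `y₁₊` in `p₂`. -/
noncomputable def mixed1 (J θ1p θ2 θε A θz β11 β21 β22 β23 : ℝ) : ℝ :=
  J * (θε * (A ^ 2 + θz + 1) * (mixed1_coeff2_θε J θ1p θ2 A θz β21 β22 β23) +
      J * (mixed1_coeff2_J J θ1p θ2 A θz β21 β22 β23)) * β11 ^ 2 -
    J * θ1p * (β23 * (mixed1_coeff1_β23 J θ2 θε A θz β21) +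
      β22 * (mixed1_coeff1_β22 J θ2 θε A θz β21)) * β11 -
    β11 ^ 3 * (β23 + β22 * (J - 1)) * J ^ 2 * (mixed1_coeff3 J θ1p θ2 θε A θz β22 β23) +
    mixed1_coeff0 J θ1p θ2 θε A θz β21

/-- Second polynomial of the mixed-strategy system: the dealers' coefficient of `y₂` in `p₂`. -/
noncomputable def mixed2 (J θ1p θ2 θε A θz β11 β21 β22 β23 : ℝ) : ℝ :=
  4 * A ^ 2 * β11 * J * θ1p * (β22 - β23) * (A ^ 4 + A ^ 2 * (-2 * β21 * (θε + J) + 2 * θz + 1) -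
  2 * β21 * (θε * θz + θε + J * θz) + θz * (θz + 1)) + β11 ^ 2 * J * (J * (A ^ 4 * (4 * β22 ^ 2 *
  θ1p - 8 * β22 * β23 * θ1p + 4 * β23 ^ 2 * θ1p + 4 * θ2 - θz) - 2 * A ^ 2 * θz * (-2 * β22 ^ 2 *
  θ1p + 4 * β22 * β23 * θ1p - 2 * β23 ^ 2 * θ1p - 2 * θ2 + θz + 1) - θz * (θz + 1) ^ 2) + θε *
  (A ^ 2 + θz + 1) * (A ^ 6 + A ^ 4 * (2 * θz + 1) + A ^ 2 * (4 * β22 ^ 2 * θ1p - 8 * β22 * β23 *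
  θ1p + 4 * β23 ^ 2 * θ1p + 4 * θ2 + θz ^ 2 - 1) - (θz + 1) ^ 2)) + θ1p * (A ^ 8 + A ^ 6 * (-4 *
  β21 * J + 3 * θz + 2) + A ^ 4 * (4 * β21 ^ 2 * J * (θε + J) - 4 * β21 * (2 * J * θz + J) + 4 *
  θ2 + 3 * θz * (θz + 1)) + A ^ 2 * (4 * β21 ^ 2 * J * (θε * θz + θε + J * θz) - 4 * β21 * J * θz
  * (θz + 1) + (θz + 1) * (4 * θ2 + θz ^ 2 - θz - 2)) - (θz + 1) ^ 3)

/-- Third polynomial of the mixed-strategy system: the HFTs' coefficient `β21`. -/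
noncomputable def mixed3 (J θ1p θε A θz β11 β21 β22 β23 : ℝ) : ℝ :=
  2 * A * β11 * β22 * (J - 1) * θ1p * (A ^ 2 + θz) * max (J - 2) 0 - A ^ 5 * (β11 ^ 2 * θε * (J -
  1) + θ1p) + 2 * A ^ 3 * (β11 ^ 2 * θε * (J - 1) * (2 * β21 * (θε + J) - θz - 1) + β11 * (J - 1)
  * θ1p * (β22 * (-J) + β22 + β23) + θ1p * (β21 * (2 * θε + J + 1) - θz - 1)) + A * (β11 ^ 2 * θε
  * (J - 1) * (4 * β21 * (θε * θz + θε + J * θz) - (θz + 1) ^ 2) + 2 * β11 * (J - 1) * θ1p * θz *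
  (β22 * (-J) + β22 + β23) + θ1p * (4 * β21 * θε * (θz + 1) + 2 * β21 * (J + 1) * θz - (θz +
  1) ^ 2))

/-- Fourth polynomial of the mixed-strategy system: the HFTs' coefficient `β22`. -/
noncomputable def mixed4 (J θ1p θε A θz β11 β21 β22 β23 : ℝ) : ℝ :=
  2 * A * β11 ^ 3 * β22 * θε * (J - 1) * J * max (J - 2) 0 * (θε * (A ^ 2 + θz + 1) + J * (A ^ 2 +
  θz)) + A ^ 5 * (β11 ^ 2 * θε * (J - 1) * (2 * θε + J) + 2 * (θε + 1) * θ1p) - 2 * A ^ 3 *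
  (β11 ^ 3 * β22 * θε * (J - 3) * (J - 1) * J * (θε + J) - β11 ^ 2 * θε * (J - 1) * (2 * θε * (θz
  + 1) + J * θz) - β11 * (θε + 1) * J * θ1p * (2 * β22 - β23) + θ1p * (β21 * θε * J + β21 * J - 2
  * (θε + 1) * θz - 2 * θε - 1)) + A * (-2 * β11 ^ 3 * β22 * θε * (J - 3) * (J - 1) * J * (θz *
  (θε + J) + θε) + β11 ^ 2 * θε * (J - 1) * (θz + 1) * (2 * θε * (θz + 1) + J * (θz - 1)) + 2 *
  β11 * J * θ1p * (2 * β22 - β23) * (θε * θz + θε + θz) - 2 * θ1p * (θε * θz + θε + θz) * (β21 * J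
  - θz - 1))

/-- Second-order expression of the HFTs' first order in a mixed-strategy equilibrium. -/
noncomputable def mixedSOC (J θ1p θε A θz β11 β23 : ℝ) : ℝ :=
  A * β11 * J / (β11 ^ 2 * J * (θε * (A ^ 2 + θz + 1) + J * (A ^ 2 + θz)) + θ1p * (A ^ 2 + θz +
  1)) - A * β23 ^ 2 / (A ^ 2 + θz + 1)

/-- Numerator of the HFTs' coefficient `β11` in a mixed-strategy equilibrium. -/
noncomputable def mixed6_num (J θ1p θε A θz β11 β21 β22 β23 : ℝ) : ℝ :=
  -(A * β11 ^ 2 * (J - 1) * J * (A ^ 2 + θz) / (β11 ^ 2 * J * (θε * (A ^ 2 + θz + 1) + J * (A ^ 2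
  + θz)) + θ1p * (A ^ 2 + θz + 1))) + 2 * A * β23 * (A ^ 2 * (β11 * β22 * (J - 1) + β21 * (θε +
  1)) + β11 * β22 * (J - 1) * θz + β21 * (θε * θz + θε + θz)) / (A ^ 2 + θz + 1) + A

/-- The equality-inequality system of the mixed-strategy equilibrium. -/
def MixedSystem (J θ1p θ2 θε A θz β11 β21 β22 β23 : ℝ) : Prop :=
  0 = mixed1 J θ1p θ2 θε A θz β11 β21 β22 β23 ∧
  0 = mixed2 J θ1p θ2 θε A θz β11 β21 β22 β23 ∧
  0 = mixed3 J θ1p θε A θz β11 β21 β22 β23 ∧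
  0 = mixed4 J θ1p θε A θz β11 β21 β22 β23 ∧
  0 = A ^ 3 + A * (β11 * β23 * J - β21 * J + θz + 1) ∧
  0 = β11 - mixed6_num J θ1p θε A θz β11 β21 β22 β23 /
    (2 * (A ^ 2 * (θε + 1) + θε * θz + θε + θz) * (mixedSOC J θ1p θε A θz β11 β23)) ∧
  0 < mixedSOC J θ1p θε A θz β11 β23 ∧
  0 < A ∧
  0 < θz

/-- The closed forms of the remaining coefficients in the mixed-strategy equilibrium. -/
def MixedClosedForms (J θ1p θε A θz β11 β21 β22 β23 Λ1 Λ1p Λ21 Λ22 A21 α22 : ℝ) : Prop :=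
  Λ1 = A / (A ^ 2 + θz + 1) ∧
  Λ1p = A * β11 * J /
    (β11 ^ 2 * J * (θε * (A ^ 2 + θz + 1) + J * (A ^ 2 + θz)) + θ1p * (A ^ 2 + θz + 1)) ∧
  Λ21 = (A - A * J * (β11 * (β22 * (J - 1) + β23) + β21) / (A ^ 2 + θz + 1)) / (β11 * J) ∧
  Λ22 = Λ1 ∧
  A21 = 1 / (2 * Λ22) ∧
  α22 = -((A ^ 2 + θz + 1) / 2)

/-- The part of the coefficient of `β11 ^ 2` in the first polynomial of the pure-strategy system
that is multiplied by `-J`. -/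
noncomputable def pure1_coeff2 (J θ1p θ2 θε Λ21 Λ22 A β21 β22 : ℝ) : ℝ :=
  4 * θε * (Λ22 ^ 2 * (β22 * Λ22 * (2 * (A ^ 2 + 1) * (J + 1) * Λ21 ^ 2 * θ1p - 2 * A * β21 * (J -
  1) * J * Λ22 + J - 1) + Λ21 * (4 * (A ^ 2 + 1) * Λ22 ^ 2 * θ2 + A * (β21 * J * Λ22 * (A * β21 *
  J * Λ22 - 2) + A * Λ21 ^ 2 * θ1p) + Λ21 ^ 2 * θ1p) + (A ^ 2 + 1) * β22 ^ 2 * (J + 1) ^ 2 * Λ21 *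
  Λ22 ^ 2 * θ1p)) + A ^ 2 * J * Λ21 * (θ1p * (Λ22 * (3 * β22 * J * Λ22 + β22 * Λ22 + 3 * Λ21)) ^ 2
  + 16 * Λ22 ^ 4 * θ2)

/-- The part of the coefficient of `β11 ^ 1` in the first polynomial of the pure-strategy system
that is multiplied by `4 J Λ22`. -/
noncomputable def pure1_coeff1 (J θ1p θ2 θε Λ21 Λ22 A β21 β22 : ℝ) : ℝ :=
  β21 * Λ22 * (4 * (A ^ 2 + 1) * θε * Λ21 * Λ22 * θ1p * (β22 * (J + 1) * Λ22 + Λ21) + A ^ 2 * J *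
  Λ21 * θ1p * (Λ22 * (3 * β22 * J * Λ22 + β22 * Λ22 + 3 * Λ21)) - 2 * θε * Λ22) + 2 * A * β21 ^ 2
  * θε * J * Λ22 ^ 3 + A * θ1p * (β22 * J * Λ22 + Λ21) * (Λ22 * (3 * β22 * J * Λ22 + β22 * Λ22 + 3
  * Λ21)) + 4 * A * Λ22 ^ 3 * θ2

/-- The part of the coefficient of `β11 ^ 0` in the first polynomial of the pure-strategy system
that is multiplied by `-4 θ1p Λ22 ^ 2`. -/
noncomputable def pure1_coeff0 (J θ2 θε Λ21 Λ22 A β21 β22 : ℝ) : ℝ :=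
  Λ21 * Λ22 * (4 * (A ^ 2 + 1) * Λ22 * θ2 + β21 * J * (A * (A * β21 * Λ22 * (4 * θε + J) + 2) + 4
  * β21 * θε * Λ22)) + 2 * β22 * J * Λ22 * (A * β21 * J * Λ22 + 1) + Λ21

/-- First polynomial of the pure-strategy system: the dealers' coefficient of `y₁₊` in `p₂`. -/
noncomputable def pure1 (J θ1p θ2 θε Λ21 Λ22 A β11 β21 β22 : ℝ) : ℝ :=
  -A ^ 2 * β11 ^ 4 * θε * J ^ 3 * Λ21 * (Λ22 * (β22 * (J - 1) * Λ22 + Λ21)) ^ 2 -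
    β11 ^ 2 * J * (pure1_coeff2 J θ1p θ2 θε Λ21 Λ22 A β21 β22) +
    4 * β11 * J * Λ22 * (pure1_coeff1 J θ1p θ2 θε Λ21 Λ22 A β21 β22) -
    4 * θ1p * Λ22 ^ 2 * (pure1_coeff0 J θ2 θε Λ21 Λ22 A β21 β22) -
    2 * A * β11 ^ 3 * θε * J ^ 2 * (Λ22 * (β22 * (J - 1) * Λ22 + Λ21)) * (Λ22 ^ 2 * (2 * A * β21 *
    J * Λ21 + β22 * (-J) + β22) - Λ21 * Λ22)

/-- Second polynomial of the pure-strategy system: the dealers' coefficient of `y₂` in `p₂`. -/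
noncomputable def pure2 (J θ1p θ2 θε Λ21 Λ22 A β11 β21 β22 : ℝ) : ℝ :=
  -A ^ 2 * β11 ^ 4 * θε * J ^ 3 * (Λ22 * (β22 * (J - 1) * Λ22 + Λ21)) ^ 2 - 4 * A ^ 2 * β11 ^ 3 *
  β21 * θε * J ^ 3 * Λ22 ^ 3 * (β22 * (J - 1) * Λ22 + Λ21) - β11 ^ 2 * J * (4 * θε * (Λ22 ^ 2 *
  (A ^ 2 * (β21 ^ 2 * J ^ 2 * Λ22 ^ 2 + θ1p * (β22 * (J + 1) * Λ22 + Λ21) ^ 2 + 4 * Λ22 ^ 2 * θ2)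
  + θ1p * (β22 * (J + 1) * Λ22 + Λ21) ^ 2 + 4 * Λ22 ^ 2 * θ2 - 1)) + A ^ 2 * J * (θ1p * (Λ22 * (3
  * β22 * J * Λ22 + β22 * Λ22 + 3 * Λ21)) ^ 2 + 16 * Λ22 ^ 4 * θ2)) + 4 * β11 * β21 * J * Λ22 ^ 2
  * θ1p * (Λ22 * (4 * (A ^ 2 + 1) * θε * Λ21 + 3 * A ^ 2 * J * Λ21) + β22 * Λ22 ^ 2 * (4 * (A ^ 2
  + 1) * θε * (J + 1) + A ^ 2 * J * (3 * J + 1))) - 4 * θ1p * Λ22 ^ 2 * (Λ22 ^ 2 * (β21 ^ 2 * J *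
  (4 * (A ^ 2 + 1) * θε + A ^ 2 * J) + 4 * (A ^ 2 + 1) * θ2) - 1)

/-- Second-order expression of IT's first order in a pure-strategy equilibrium. -/
noncomputable def pureSOC1 (J Λ21 Λ22 A β11 β21 β22 : ℝ) : ℝ :=
  A / (A ^ 2 + 1) - (2 * A * Λ22 + J * (β11 * Λ22 * (β22 * (J - 1) * Λ22 + Λ21) + 2 * β21 *
  Λ22 ^ 2)) ^ 2 / (16 * (A ^ 2 + 1) ^ 2 * Λ22 ^ 3)

/-- Fourth polynomial of the pure-strategy system: the HFTs' coefficient `β21`. -/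
noncomputable def pure4 (J θ1p θε Λ21 Λ22 A β11 β21 β22 : ℝ) : ℝ :=
  4 * A ^ 2 * β11 * β22 * (J - 1) * Λ22 ^ 2 * θ1p * max (J - 2) 0 + A ^ 2 * (-β11 ^ 3 * θε * (J -
  1) * J * (Λ22 * (β22 * (J - 1) * Λ22 + Λ21)) + 2 * β11 ^ 2 * β21 * θε * (J - 1) * Λ22 * (4 * θε
  * Λ22 + 3 * J * Λ22) - β11 * θ1p * (Λ22 * (β22 * (7 * J ^ 2 - 13 * J + 6) * Λ22 + (3 * J - 2) *
  Λ21)) + 2 * β21 * θ1p * Λ22 ^ 2 * (4 * θε + J + 2)) - 2 * A * Λ22 * (β11 ^ 2 * θε * (J - 1) +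
  θ1p) + 8 * β21 * θε * Λ22 ^ 2 * (β11 ^ 2 * θε * (J - 1) + θ1p)

/-- Fifth polynomial of the pure-strategy system: the HFTs' coefficient `β22`. -/
noncomputable def pure5 (J θ1p θε Λ21 Λ22 A β11 β21 β22 : ℝ) : ℝ :=
  4 * β11 ^ 2 * β22 * θε * (J - 1) * Λ22 ^ 2 * max (J - 2) 0 * (A ^ 2 * θε + A ^ 2 * J + θε) +
  A ^ 2 * (β11 ^ 2 * θε * (J - 1) * (β22 * (Λ22 ^ 2 * ((11 - 3 * J) * J - 2 * θε * (J - 5))) + Λ21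
  * Λ22 * (2 * θε + J)) + 2 * β11 * β21 * θε * (J - 1) * Λ22 ^ 2 * (2 * θε + J) + 4 * (θε + 1) *
  θ1p * Λ22 * (β22 * (J * Λ22 + Λ22) + Λ21)) - 2 * A * β11 * θε * (J - 1) * Λ22 + 2 * θε *
  (β11 ^ 2 * θε * (J - 1) * (Λ22 * Λ21 - β22 * (J - 5) * Λ22 ^ 2) + 2 * β11 * β21 * θε * (J - 1) *
  Λ22 ^ 2 + 2 * θ1p * Λ22 * (β22 * (J + 1) * Λ22 + Λ21))

/-- Second-order expression of the HFTs' first order in a pure-strategy equilibrium. -/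
noncomputable def pureSOC2 (J θ1p θε Λ21 Λ22 A β11 β22 : ℝ) : ℝ :=
  4 * A * β11 * J / (β11 ^ 2 * J * (A ^ 2 * θε + A ^ 2 * J + θε) + (A ^ 2 + 1) * θ1p) - (β22 * (J
  - 1) * Λ22 + Λ21) ^ 2 / Λ22

/-- Numerator of the HFTs' coefficient `β11` in a pure-strategy equilibrium. -/
noncomputable def pure6_num (J θ1p θε Λ21 Λ22 A β11 β21 β22 : ℝ) : ℝ :=
  2 * (-(β22 * (J - 1) * Λ22 + Λ21) * (A ^ 2 * (β11 * β22 * (J - 1) + β21 * (θε + 1)) + β21 * θε)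
  - A ^ 3 * β11 ^ 2 * (J - 1) * J / (β11 ^ 2 * J * (A ^ 2 * θε + A ^ 2 * J + θε) + (A ^ 2 + 1) *
  θ1p) + A)

/-- The equality-inequality system of the pure-strategy equilibrium. -/
def PureSystem (J θ1p θ2 θε Λ21 Λ22 A β11 β21 β22 : ℝ) : Prop :=
  0 = pure1 J θ1p θ2 θε Λ21 Λ22 A β11 β21 β22 ∧
  0 = pure2 J θ1p θ2 θε Λ21 Λ22 A β11 β21 β22 ∧
  0 = (-4 * A ^ 2 * Λ22 ^ 2 + 2 * A * Λ22 + β11 * J * (Λ22 * (β22 * (J - 1) * Λ22 + Λ21)) +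
      2 * Λ22 ^ 2 * (β21 * J - 2)) /
    (8 * (A ^ 2 + 1) * Λ22 ^ 2 * (pureSOC1 J Λ21 Λ22 A β11 β21 β22)) + A ∧
  0 = pure4 J θ1p θε Λ21 Λ22 A β11 β21 β22 ∧
  0 = pure5 J θ1p θε Λ21 Λ22 A β11 β21 β22 ∧
  0 = β11 - pure6_num J θ1p θε Λ21 Λ22 A β11 β21 β22 /
    ((A ^ 2 * (θε + 1) + θε) * (pureSOC2 J θ1p θε Λ21 Λ22 A β11 β22)) ∧
  0 < Λ22 ∧
  0 < pureSOC1 J Λ21 Λ22 A β11 β21 β22 ∧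
  0 < pureSOC2 J θ1p θε Λ21 Λ22 A β11 β22

/-- The closed forms of the remaining coefficients in the pure-strategy equilibrium. -/
def PureClosedForms (J θ1p θε Λ21 Λ22 A β11 β21 β22 Λ1 Λ1p A21 α22 β23 : ℝ) : Prop :=
  Λ1 = A / (A ^ 2 + 1) ∧
  Λ1p = A * β11 * J / (β11 ^ 2 * J * (θε * (A ^ 2 + 1) + J * A ^ 2) + θ1p * (A ^ 2 + 1)) ∧
  A21 = 1 / (2 * Λ22) ∧
  α22 = -((β11 * J * Λ21 + J * Λ22 * (β21 + β23 * β11 + (J - 1) * β22 * β11)) / (2 * Λ22)) ∧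
  β23 = -((β22 * (J - 1) * Λ22 + Λ21) / (2 * Λ22))

/-! Each trader's conditional expected profit is a quadratic polynomial in her own current order. A
measurable rule is therefore its unique maximiser exactly when the polynomial is strictly concave
and the rule sits at the vertex almost surely (`quadratic_unique_max_iff`,
`unique_max_condMean_iff`). Once value is measured in units of `σv` and orders in units of `σ1`,
pricing errors and first-order conditions along the linear profile are combinations of independent
centred normals. For such variables a vanishing conditional mean amounts to finitely many vanishing
covariances (`condExp_comb_eq_zero_iff`). Equilibrium thus becomes a finite system in the
coefficients.

Optimality of a second order is demanded after every own first order. Testing the constant first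
orders 0 and 1 separates the reaction to one's own order from the covariance conditions. For the
informed trader this even forces `lam1` to be the regression slope of the value on the first order
flow. With her second order optimal, her total profit from a first order `f`, given `v`, is a
quadratic in `f` whose coefficients depend on `carry`, the effect of her first order on her second
(`condMean_it_first`). Indifference means that the linear and the quadratic coefficient both vanish;
a unique pure optimum means strict concavity and the vertex equation.

What remains is algebra. The two conditions for `p2` and the two for an HFT's second order are pairs
of normal equations whose Gram matrices are nonsingular: `u2` enters `y2` but not `y1+`, and `u1+`
enters the other traders' flow but not the own signal. A pair holds if and only if its two Cramer
numerators vanish (`pair_eq_zero_iff`), and after the closed forms are substituted these numerators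
are the stated polynomials up to nonzero factors (`mixed1_eq` to `mixed4_eq`, and the pure
analogues). The sign conditions guarantee that every division is legitimate: they give a positive
`α1` and, in the mixed case, a nonzero `β11`. -/

/-! ### Conditional means through regular conditional distributions -/

section ConditionalMeans

/-- Under the regular conditional distribution, a random variable that is measurable with respect
to the conditioning σ-algebra is almost surely constant. -/
lemma condExpKernel_ae_eq_const {Ω : Type*} {m mΩ : MeasurableSpace Ω} [StandardBorelSpace Ω]
    (μ : Measure Ω) [IsFiniteMeasure μ] {β : Type*} [MeasurableSpace β] [MeasurableEq β]
    {info : Ω → β} (hm : m ≤ mΩ) (hinfo : Measurable[m] info) :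
    ∀ᵐ ω ∂μ, ∀ᵐ ω' ∂(condExpKernel μ m ω), info ω' = info ω := by
  have hset : @MeasurableSet (Ω × Ω) (m.prod mΩ) {p | info p.2 = info p.1} := by
    have h1 : @Measurable (Ω × Ω) β (m.prod mΩ) _ fun p => info p.2 :=
      @Measurable.comp (Ω × Ω) Ω β (m.prod mΩ) mΩ _ _ _ (hinfo.mono hm le_rfl)
        (@measurable_snd Ω Ω m mΩ)
    have h2 : @Measurable (Ω × Ω) β (m.prod mΩ) _ fun p => info p.1 :=
      @Measurable.comp (Ω × Ω) Ω β (m.prod mΩ) m _ _ _ hinfo (@measurable_fst Ω Ω m mΩ)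
    exact measurableSet_eq_fun h1 h2
  -- Drawing `ω` and then `ω'` from the conditional law at `ω` yields the image of `μ` on the
  -- diagonal, where the two values of `info` coincide.
  have h : ∀ᵐ p ∂((μ.trim hm) ⊗ₘ condExpKernel μ m), info p.2 = info p.1 := by
    rw [compProd_trim_condExpKernel hm]
    have hd : @Measurable Ω (Ω × Ω) mΩ (m.prod mΩ) Function.diag :=
      (measurable_id'' hm).prodMk measurable_id
    refine (@ae_map_iff Ω (Ω × Ω) mΩ (m.prod mΩ) μ Function.diag
      (@Measurable.aemeasurable _ _ _ (m.prod mΩ) _ _ hd) _ hset).2 ?_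
    exact Filter.Eventually.of_forall fun _ => rfl
  exact ae_of_ae_trim hm (Measure.ae_ae_of_ae_compProd h)

variable {Ω : Type*} [mΩ : MeasurableSpace Ω] [StandardBorelSpace Ω]

/-- What is known can be taken out of the conditional mean; the known factors need not be
integrable. -/
lemma condMean_sum (μ : Measure Ω) [IsFiniteMeasure μ] {β : Type*}
    [MeasurableSpace β] [MeasurableEq β] {info : Ω → β} (hinfo : Measurable info)
    {n : ℕ} (a : Fin n → β → ℝ) {Y : Fin n → Ω → ℝ} (hY : ∀ i, Integrable (Y i) μ) :
    condMean μ info (fun ω => ∑ i, a i (info ω) * Y i ω) =ᵐ[μ]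
      fun ω => ∑ i, a i (info ω) * (μ[Y i | MeasurableSpace.comap info inferInstance]) ω := by
  have h1 : ∀ᵐ ω ∂μ, ∀ i, Integrable (Y i)
      (condExpKernel μ (MeasurableSpace.comap info inferInstance) ω) :=
    ae_all_iff.2 fun i => (hY i).condExpKernel_ae
  have h2 : ∀ᵐ ω ∂μ, ∀ i, (μ[Y i | MeasurableSpace.comap info inferInstance]) ω =
      ∫ ω', Y i ω' ∂(condExpKernel μ (MeasurableSpace.comap info inferInstance) ω) :=
    ae_all_iff.2 fun i => condExp_ae_eq_integral_condExpKernel hinfo.comap_le (hY i)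
  filter_upwards [condExpKernel_ae_eq_const μ hinfo.comap_le (comap_measurable info), h1, h2] with ω h0 h1 h2
  calc condMean μ info (fun ω => ∑ i, a i (info ω) * Y i ω) ω
      = ∫ ω', ∑ i, a i (info ω) * Y i ω'
          ∂(condExpKernel μ (MeasurableSpace.comap info inferInstance) ω) := by
        refine integral_congr_ae ?_
        filter_upwards [h0] with ω' h
        rw [h]
    _ = _ := by
        rw [integral_finsetSum _ fun i _ => (h1 i).const_mul _]
        refine Finset.sum_congr rfl fun i _ => ?_
        rw [integral_const_mul, h2]

/-- Averaging the conditional laws gives back `μ`, so a `μ`-null set is null for almost every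
conditional law. This lets a first order that is only almost surely a function of `v` be replaced by
that function. -/
lemma condMean_congr_ae (μ : Measure Ω) [IsFiniteMeasure μ] {β : Type*}
    [MeasurableSpace β] {info : Ω → β} (hinfo : Measurable info) {X Y : Ω → ℝ} (h : X =ᵐ[μ] Y) :
    condMean μ info X =ᵐ[μ] condMean μ info Y := by
  have hm : MeasurableSpace.comap info inferInstance ≤ mΩ := hinfo.comap_le
  have h' : ∀ᵐ ω ∂μ, ∀ᵐ ω' ∂(condExpKernel μ (MeasurableSpace.comap info inferInstance) ω),
      X ω' = Y ω' := by
    have : ∀ᵐ ω' ∂(condExpKernel μ (MeasurableSpace.comap info inferInstance) ∘ₘ μ.trim hm),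
        X ω' = Y ω' := by
      rw [condExpKernel_comp_trim hm]; exact h
    exact ae_of_ae_trim hm (Measure.ae_ae_of_ae_comp this)
  filter_upwards [h'] with ω hω
  exact integral_congr_ae hω

end ConditionalMeans

/-! ### Unique maximisers of quadratic objectives -/

section UniqueMaximiser

variable {Ω β : Type*} [MeasurableSpace Ω] [MeasurableSpace β]

/-- A strategy is the pointwise unique maximiser of a quadratic objective if and only if the
objective is strictly concave and the first-order condition holds. -/
lemma quadratic_unique_max_iff {μ : Measure Ω} [NeZero μ] {info : Ω → β} {α gs : β → ℝ}
    (hα : Measurable α) (hgs : Measurable gs) (K : ℝ) :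
    (∀ g : β → ℝ, Measurable g → ∀ᵐ ω ∂μ, g (info ω) ≠ gs (info ω) →
        g (info ω) * α (info ω) - K * g (info ω) ^ 2 <
          gs (info ω) * α (info ω) - K * gs (info ω) ^ 2) ↔
      0 < K ∧ ∀ᵐ ω ∂μ, α (info ω) = 2 * K * gs (info ω) := by
  constructor
  · intro h
    have hK : 0 < K := by
      -- In the sum of the inequalities for the shifts by +1 and -1 the linear terms cancel, which
      -- leaves `-2K < 0`.
      have h1 := h (fun b => gs b + 1) (by fun_prop)
      have h2 := h (fun b => gs b - 1) (by fun_prop)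
      obtain ⟨ω, h1, h2⟩ := (h1.and h2).exists
      have h1 := h1 (by simp)
      have h2 := h2 (by simp)
      nlinarith
    refine ⟨hK, ?_⟩
    -- The vertex is itself an admissible rule; if it differed from `gs`, completing the square
    -- would contradict the maximality of `gs`.
    filter_upwards [h (fun b => α b / (2 * K)) (by fun_prop)] with ω hω
    by_contra hne
    have hlt := hω fun he => hne (by
      rw [← he]; field_simp)
    have : α (info ω) / (2 * K) * α (info ω) - K * (α (info ω) / (2 * K)) ^ 2
        = gs (info ω) * α (info ω) - K * gs (info ω) ^ 2
          + K * (α (info ω) / (2 * K) - gs (info ω)) ^ 2 := by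
      field_simp; ring
    have h3 := mul_nonneg hK.le (sq_nonneg (α (info ω) / (2 * K) - gs (info ω)))
    linarith
  · rintro ⟨hK, h⟩ g -
    filter_upwards [h] with ω hω hne
    have h3 := mul_pos hK (pow_pos (abs_pos.2 (sub_ne_zero.2 hne)) 2)
    rw [sq_abs] at h3
    rw [hω]
    nlinarith

end UniqueMaximiser

/-! ### Gaussian combinations: zero covariance and conditional means -/

section Gaussian

variable {Ω : Type*} [mΩ : MeasurableSpace Ω] {μ : Measure Ω}

/-- A family of centred, jointly Gaussian, uncorrelated random variables `X k` with
variances `τ k`. -/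
structure IsGaussianBasis {ι : Type*} [Fintype ι] [DecidableEq ι] (μ : Measure Ω) (X : ι → Ω → ℝ)
    (τ : ι → ℝ) : Prop where
  meas : ∀ k, Measurable (X k)
  gauss : HasGaussianLaw (fun ω k => X k ω) μ
  mean : ∀ k, ∫ ω, X k ω ∂μ = 0
  cov : ∀ k l, cov[X k, X l; μ] = if k = l then τ k else 0

namespace IsGaussianBasis

variable {ι : Type*} [Fintype ι] [DecidableEq ι] {X : ι → Ω → ℝ} {τ : ι → ℝ}

/-- The linear combination of the `X k` with weights `a k`. -/
def lin (X : ι → Ω → ℝ) (a : ι → ℝ) (ω : Ω) : ℝ := ∑ k, a k * X k ω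

lemma measurable_lin (h : IsGaussianBasis μ X τ) (a : ι → ℝ) : Measurable (lin X a) :=
  Finset.measurable_sum _ fun k _ => (h.meas k).const_mul _

lemma memLp (h : IsGaussianBasis μ X τ) (k : ι) : MemLp (X k) 2 μ := (h.gauss.eval k).memLp_two

lemma memLp_lin (h : IsGaussianBasis μ X τ) (a : ι → ℝ) : MemLp (lin X a) 2 μ :=
  memLp_finsetSum _ fun k _ => (h.memLp k).const_mul _

lemma integrable_lin (h : IsGaussianBasis μ X τ) (a : ι → ℝ) : Integrable (lin X a) μ := by
  have := h.gauss.isProbabilityMeasure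
  exact (h.memLp_lin a).integrable (by norm_num)

lemma integral_lin (h : IsGaussianBasis μ X τ) (a : ι → ℝ) : ∫ ω, lin X a ω ∂μ = 0 := by
  have := h.gauss.isProbabilityMeasure
  unfold lin
  rw [integral_finsetSum _ fun k _ => ((h.memLp k).integrable (by norm_num)).const_mul _]
  simp [integral_const_mul, h.mean]

lemma integral_lin_mul_lin (h : IsGaussianBasis μ X τ) (a b : ι → ℝ) :
    ∫ ω, lin X a ω * lin X b ω ∂μ = ∑ k, τ k * (a k * b k) := by
  have := h.gauss.isProbabilityMeasure
  have hXX : ∀ k l, ∫ ω, X k ω * X l ω ∂μ = if k = l then τ k else 0 := by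
    intro k l
    have := covariance_eq_sub (h.memLp k) (h.memLp l)
    simp only [h.cov, h.mean, Pi.mul_apply] at this
    linarith
  have hint : ∀ k l, Integrable (fun ω => X k ω * X l ω) μ := fun k l =>
    (h.memLp k).integrable_mul (h.memLp l)
  have hrw : ∀ ω, lin X a ω * lin X b ω = ∑ k, ∑ l, (a k * b l) * (X k ω * X l ω) := by
    intro ω
    unfold lin
    rw [Finset.sum_mul_sum]
    refine Finset.sum_congr rfl fun k _ => Finset.sum_congr rfl fun l _ => by ring
  simp_rw [hrw]
  rw [integral_finsetSum _ fun k _ => integrable_finsetSum _ fun l _ => (hint k l).const_mul _]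
  refine Finset.sum_congr rfl fun k _ => ?_
  rw [integral_finsetSum _ fun l _ => (hint k l).const_mul _]
  simp_rw [integral_const_mul, hXX]
  simp [mul_comm]

lemma covariance_lin (h : IsGaussianBasis μ X τ) (a b : ι → ℝ) :
    cov[lin X a, lin X b; μ] = ∑ k, τ k * (a k * b k) := by
  have := h.gauss.isProbabilityMeasure
  rw [covariance_eq_sub (h.memLp_lin a) (h.memLp_lin b), h.integral_lin, h.integral_lin,
    ← h.integral_lin_mul_lin]
  simp

lemma hasGaussianLaw_lin (h : IsGaussianBasis μ X τ) (a : ι → ℝ) :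
    HasGaussianLaw (lin X a) μ := by
  let T : (ι → ℝ) →L[ℝ] ℝ := ∑ k, a k • ContinuousLinearMap.proj k
  have h2 := h.gauss.map_fun T
  refine h2.congr (Filter.Eventually.of_forall fun ω => ?_)
  simp [T, lin]

/-- Uncorrelated linear combinations are independent. -/
lemma indepFun_lin (h : IsGaussianBasis μ X τ) {n : ℕ} {a : ι → ℝ} {b : Fin n → ι → ℝ}
    (hab : ∀ i, ∑ k, τ k * (a k * b i k) = 0) :
    IndepFun (lin X a) (fun ω i => lin X (b i) ω) μ := by
  -- The single combination is treated as a vector with one component, the shape in which the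
  -- covariance criterion for independence is stated.
  have hpair : HasGaussianLaw
      (fun ω => ((fun _ => lin X a ω : Fin 1 → ℝ), (fun i => lin X (b i) ω))) μ := by
    let T : (ι → ℝ) →L[ℝ] ℝ := ∑ k, a k • ContinuousLinearMap.proj k
    let T' : Fin n → (ι → ℝ) →L[ℝ] ℝ := fun i => ∑ k, b i k • ContinuousLinearMap.proj k
    have h2 := h.gauss.map_fun
      ((ContinuousLinearMap.pi fun _ : Fin 1 => T).prod (ContinuousLinearMap.pi T'))
    refine h2.congr (Filter.Eventually.of_forall fun ω => ?_)
    ext <;> simp [T, T', lin]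
  have := hpair.indepFun_of_covariance_eval (X := fun _ => lin X a) (Y := fun i => lin X (b i))
    fun _ i => by rw [h.covariance_lin, hab]
  exact this.comp (φ := fun f : Fin 1 → ℝ => f 0) (ψ := id) (measurable_pi_apply 0) measurable_id

/-- The conditional expectation of a linear combination vanishes if it is uncorrelated with
linear combinations that determine the information. -/
lemma condExp_lin_eq_zero (h : IsGaussianBasis μ X τ) {n : ℕ}
    {a : ι → ℝ} {b : Fin n → ι → ℝ} {β : Type*} [MeasurableSpace β] {info : Ω → β}
    (Φ : (Fin n → ℝ) → β) (hΦ : Measurable Φ) (hinfo : ∀ ω, info ω = Φ fun i => lin X (b i) ω)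
    (hab : ∀ i, ∑ k, τ k * (a k * b i k) = 0) :
    μ[lin X a | MeasurableSpace.comap info inferInstance] =ᵐ[μ] 0 := by
  have := h.gauss.isProbabilityMeasure
  have hinfo' : info = Φ ∘ fun ω i => lin X (b i) ω := funext hinfo
  have hmeas : Measurable info :=
    hinfo' ▸ hΦ.comp (measurable_pi_lambda _ fun i => h.measurable_lin (b i))
  have hind : IndepFun (lin X a) info μ := by
    rw [hinfo']
    exact (h.indepFun_lin hab).comp (φ := id) measurable_id hΦ
  have := condExp_indep_eq (h.measurable_lin a).comap_le hmeas.comap_le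
    (comap_measurable (lin X a)).stronglyMeasurable hind
  rw [h.integral_lin] at this
  exact this

/-- The conditional expectation of a linear combination vanishes if and only if the linear
combination is uncorrelated with the information. -/
lemma condExp_lin_eq_zero_iff (h : IsGaussianBasis μ X τ) {n : ℕ}
    {a : ι → ℝ} {b : Fin n → ι → ℝ} {β : Type*} [MeasurableSpace β] {info : Ω → β}
    (Φ : (Fin n → ℝ) → β) (hΦ : Measurable Φ) (hinfo : ∀ ω, info ω = Φ fun i => lin X (b i) ω)
    (ψ : Fin n → β → ℝ) (hψ : ∀ i, Measurable (ψ i))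
    (hb : ∀ i ω, lin X (b i) ω = ψ i (info ω)) :
    μ[lin X a | MeasurableSpace.comap info inferInstance] =ᵐ[μ] 0 ↔
      ∀ i, ∑ k, τ k * (a k * b i k) = 0 := by
  have := h.gauss.isProbabilityMeasure
  have hvec : Measurable fun ω i => lin X (b i) ω :=
    measurable_pi_lambda _ fun i => h.measurable_lin (b i)
  have hinfo' : info = Φ ∘ fun ω i => lin X (b i) ω := funext hinfo
  have hmeas : Measurable info := hinfo' ▸ hΦ.comp hvec
  constructor
  · intro h0 i
    rw [← h.integral_lin_mul_lin]
    have hsm : StronglyMeasurable[MeasurableSpace.comap info inferInstance] (lin X (b i)) := by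
      have : lin X (b i) = ψ i ∘ info := funext (hb i)
      rw [this]
      exact ((hψ i).comp (comap_measurable info)).stronglyMeasurable
    have hint : Integrable (lin X a * lin X (b i)) μ :=
      (h.memLp_lin a).integrable_mul (h.memLp_lin (b i))
    have hmul := condExp_mul_of_stronglyMeasurable_right hsm hint (h.integrable_lin a)
    -- `lin X (b i)` is known, so it can be pulled out of the conditional expectation; the mean of
    -- the product is then the mean of zero.
    have : ∫ ω, (lin X a * lin X (b i)) ω ∂μ = 0 := by
      rw [← integral_condExp hmeas.comap_le, integral_congr_ae hmul]
      have : ∀ᵐ ω ∂μ, (μ[lin X a | MeasurableSpace.comap info inferInstance] * lin X (b i)) ω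
          = 0 := by
        filter_upwards [h0] with ω hω
        simp [hω]
      rw [integral_congr_ae this]
      simp
    exact this
  · exact h.condExp_lin_eq_zero Φ hΦ hinfo

end IsGaussianBasis

end Gaussian

/-! ### Decisions under quadratic payoffs -/

section Decision

variable {Ω : Type*} [mΩ : MeasurableSpace Ω] [StandardBorelSpace Ω] {μ : Measure Ω}
  {β : Type*} [MeasurableSpace β] [MeasurableEq β] {info : Ω → β}

/-- The conditional mean of a payoff that is quadratic in the decision `g`. -/
lemma condMean_quadratic [IsFiniteMeasure μ] (hinfo : Measurable info) {G : Ω → ℝ}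
    (hG : Integrable G μ) (c K : ℝ) (gs φ : β → ℝ) {n : ℕ} (d : Fin n → β → ℝ) {Y : Fin n → Ω → ℝ}
    (hY : ∀ i, Integrable (Y i) μ) (g : β → ℝ) {P : Ω → ℝ}
    (hP : ∀ ω, P ω = g (info ω) * (c * G ω + 2 * K * gs (info ω) + φ (info ω)) -
      K * g (info ω) ^ 2 + ∑ i, d i (info ω) * Y i ω) :
    condMean μ info P =ᵐ[μ] fun ω =>
      g (info ω) * (c * (μ[G | MeasurableSpace.comap info inferInstance]) ω +
        2 * K * gs (info ω) + φ (info ω)) - K * g (info ω) ^ 2 +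
      ∑ i, d i (info ω) * (μ[Y i | MeasurableSpace.comap info inferInstance]) ω := by
  -- The payoff is a sum of known factors times integrable variables once `G` and the constant 1 are
  -- adjoined to the `Y i`.
  let a : Fin (n + 2) → β → ℝ := Fin.cons (fun b => g b * c)
    (Fin.cons (fun b => g b * (2 * K * gs b + φ b) - K * g b ^ 2) d)
  let Z : Fin (n + 2) → Ω → ℝ := Fin.cons G (Fin.cons (fun _ => 1) Y)
  have hZ : ∀ i, Integrable (Z i) μ := by
    intro i
    refine Fin.cases hG (fun i => ?_) i
    exact Fin.cases (integrable_const _) (fun i => hY i) i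
  have hPa : P = fun ω => ∑ i, a i (info ω) * Z i ω := by
    funext ω
    rw [hP, Fin.sum_univ_succ, Fin.sum_univ_succ]
    simp only [a, Z, Fin.cons_zero, Fin.cons_succ]
    ring
  rw [hPa]
  filter_upwards [condMean_sum μ hinfo a hZ] with ω hω
  rw [hω, Fin.sum_univ_succ, Fin.sum_univ_succ]
  simp only [a, Z, Fin.cons_zero, Fin.cons_succ]
  rw [condExp_const hinfo.comap_le]
  ring

/-- A decision rule is the unique maximiser of a conditional mean payoff that is quadratic in the
decision if and only if the payoff is strictly concave and the first-order condition holds. -/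
lemma unique_max_condMean_iff [IsFiniteMeasure μ] [NeZero μ] (hinfo : Measurable info) {G : Ω → ℝ}
    (hG : Integrable G μ) (c K : ℝ) {gs φ : β → ℝ} (hgs : Measurable gs) (hφ : Measurable φ)
    {n : ℕ} (d : Fin n → β → ℝ) {Y : Fin n → Ω → ℝ} (hY : ∀ i, Integrable (Y i) μ)
    {P : (β → ℝ) → Ω → ℝ}
    (hP : ∀ g ω, P g ω = g (info ω) * (c * G ω + 2 * K * gs (info ω) + φ (info ω)) -
      K * g (info ω) ^ 2 + ∑ i, d i (info ω) * Y i ω) :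
    (∀ g : β → ℝ, Measurable g → ∀ᵐ ω ∂μ, g (info ω) ≠ gs (info ω) →
      condMean μ info (P g) ω < condMean μ info (P gs) ω) ↔
    0 < K ∧ ∀ᵐ ω ∂μ,
      c * (μ[G | MeasurableSpace.comap info inferInstance]) ω + φ (info ω) = 0 := by
  -- The conditional expectation is written as a measurable function of `info`, so that the vertex
  -- is an admissible decision rule.
  obtain ⟨γ, hγ, hγ'⟩ := (stronglyMeasurable_condExp (f := G) (μ := μ)
    (m := MeasurableSpace.comap info inferInstance)).measurable.exists_eq_measurable_comp
  have hcm := fun g => condMean_quadratic hinfo hG c K gs φ d hY g (hP g)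
  have key := quadratic_unique_max_iff (μ := μ) (info := info)
    (α := fun b => c * γ b + 2 * K * gs b + φ b) (gs := gs) (by fun_prop) hgs K
  have h1 : (∀ g : β → ℝ, Measurable g → ∀ᵐ ω ∂μ, g (info ω) ≠ gs (info ω) →
      condMean μ info (P g) ω < condMean μ info (P gs) ω) ↔
      (∀ g : β → ℝ, Measurable g → ∀ᵐ ω ∂μ, g (info ω) ≠ gs (info ω) →
        g (info ω) * (c * γ (info ω) + 2 * K * gs (info ω) + φ (info ω)) - K * g (info ω) ^ 2 <
          gs (info ω) * (c * γ (info ω) + 2 * K * gs (info ω) + φ (info ω))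
            - K * gs (info ω) ^ 2) := by
    refine forall₂_congr fun g _ => Filter.eventually_congr ?_
    filter_upwards [hcm g, hcm gs] with ω h1 h2
    rw [h1, h2, hγ']
    simp only [Function.comp_apply]
    -- The `Y` terms do not involve the decision and cancel from the comparison.
    rw [add_lt_add_iff_right]
  rw [h1, key]
  refine and_congr_right fun _ => Filter.eventually_congr (Filter.Eventually.of_forall fun ω => ?_)
  rw [hγ']
  simp only [Function.comp_apply]
  constructor <;> intro h <;> linarith

end Decision

/-! ### Dimensionless shocks -/

section Standardisation

variable {Ω : Type*} [mΩ : MeasurableSpace Ω] {J : ℕ} {μ : Measure Ω}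

/-- The shocks in units of their scales, centred. -/
noncomputable def Shocks.standardize (S : Shocks Ω J) (p0 σv σ1 : ℝ) : Shocks Ω J where
  v ω := (S.v ω - p0) / σv
  z ω := S.z ω / σ1
  u1 ω := S.u1 ω / σ1
  u1p ω := S.u1p ω / σ1
  u2 ω := S.u2 ω / σ1
  ε j ω := S.ε j ω / σ1

lemma map_affine_gaussianReal {Y : Ω → ℝ} (hY : Measurable Y) {m σ : ℝ}
    (h : μ.map Y = gaussianReal m (Real.toNNReal (σ ^ 2))) (c : ℝ) :
    μ.map (fun ω => (Y ω - m) / c) = gaussianReal 0 (Real.toNNReal (σ ^ 2 / c ^ 2)) := by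
  have h1 : HasLaw Y (gaussianReal m (Real.toNNReal (σ ^ 2))) μ := ⟨hY.aemeasurable, h⟩
  have h2 := (gaussianReal_div_const (gaussianReal_sub_const h1 m) c).map_eq
  simp only [sub_self, zero_div] at h2
  rw [h2]
  congr 1
  ext
  rw [NNReal.coe_div, Real.coe_toNNReal _ (sq_nonneg _), Real.coe_toNNReal _ (by positivity)]
  simp

/-- The variances of the standardised shocks. -/
def stdVar (J : ℕ) (θz θ1p θ2 θε : ℝ) : Fin 5 ⊕ Fin J → ℝ :=
  Sum.elim ![1, θz, 1, θ1p, θ2] fun _ => θε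

lemma Shocks.HasNormalLaws.isGaussianBasis {S : Shocks Ω J} {p0 σv σz σ1 σ1p σ2 σε : ℝ}
    [IsProbabilityMeasure μ]
    (hS : S.HasNormalLaws μ p0 σv σz σ1 σ1p σ2 σε) (hσv : 0 < σv) (hσ1 : 0 < σ1) :
    IsGaussianBasis μ (S.standardize p0 σv σ1).family
      (stdVar J (σz ^ 2 / σ1 ^ 2) (σ1p ^ 2 / σ1 ^ 2) (σ2 ^ 2 / σ1 ^ 2) (σε ^ 2 / σ1 ^ 2)) := by
  set N := S.standardize p0 σv σ1
  set τ := stdVar J (σz ^ 2 / σ1 ^ 2) (σ1p ^ 2 / σ1 ^ 2) (σ2 ^ 2 / σ1 ^ 2) (σε ^ 2 / σ1 ^ 2)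
  let g : Fin 5 ⊕ Fin J → ℝ → ℝ := Sum.elim
    ![fun x => (x - p0) / σv, fun x => x / σ1, fun x => x / σ1, fun x => x / σ1, fun x => x / σ1]
    fun _ x => x / σ1
  have hg : ∀ k, Measurable (g k) := by
    rintro (k | k)
    · fin_cases k <;> simp [g] <;> fun_prop
    · simp only [g, Sum.elim_inr]; fun_prop
  have hN : ∀ k, N.family k = g k ∘ S.family k := by
    rintro (k | k)
    · fin_cases k <;> rfl
    · rfl
  have hmeas : ∀ k, Measurable (N.family k) := fun k => by
    rw [hN]; exact (hg k).comp (hS.meas k)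
  have hm : ∀ k : Fin 5, Measurable (S.family (Sum.inl k)) := fun k => hS.meas _
  have hmap : ∀ k, μ.map (N.family k) = gaussianReal 0 (Real.toNNReal (τ k)) := by
    rintro (k | k)
    · fin_cases k
      · have := map_affine_gaussianReal (hm 0) hS.law_v σv
        rw [div_self (by positivity)] at this
        exact this
      · have := map_affine_gaussianReal (hm 1) hS.law_z σ1
        simp only [sub_zero] at this
        exact this
      · have := map_affine_gaussianReal (hm 2) hS.law_u1 σ1
        simp only [sub_zero] at this
        rw [div_self (by positivity)] at this
        exact this
      · have := map_affine_gaussianReal (hm 3) hS.law_u1p σ1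
        simp only [sub_zero] at this
        exact this
      · have := map_affine_gaussianReal (hm 4) hS.law_u2 σ1
        simp only [sub_zero] at this
        exact this
    · have := map_affine_gaussianReal (hS.meas (Sum.inr k)) (hS.law_ε k) σ1
      simp only [sub_zero] at this
      exact this
  have hτ : ∀ k, 0 ≤ τ k := by
    rintro (k | k)
    · fin_cases k <;> simp [τ, stdVar] <;> positivity
    · simp only [τ, stdVar, Sum.elim_inr]; positivity
  have hind : iIndepFun N.family μ := by
    have := hS.indep.comp g hg
    simpa only [← hN] using this
  -- Zero variances are allowed here: a point mass counts as a Gaussian law.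
  have hgauss : ∀ k, HasGaussianLaw (N.family k) μ := fun k => ⟨by rw [hmap]; infer_instance⟩
  refine ⟨hmeas, hind.hasGaussianLaw hgauss, fun k => ?_, fun k l => ?_⟩
  · have := integral_map (hmeas k).aemeasurable (f := id) (μ := μ)
      (by rw [hmap]; exact aestronglyMeasurable_id)
    rw [hmap] at this
    simpa [integral_id_gaussianReal] using this.symm
  · split_ifs with h
    · subst h
      rw [covariance_self (hmeas k).aemeasurable]
      have := variance_map (X := id) (μ := μ) (Y := N.family k) (by fun_prop)
        (hmeas k).aemeasurable
      rw [hmap, variance_id_gaussianReal] at this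
      simpa [hτ k] using this.symm
    · exact (hind.indepFun h).covariance_eq_zero (hgauss k).memLp_two (hgauss l).memLp_two

end Standardisation

/-! ### Coordinates adapted to the regression on the first order flow -/

/-- Weights of a linear combination of: the residual of the value and the residual of the informed
trader's first order after regression on the first order flow, the first order flow itself, the
later noise orders, the sum of the other traders' signal noises, and the own signal noise. -/
structure Weights where
  n : ℝ
  i : ℝ
  y : ℝ
  p : ℝ
  q : ℝ
  o : ℝ
  e : ℝ

section Combinations

variable {Ω : Type*} {J : ℕ}

/-- The linear combination of standardised shocks with the given weights. -/
noncomputable def Shocks.comb (N : Shocks Ω J) (A θz : ℝ) (j : Fin J) (w : Weights) (ω : Ω) : ℝ :=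
  w.n * (N.v ω - A / (A ^ 2 + θz + 1) * (A * N.v ω + N.z ω + N.u1 ω)) +
  w.i * (A * N.v ω + N.z ω -
    (A ^ 2 + θz) / (A ^ 2 + θz + 1) * (A * N.v ω + N.z ω + N.u1 ω)) +
  w.y * (A * N.v ω + N.z ω + N.u1 ω) + w.p * N.u1p ω + w.q * N.u2 ω +
  w.o * (∑ k ∈ Finset.univ.erase j, N.ε k ω) + w.e * N.ε j ω

/-- The covariance of two linear combinations. -/
noncomputable def Weights.dot (J θz θ1p θ2 θε A : ℝ) (w x : Weights) : ℝ :=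
  w.n * x.n * ((θz + 1) / (A ^ 2 + θz + 1)) +
  (w.n * x.i + w.i * x.n) * (A / (A ^ 2 + θz + 1)) +
  w.i * x.i * ((A ^ 2 + θz) / (A ^ 2 + θz + 1)) + w.y * x.y * (A ^ 2 + θz + 1) +
  w.p * x.p * θ1p + w.q * x.q * θ2 + w.o * x.o * ((J - 1) * θε) + w.e * x.e * θε

/-- The coefficients of a linear combination with respect to the standardised shocks. -/
noncomputable def Weights.coeffs (A θz : ℝ) (j : Fin J) (w : Weights) : Fin 5 ⊕ Fin J → ℝ :=
  Sum.elim
    ![w.n * (1 - A / (A ^ 2 + θz + 1) * A) +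
        w.i * (A - (A ^ 2 + θz) / (A ^ 2 + θz + 1) * A) + w.y * A,
      -w.n * (A / (A ^ 2 + θz + 1)) + w.i * (1 - (A ^ 2 + θz) / (A ^ 2 + θz + 1)) + w.y,
      -w.n * (A / (A ^ 2 + θz + 1)) - w.i * ((A ^ 2 + θz) / (A ^ 2 + θz + 1)) + w.y, w.p, w.q]
    fun k => if k = j then w.e else w.o

lemma Shocks.comb_eq_lin (N : Shocks Ω J) (A θz : ℝ) (j : Fin J) (w : Weights) :
    N.comb A θz j w = IsGaussianBasis.lin N.family (w.coeffs A θz j) := by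
  funext ω
  have h : ∑ k, (if k = j then w.e else w.o) * N.ε k ω =
      w.e * N.ε j ω + w.o * ∑ k ∈ Finset.univ.erase j, N.ε k ω := by
    rw [← Finset.add_sum_erase Finset.univ _ (Finset.mem_univ j), if_pos rfl, Finset.mul_sum]
    congr 1
    exact Finset.sum_congr rfl fun k hk => by rw [if_neg (Finset.ne_of_mem_erase hk)]
  simp only [Shocks.comb, IsGaussianBasis.lin, Fintype.sum_sum_type, Fin.sum_univ_five,
    Weights.coeffs, Shocks.family, Sum.elim_inl, Sum.elim_inr, h]
  simp only [Matrix.cons_val]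
  ring

variable {N : Shocks Ω J} {θz θ1p θ2 θε : ℝ}

/-- The residuals of the value and of the informed order are uncorrelated with the first order flow,
so `y` decouples in `dot`. The remaining terms are the residual variances and their covariance `A /
(A ^ 2 + θz + 1)`; the weight `o` sits on `J - 1` independent signal noises. -/
lemma Weights.sum_coeffs (A : ℝ) (hθz : 0 ≤ θz) (j : Fin J) (w x : Weights) :
    ∑ k, stdVar J θz θ1p θ2 θε k * (w.coeffs A θz j k * x.coeffs A θz j k) =
      w.dot J θz θ1p θ2 θε A x := by
  have hQ : A ^ 2 + θz + 1 ≠ 0 := by positivity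
  simp only [Fintype.sum_sum_type, Fin.sum_univ_five, Weights.coeffs, stdVar, Sum.elim_inl,
    Sum.elim_inr]
  rw [← Finset.add_sum_erase Finset.univ _ (Finset.mem_univ j),
    Finset.sum_congr rfl (g := fun k => θε * (w.o * x.o)) fun k hk => by
      rw [if_neg (Finset.ne_of_mem_erase hk), if_neg (Finset.ne_of_mem_erase hk)],
    Finset.sum_const, Finset.card_erase_of_mem (Finset.mem_univ j), Finset.card_univ,
    Fintype.card_fin, nsmul_eq_mul, Nat.cast_sub (by have := j.pos; omega)]
  simp [Weights.dot]
  field_simp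
  ring

variable [mΩ : MeasurableSpace Ω] {μ : Measure Ω}
  (hB : IsGaussianBasis μ N.family (stdVar J θz θ1p θ2 θε))
include hB

lemma measurable_comb (A : ℝ) (j : Fin J) (w : Weights) : Measurable (N.comb A θz j w) := by
  rw [N.comb_eq_lin]; exact hB.measurable_lin _

lemma memLp_comb (A : ℝ) (j : Fin J) (w : Weights) : MemLp (N.comb A θz j w) 2 μ := by
  rw [N.comb_eq_lin]; exact hB.memLp_lin _

lemma integrable_comb (A : ℝ) (j : Fin J) (w : Weights) : Integrable (N.comb A θz j w) μ := by
  rw [N.comb_eq_lin]; exact hB.integrable_lin _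

/-- The second moment of a combination is `w.dot w`. This is the source of all linear independence
arguments below. -/
lemma dot_self_eq_zero_of_comb (A : ℝ) (hθz : 0 ≤ θz) (j : Fin J) {w : Weights}
    (h : ∀ᵐ ω ∂μ, N.comb A θz j w ω = 0) : w.dot J θz θ1p θ2 θε A w = 0 := by
  rw [← Weights.sum_coeffs A hθz j, ← hB.integral_lin_mul_lin, ← N.comb_eq_lin,
    integral_congr_ae (g := fun _ => 0) (by filter_upwards [h] with ω hω; simp [hω])]
  simp

lemma map_comb (A : ℝ) (hθz : 0 ≤ θz) (j : Fin J) (w : Weights) :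
    μ.map (N.comb A θz j w) = gaussianReal 0 (w.dot J θz θ1p θ2 θε A w).toNNReal := by
  have h := (hB.hasGaussianLaw_lin (w.coeffs A θz j)).map_eq_gaussianReal
  have := hB.gauss.isProbabilityMeasure
  rw [hB.integral_lin, ← covariance_self (hB.measurable_lin _).aemeasurable, hB.covariance_lin,
    Weights.sum_coeffs A hθz j] at h
  rw [N.comb_eq_lin, h]

variable {β : Type*} [MeasurableSpace β] {info : Ω → β}

lemma condExp_comb_eq_zero_iff (A : ℝ) (hθz : 0 ≤ θz) (j : Fin J) {n : ℕ} {a : Weights}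
    {b : Fin n → Weights} (Φ : (Fin n → ℝ) → β) (hΦ : Measurable Φ)
    (hinfo : ∀ ω, info ω = Φ fun k => N.comb A θz j (b k) ω)
    (ψ : Fin n → β → ℝ) (hψ : ∀ k, Measurable (ψ k))
    (hb : ∀ k ω, N.comb A θz j (b k) ω = ψ k (info ω)) :
    μ[N.comb A θz j a | MeasurableSpace.comap info inferInstance] =ᵐ[μ] 0 ↔
      ∀ k, a.dot J θz θ1p θ2 θε A (b k) = 0 := by
  simp only [N.comb_eq_lin] at hinfo hb ⊢
  rw [hB.condExp_lin_eq_zero_iff (b := fun k => (b k).coeffs A θz j) Φ hΦ hinfo ψ hψ hb]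
  simp only [Weights.sum_coeffs A hθz j]

lemma condExp_comb_eq_zero (A : ℝ) (hθz : 0 ≤ θz) (j : Fin J) {n : ℕ} {a : Weights}
    {b : Fin n → Weights} (Φ : (Fin n → ℝ) → β) (hΦ : Measurable Φ)
    (hinfo : ∀ ω, info ω = Φ fun k => N.comb A θz j (b k) ω)
    (h : ∀ k, a.dot J θz θ1p θ2 θε A (b k) = 0) :
    μ[N.comb A θz j a | MeasurableSpace.comap info inferInstance] =ᵐ[μ] 0 := by
  simp only [N.comb_eq_lin] at hinfo ⊢
  refine hB.condExp_lin_eq_zero (b := fun k => (b k).coeffs A θz j) Φ hΦ hinfo fun k => ?_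
  simp only [Weights.sum_coeffs A hθz j, h]

lemma condExp_comb_eq_zero_iff_one (A : ℝ) (hθz : 0 ≤ θz) (j : Fin J) {σ : ℝ} (hσ : σ ≠ 0)
    {a b : Weights} {info : Ω → ℝ} (hinfo : ∀ ω, info ω = σ * N.comb A θz j b ω) :
    μ[N.comb A θz j a | MeasurableSpace.comap info inferInstance] =ᵐ[μ] 0 ↔
      a.dot J θz θ1p θ2 θε A b = 0 := by
  rw [condExp_comb_eq_zero_iff hB A hθz j (b := ![b]) (fun x => σ * x 0) (by fun_prop)
    (fun ω => by simp [hinfo]) ![fun y => y / σ]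
    (fun k => by fin_cases k; simp; fun_prop)
    (fun k ω => by fin_cases k; simp [hinfo]; field_simp)]
  simp

lemma condExp_comb_eq_zero_iff_two (A : ℝ) (hθz : 0 ≤ θz) (j : Fin J) {σ : ℝ} (hσ : σ ≠ 0)
    {a b₁ b₂ : Weights} {info : Ω → ℝ × ℝ}
    (hinfo : ∀ ω, info ω = (σ * N.comb A θz j b₁ ω, σ * N.comb A θz j b₂ ω)) :
    μ[N.comb A θz j a | MeasurableSpace.comap info inferInstance] =ᵐ[μ] 0 ↔
      a.dot J θz θ1p θ2 θε A b₁ = 0 ∧ a.dot J θz θ1p θ2 θε A b₂ = 0 := by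
  rw [condExp_comb_eq_zero_iff hB A hθz j (b := ![b₁, b₂]) (fun x => (σ * x 0, σ * x 1))
    (by fun_prop) (fun ω => by simp [hinfo]) ![fun y => y.1 / σ, fun y => y.2 / σ]
    (fun k => by fin_cases k <;> simp <;> fun_prop)
    (fun k ω => by fin_cases k <;> simp [hinfo] <;> field_simp)]
  simp [Fin.forall_fin_two]

/-- Adding a known function `f` of the first two observations to the third does not change the
information, since it can be subtracted again. Hence an HFT learns the same from `y1+` whatever her
own first order was, however nonlinear. -/
lemma condExp_comb_eq_zero_iff_three (A : ℝ) (hθz : 0 ≤ θz) (j : Fin J) {σ : ℝ} (hσ : σ ≠ 0)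
    {a b₁ b₂ b₃ : Weights} {info : Ω → ℝ × ℝ × ℝ} {f : ℝ → ℝ → ℝ}
    (hf : Measurable fun x : ℝ × ℝ => f x.1 x.2)
    (hinfo : ∀ ω, info ω = (σ * N.comb A θz j b₁ ω, σ * N.comb A θz j b₂ ω,
      f (σ * N.comb A θz j b₁ ω) (σ * N.comb A θz j b₂ ω) + σ * N.comb A θz j b₃ ω)) :
    μ[N.comb A θz j a | MeasurableSpace.comap info inferInstance] =ᵐ[μ] 0 ↔
      a.dot J θz θ1p θ2 θε A b₁ = 0 ∧ a.dot J θz θ1p θ2 θε A b₂ = 0 ∧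
        a.dot J θz θ1p θ2 θε A b₃ = 0 := by
  have hf1 : Measurable fun x : Fin 3 → ℝ => f (σ * x 0) (σ * x 1) :=
    hf.comp (g := fun x : ℝ × ℝ => f x.1 x.2)
      (f := fun x : Fin 3 → ℝ => (σ * x 0, σ * x 1)) (by fun_prop)
  have hf2 : Measurable fun y : ℝ × ℝ × ℝ => f y.1 y.2.1 :=
    hf.comp (g := fun x : ℝ × ℝ => f x.1 x.2) (f := fun y : ℝ × ℝ × ℝ => (y.1, y.2.1))
      (by fun_prop)
  rw [condExp_comb_eq_zero_iff hB A hθz j (b := ![b₁, b₂, b₃])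
    (fun x => (σ * x 0, σ * x 1, f (σ * x 0) (σ * x 1) + σ * x 2))
    (by fun_prop) (fun ω => by simp [hinfo])
    ![fun y => y.1 / σ, fun y => y.2.1 / σ, fun y => (y.2.2 - f y.1 y.2.1) / σ]
    (fun k => by fin_cases k <;> simp <;> fun_prop)
    (fun k ω => by fin_cases k <;> simp [hinfo] <;> field_simp)]
  simp [Fin.forall_fin_succ]

end Combinations

/-! ### The model in standardised units; regression functions of a linear profile -/

/-- Standing assumptions, in terms of the standardised shocks. -/
structure StandardModel {Ω : Type*} [MeasurableSpace Ω] {J : ℕ} (μ : Measure Ω) (S : Shocks Ω J)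
    (p0 σv σ1 θz θ1p θ2 θε : ℝ) : Prop where
  basis : IsGaussianBasis μ (S.standardize p0 σv σ1).family (stdVar J θz θ1p θ2 θε)
  σv_pos : 0 < σv
  σ1_pos : 0 < σ1
  θz_nonneg : 0 ≤ θz

/-- The coefficients whose dimensionless versions are `n`. -/
noncomputable def Coeffs.rescale (n : Coeffs) (σv σ1 : ℝ) : Coeffs where
  lam1 := n.lam1 * (σv / σ1)
  lam1p := n.lam1p * (σv / σ1)
  lam21 := n.lam21 * (σv / σ1)
  lam22 := n.lam22 * (σv / σ1)
  α1 := n.α1 * (σ1 / σv)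
  α21 := n.α21 * (σ1 / σv)
  α22 := n.α22
  β11 := n.β11
  β21 := n.β21
  β22 := n.β22
  β23 := n.β23

/-- The linear profile with dimensionless coefficients `n`, with explicit regression functions. -/
noncomputable def affineProfile (J : ℕ) (p0 σv σ1 θz : ℝ) (n : Coeffs) : Profile J where
  p1 := fun y1 => p0 + n.lam1 * (σv / σ1) * y1
  p1p := fun y1 y1p => (p0 + n.lam1 * (σv / σ1) * y1) + n.lam1p * (σv / σ1) * y1p
  p2 := fun y1 y1p y2 => (p0 + n.lam1 * (σv / σ1) * y1) + n.lam21 * (σv / σ1) * y1p +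
    n.lam22 * (σv / σ1) * y2
  i1 := fun v z => n.α1 * (σ1 / σv) * (v - p0) + z
  i2 := fun v i1 y1 =>
    n.α21 * (σ1 / σv) * (v - (p0 + σv / σ1 * (n.α1 / (n.α1 ^ 2 + θz + 1)) * y1)) +
      n.α22 * (i1 - (n.α1 ^ 2 + θz) / (n.α1 ^ 2 + θz + 1) * y1)
  x1 := fun _ s y1 => n.β11 * (s - (n.α1 ^ 2 + θz) / (n.α1 ^ 2 + θz + 1) * y1)
  x2 := fun _ s y1 y1p x1 =>
    n.β21 * (s - (n.α1 ^ 2 + θz) / (n.α1 ^ 2 + θz + 1) * y1) + n.β22 * (y1p - x1) + n.β23 * x1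

lemma measurable_affineProfile (J : ℕ) (p0 σv σ1 θz : ℝ) (n : Coeffs) :
    (affineProfile J p0 σv σ1 θz n).IsMeasurable := by
  constructor
  case x1 => intro _; simp only [affineProfile]; fun_prop
  case x2 => intro _; simp only [affineProfile]; fun_prop
  all_goals simp only [affineProfile]; fun_prop

lemma sum_eq_add_others {J : ℕ} (j : Fin J) {x e : Fin J → ℝ} {a b : ℝ}
    (h : ∀ k, k ≠ j → x k = a + b * e k) :
    ∑ k, x k = x j + ((J - 1) * a + b * ∑ k ∈ Finset.univ.erase j, e k) := by
  rw [← Finset.add_sum_erase Finset.univ _ (Finset.mem_univ j),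
    Finset.sum_congr rfl fun k hk => h k (Finset.ne_of_mem_erase hk), Finset.sum_add_distrib,
    Finset.sum_const, Finset.card_erase_of_mem (Finset.mem_univ j), Finset.card_univ,
    Fintype.card_fin, nsmul_eq_mul, Nat.cast_sub (by have := j.pos; omega), Finset.mul_sum]
  simp

section Model

variable {Ω : Type*} [mΩ : MeasurableSpace Ω] {J : ℕ} {μ : Measure Ω} {S : Shocks Ω J}
  {p0 σv σ1 θz θ1p θ2 θε : ℝ} (hM : StandardModel μ S p0 σv σ1 θz θ1p θ2 θε)
include hM

namespace StandardModel

lemma v_eq (ω : Ω) : S.v ω = p0 + σv * (S.standardize p0 σv σ1).v ω := by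
  have := hM.σv_pos; simp only [Shocks.standardize]; field_simp; ring

lemma z_eq (ω : Ω) : S.z ω = σ1 * (S.standardize p0 σv σ1).z ω := by
  have := hM.σ1_pos; simp only [Shocks.standardize]; field_simp

lemma u1_eq (ω : Ω) : S.u1 ω = σ1 * (S.standardize p0 σv σ1).u1 ω := by
  have := hM.σ1_pos; simp only [Shocks.standardize]; field_simp

lemma u1p_eq (ω : Ω) : S.u1p ω = σ1 * (S.standardize p0 σv σ1).u1p ω := by
  have := hM.σ1_pos; simp only [Shocks.standardize]; field_simp

lemma u2_eq (ω : Ω) : S.u2 ω = σ1 * (S.standardize p0 σv σ1).u2 ω := by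
  have := hM.σ1_pos; simp only [Shocks.standardize]; field_simp

lemma ε_eq (j : Fin J) (ω : Ω) : S.ε j ω = σ1 * (S.standardize p0 σv σ1).ε j ω := by
  have := hM.σ1_pos; simp only [Shocks.standardize]; field_simp

lemma measurable_v : Measurable S.v := by
  have h := hM.basis.meas (Sum.inl 0)
  have : S.v = fun ω => p0 + σv * (S.standardize p0 σv σ1).family (Sum.inl 0) ω :=
    funext hM.v_eq
  rw [this]; fun_prop

lemma measurable_z : Measurable S.z := by
  have h := hM.basis.meas (Sum.inl 1)
  have : S.z = fun ω => σ1 * (S.standardize p0 σv σ1).family (Sum.inl 1) ω := funext hM.z_eq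
  rw [this]; fun_prop

lemma measurable_u1 : Measurable S.u1 := by
  have h := hM.basis.meas (Sum.inl 2)
  have : S.u1 = fun ω => σ1 * (S.standardize p0 σv σ1).family (Sum.inl 2) ω := funext hM.u1_eq
  rw [this]; fun_prop

lemma Q_pos (A : ℝ) : 0 < A ^ 2 + θz + 1 := by have := hM.θz_nonneg; positivity

lemma v_eq_comb (A : ℝ) (j : Fin J) (ω : Ω) : S.v ω =
    p0 + σv * (S.standardize p0 σv σ1).comb A θz j
      ⟨1, 0, A / (A ^ 2 + θz + 1), 0, 0, 0, 0⟩ ω := by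
  rw [hM.v_eq]; simp only [Shocks.comb]; ring

lemma integrable_v (j : Fin J) : Integrable S.v μ := by
  have := hM.basis.gauss.isProbabilityMeasure
  have h := integrable_comb (θz := θz) hM.basis 0 j ⟨1, 0, 0 / (0 ^ 2 + θz + 1), 0, 0, 0, 0⟩
  rw [show S.v = fun ω => _ from funext (hM.v_eq_comb 0 j)]
  exact (integrable_const p0).add (h.const_mul σv)

section Dealers

/-- A price is the conditional expectation of a random variable if and only if the conditional
expectation of the pricing error vanishes. -/
lemma ae_eq_condExp_iff [StandardBorelSpace Ω] {X : Ω → ℝ} (A : ℝ) (j : Fin J) {β : Type*}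
    [MeasurableSpace β] {info : Ω → β} (hinfo : Measurable info) {ψ : β → ℝ} (hψ : Measurable ψ)
    {σ : ℝ} (hσ : σ ≠ 0) {a : Weights} (hX : Integrable X μ)
    (h : ∀ ω, X ω = ψ (info ω) + σ * (S.standardize p0 σv σ1).comb A θz j a ω) :
    (fun ω => ψ (info ω)) =ᵐ[μ] μ[X | MeasurableSpace.comap info inferInstance] ↔
      μ[(S.standardize p0 σv σ1).comb A θz j a | MeasurableSpace.comap info inferInstance]
        =ᵐ[μ] 0 := by
  have := hM.basis.gauss.isProbabilityMeasure
  set L := (S.standardize p0 σv σ1).comb A θz j a with hL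
  have hLi : Integrable L μ := integrable_comb hM.basis A j a
  have hp : Integrable (fun ω => ψ (info ω)) μ := by
    have : (fun ω => ψ (info ω)) = fun ω => X ω - σ * L ω := by funext ω; rw [h]; ring
    rw [this]; exact hX.sub (hLi.const_mul σ)
  have hX' : X = (fun ω => ψ (info ω)) + σ • L := by
    funext ω; simp [h]
  have h1 : μ[X | MeasurableSpace.comap info inferInstance] =ᵐ[μ]
      fun ω => ψ (info ω) + σ * (μ[L | MeasurableSpace.comap info inferInstance]) ω := by
    have e1 := condExp_add hp (hLi.smul σ) (MeasurableSpace.comap info inferInstance)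
    have e2 := condExp_smul (μ := μ) σ L (MeasurableSpace.comap info inferInstance)
    have e3 := condExp_of_stronglyMeasurable hinfo.comap_le
      ((hψ.comp (comap_measurable info)).stronglyMeasurable) hp
    rw [hX']
    filter_upwards [e1, e2] with ω e1 e2
    rw [e1, Pi.add_apply, e2]
    have := congrFun e3 ω
    simp only [Function.comp_def] at this
    rw [this]
    rfl
  constructor
  · intro h0
    filter_upwards [h0, h1] with ω h0 h1
    rw [h1] at h0
    have : σ * (μ[L | MeasurableSpace.comap info inferInstance]) ω = 0 := by linarith
    simpa [hσ] using this
  · intro h0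
    filter_upwards [h0, h1] with ω h0 h1
    rw [h1, h0]
    simp

variable {s : Profile J} {n : Coeffs}

lemma flow1_eq (hs : s.i1 = fun v z => n.α1 * (σ1 / σv) * (v - p0) + z) (j : Fin J) (ω : Ω) :
    flow1 S s ω =
      σ1 * (S.standardize p0 σv σ1).comb n.α1 θz j ⟨0, 0, 1, 0, 0, 0, 0⟩ ω := by
  have := hM.σv_pos
  have := hM.σ1_pos
  simp only [flow1, orderI1, hs, hM.v_eq, hM.z_eq, hM.u1_eq, Shocks.comb]
  field_simp
  ring

lemma orderI1_eq (hs : s.i1 = fun v z => n.α1 * (σ1 / σv) * (v - p0) + z) (j : Fin J) (ω : Ω) :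
    orderI1 S s ω = σ1 * (S.standardize p0 σv σ1).comb n.α1 θz j
        ⟨0, 1, (n.α1 ^ 2 + θz) / (n.α1 ^ 2 + θz + 1), 0, 0, 0, 0⟩ ω := by
  have := hM.σv_pos
  have := hM.σ1_pos
  simp only [orderI1, hs, hM.v_eq, hM.z_eq, Shocks.comb]
  field_simp
  ring

lemma signal_eq (hs : s.i1 = fun v z => n.α1 * (σ1 / σv) * (v - p0) + z) (j : Fin J) (ω : Ω) :
    signal S s j ω = σ1 * (S.standardize p0 σv σ1).comb n.α1 θz j
        ⟨0, 1, (n.α1 ^ 2 + θz) / (n.α1 ^ 2 + θz + 1), 0, 0, 0, 1⟩ ω := by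
  simp only [signal, hM.orderI1_eq hs j, hM.ε_eq, Shocks.comb]
  ring

/-- A continuous regression function on the first order flow is determined by its values. -/
lemma regression_eq [StandardBorelSpace Ω]
    (hs : s.i1 = fun v z => n.α1 * (σ1 / σv) * (v - p0) + z) (j : Fin J)
    {X : Ω → ℝ} (hX : Integrable X μ) {m : ℝ → ℝ} (hm : IsRegression μ X (flow1 S s) m) (x0 k : ℝ)
    {σ : ℝ} (hσ : σ ≠ 0) {a : Weights} (ha : a.y = 0)
    (h : ∀ ω, X ω = x0 + k * flow1 S s ω + σ * (S.standardize p0 σv σ1).comb n.α1 θz j a ω) :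
    m = fun y => x0 + k * y := by
  have hflow := hM.flow1_eq hs j
  have hfm : Measurable (flow1 S s) := by
    rw [show flow1 S s = fun ω => _ from funext hflow]
    exact (measurable_comb hM.basis n.α1 j _).const_mul _
  have h1 := (hM.ae_eq_condExp_iff (info := flow1 S s) n.α1 j hfm (ψ := fun y => x0 + k * y)
    (by fun_prop) hσ hX h).2
    ((condExp_comb_eq_zero_iff_one hM.basis n.α1 hM.θz_nonneg j hM.σ1_pos.ne' hflow).2
      (by simp [Weights.dot, ha]))
  have h2 : ∀ᵐ ω ∂μ, m (flow1 S s ω) = x0 + k * flow1 S s ω := by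
    filter_upwards [hm.2, h1] with ω h2 h1
    rw [h2, h1]
  have hQ := hM.Q_pos n.α1
  have h3 : ∀ᵐ x ∂(μ.map ((S.standardize p0 σv σ1).comb n.α1 θz j ⟨0, 0, 1, 0, 0, 0, 0⟩)),
      m (σ1 * x) = x0 + k * (σ1 * x) := by
    have hmm := hm.1.measurable
    rw [ae_map_iff (measurable_comb hM.basis n.α1 j _).aemeasurable
      (p := fun x => m (σ1 * x) = x0 + k * (σ1 * x))
      (measurableSet_eq_fun (by fun_prop) (by fun_prop))]
    filter_upwards [h2] with ω h2
    rw [← hflow, h2]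
  rw [map_comb hM.basis n.α1 hM.θz_nonneg j] at h3
  -- The standardised flow has positive variance `A ^ 2 + θz + 1`, so its null sets are Lebesgue
  -- null.
  have h4 : ∀ᵐ x ∂(volume : Measure ℝ), m (σ1 * x) = x0 + k * (σ1 * x) := by
    refine (gaussianReal_absolutelyContinuous' 0 ?_).ae_le h3
    simp only [Weights.dot]
    norm_num
    linarith
  have hcont : Continuous m := hm.1
  -- Two continuous functions that agree Lebesgue almost everywhere agree everywhere; this is where
  -- continuity of the regression function enters.
  have h5 : (fun x => m (σ1 * x)) = fun x => x0 + k * (σ1 * x) :=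
    ((hcont.comp (continuous_const_mul σ1)).ae_eq_iff_eq volume (by fun_prop)).1 h4
  funext y
  have := congrFun h5 (y / σ1)
  have hσ1 := hM.σ1_pos.ne'
  simpa [mul_div_cancel₀, mul_div_cancel_left₀, hσ1] using this

/-- The regression functions of a linear profile are linear. -/
lemma eq_affineProfile [StandardBorelSpace Ω] (hJ : 1 ≤ J)
    (hs : IsLinearProfile μ S p0 (n.rescale σv σ1) s) :
    s = affineProfile J p0 σv σ1 θz n := by
  obtain ⟨mv, mi, ms, hmv, hmi, hms, hs⟩ := hs
  have hi1 : s.i1 = fun v z => n.α1 * (σ1 / σv) * (v - p0) + z := by rw [hs]; rfl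
  have hv := hM.σv_pos
  have h1 := hM.σ1_pos
  -- The index `⟨0, hJ⟩` merely selects coordinates for the signal noises; the regressions of `v`
  -- and `i1` do not depend on it.
  have ev := hM.regression_eq hi1 ⟨0, hJ⟩ (hM.integrable_v ⟨0, hJ⟩) hmv p0
    (σv / σ1 * (n.α1 / (n.α1 ^ 2 + θz + 1))) hv.ne' (a := ⟨1, 0, 0, 0, 0, 0, 0⟩) rfl
    (fun ω => by
      rw [hM.flow1_eq hi1 ⟨0, hJ⟩, hM.v_eq_comb n.α1 ⟨0, hJ⟩]
      simp only [Shocks.comb]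
      field_simp
      ring)
  have ei := hM.regression_eq hi1 ⟨0, hJ⟩ (by
      rw [show orderI1 S s = fun ω => _ from funext (hM.orderI1_eq hi1 ⟨0, hJ⟩)]
      exact (integrable_comb hM.basis _ _ _).const_mul _) hmi 0
    ((n.α1 ^ 2 + θz) / (n.α1 ^ 2 + θz + 1)) h1.ne' (a := ⟨0, 1, 0, 0, 0, 0, 0⟩) rfl
    (fun ω => by
      rw [hM.flow1_eq hi1 ⟨0, hJ⟩, hM.orderI1_eq hi1 ⟨0, hJ⟩]
      simp only [Shocks.comb]
      ring)
  have es : ∀ j, ms j = fun y => 0 + (n.α1 ^ 2 + θz) / (n.α1 ^ 2 + θz + 1) * y := fun j =>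
    hM.regression_eq hi1 j (by
      rw [show signal S s j = fun ω => _ from funext (hM.signal_eq hi1 j)]
      exact (integrable_comb hM.basis _ _ _).const_mul _) (hms j) 0
    ((n.α1 ^ 2 + θz) / (n.α1 ^ 2 + θz + 1)) h1.ne' (a := ⟨0, 1, 0, 0, 0, 0, 1⟩) rfl
    (fun ω => by
      rw [hM.flow1_eq hi1 j, hM.signal_eq hi1 j]
      simp only [Shocks.comb]
      ring)
  rw [hs, ev, ei]
  simp only [es, zero_add, affineProfile, Coeffs.rescale]

end Dealers

end StandardModel

end Model

/-! ### Pricing errors and price impacts as weights -/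

namespace Coeffs

variable (n : Coeffs)

/-- Slope of the second order of an HFT in her signal, when her second order is expressed through
her signal and the order flow at time `1₊`. -/
def slope : ℝ := n.β21 + (n.β23 - n.β22) * n.β11

/-- The effect on `p₂` of the first order of a single HFT, her own second order being fixed. -/
def impact (J : ℝ) : ℝ := n.lam21 + n.lam22 * (J - 1) * n.β22

/-- The effect on `p₂` of IT's first order through the orders of the HFTs. -/
def leak (J : ℝ) : ℝ :=
  n.lam21 * J * n.β11 + n.lam22 * J * (n.β21 + n.β23 * n.β11 + (J - 1) * n.β22 * n.β11)

/-- Value minus the first price. -/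
noncomputable def error1 (θz : ℝ) : Weights :=
  ⟨1, 0, n.α1 / (n.α1 ^ 2 + θz + 1) - n.lam1, 0, 0, 0, 0⟩

/-- Sum of the first orders of the other HFTs and of the noise order at time `1₊`. -/
def others (J : ℝ) : Weights := ⟨0, n.β11 * (J - 1), 0, 1, 0, n.β11, 0⟩

/-- Value minus the price at time `1₊`, apart from the effect of the own first order. -/
noncomputable def error1p (J θz : ℝ) : Weights :=
  ⟨1, -n.lam1p * (n.β11 * (J - 1)), n.α1 / (n.α1 ^ 2 + θz + 1) - n.lam1, -n.lam1p, 0,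
    -n.lam1p * n.β11, 0⟩

/-- Value minus the second price, apart from the effects of the own orders. -/
noncomputable def error2 (J θz : ℝ) : Weights :=
  ⟨1 - n.lam22 * n.α21,
    -n.lam22 * (n.α22 + (J - 1) * n.slope) - n.impact J * (n.β11 * (J - 1)),
    n.α1 / (n.α1 ^ 2 + θz + 1) - n.lam1, -n.impact J, -n.lam22,
    -n.lam22 * n.slope - n.impact J * n.β11, 0⟩

/-- The part of the second pricing error that IT cannot predict. -/
def noise (J : ℝ) : Weights :=
  ⟨0, 0, 0, -n.lam21 - n.lam22 * J * n.β22, -n.lam22,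
    -(n.lam21 * n.β11 + n.lam22 * (n.slope + J * n.β22 * n.β11)),
    -(n.lam21 * n.β11 + n.lam22 * (n.slope + J * n.β22 * n.β11))⟩

end Coeffs

/-- The residual of the own signal after regression on the first order flow. -/
def ownResidual : Weights := ⟨0, 1, 0, 0, 0, 0, 1⟩

/-- The own signal. -/
noncomputable def ownSignal (A θz : ℝ) : Weights :=
  ⟨0, 1, (A ^ 2 + θz) / (A ^ 2 + θz + 1), 0, 0, 0, 1⟩

/-- The first order flow. -/
def firstFlow : Weights := ⟨0, 0, 1, 0, 0, 0, 0⟩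

/-! ### Play when one HFT deviates -/

/-- The profile, except that the `j`-th HFT uses the orders `f` and `G`. -/
def withHFT {J : ℕ} (s : Profile J) (j : Fin J) (f : ℝ → ℝ → ℝ) (G : ℝ → ℝ → ℝ → ℝ → ℝ) :
    Profile J :=
  { s with x1 := Function.update s.x1 j f, x2 := Function.update s.x2 j G }

namespace StandardModel

variable {Ω : Type*} [mΩ : MeasurableSpace Ω] {J : ℕ} {μ : Measure Ω} {S : Shocks Ω J}
  {p0 σv σ1 θz θ1p θ2 θε : ℝ} (hM : StandardModel μ S p0 σv σ1 θz θ1p θ2 θε) {n : Coeffs}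
include hM

section HFT

variable (j : Fin J) (f : ℝ → ℝ → ℝ) (G : ℝ → ℝ → ℝ → ℝ → ℝ) (ω : Ω)

lemma flow1_withHFT : flow1 S (withHFT (affineProfile J p0 σv σ1 θz n) j f G) ω =
    σ1 * (S.standardize p0 σv σ1).comb n.α1 θz j firstFlow ω :=
  hM.flow1_eq rfl j ω

lemma signal_withHFT : signal S (withHFT (affineProfile J p0 σv σ1 θz n) j f G) j ω =
    σ1 * (S.standardize p0 σv σ1).comb n.α1 θz j (ownSignal n.α1 θz) ω :=
  hM.signal_eq rfl j ω

lemma ownResidual_withHFT : σ1 * (S.standardize p0 σv σ1).comb n.α1 θz j ownResidual ω =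
    signal S (withHFT (affineProfile J p0 σv σ1 θz n) j f G) j ω -
      (n.α1 ^ 2 + θz) / (n.α1 ^ 2 + θz + 1) *
        flow1 S (withHFT (affineProfile J p0 σv σ1 θz n) j f G) ω := by
  rw [hM.signal_withHFT, hM.flow1_withHFT]
  simp only [Shocks.comb, ownResidual, ownSignal, firstFlow]
  ring

omit hM mΩ in
lemma orderX1_withHFT (s : Profile J) : orderX1 S (withHFT s j f G) j ω =
    f (signal S (withHFT s j f G) j ω) (flow1 S (withHFT s j f G) ω) := by
  simp [orderX1, withHFT]

omit hM mΩ in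
lemma orderX2_withHFT (s : Profile J) : orderX2 S (withHFT s j f G) j ω =
    G (signal S (withHFT s j f G) j ω) (flow1 S (withHFT s j f G) ω)
      (flow1p S (withHFT s j f G) ω) (orderX1 S (withHFT s j f G) j ω) := by
  simp [orderX2, withHFT]

/-- The other HFTs react only to their signals and `y1`, neither of which the deviation touches. -/
lemma orderX1_withHFT_of_ne {k : Fin J} (hk : k ≠ j) :
    orderX1 S (withHFT (affineProfile J p0 σv σ1 θz n) j f G) k ω =
      σ1 * n.β11 * (S.standardize p0 σv σ1).comb n.α1 θz j ⟨0, 1, 0, 0, 0, 0, 0⟩ ω +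
        σ1 * n.β11 * (S.standardize p0 σv σ1).ε k ω := by
  have h1 : orderX1 S (withHFT (affineProfile J p0 σv σ1 θz n) j f G) k ω =
      n.β11 * (signal S (withHFT (affineProfile J p0 σv σ1 θz n) j f G) k ω -
      (n.α1 ^ 2 + θz) / (n.α1 ^ 2 + θz + 1) *
        flow1 S (withHFT (affineProfile J p0 σv σ1 θz n) j f G) ω) := by
    simp [orderX1, withHFT, Function.update_of_ne hk, affineProfile]
  rw [h1, signal, hM.orderI1_eq (n := n) rfl j, hM.flow1_eq (n := n) rfl j, hM.ε_eq]
  simp only [Shocks.comb]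
  ring

lemma flow1p_withHFT : flow1p S (withHFT (affineProfile J p0 σv σ1 θz n) j f G) ω =
    orderX1 S (withHFT (affineProfile J p0 σv σ1 θz n) j f G) j ω +
      σ1 * (S.standardize p0 σv σ1).comb n.α1 θz j (n.others J) ω := by
  rw [flow1p, sum_eq_add_others j fun k hk => hM.orderX1_withHFT_of_ne j f G ω hk, hM.u1p_eq]
  simp only [Shocks.comb, Coeffs.others]
  ring

/-- The deviation reaches another HFT's second order only through `y1+`. Rewriting that order in
terms of `y1+` and her residual signal isolates this channel, with coefficient `β22`. -/
lemma orderX2_withHFT_of_ne {k : Fin J} (hk : k ≠ j) :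
    orderX2 S (withHFT (affineProfile J p0 σv σ1 θz n) j f G) k ω =
      (n.β22 * flow1p S (withHFT (affineProfile J p0 σv σ1 θz n) j f G) ω +
        σ1 * n.slope * (S.standardize p0 σv σ1).comb n.α1 θz j ⟨0, 1, 0, 0, 0, 0, 0⟩ ω) +
        σ1 * n.slope * (S.standardize p0 σv σ1).ε k ω := by
  have h1 : orderX2 S (withHFT (affineProfile J p0 σv σ1 θz n) j f G) k ω =
      n.β21 * (signal S (withHFT (affineProfile J p0 σv σ1 θz n) j f G) k ω -
      (n.α1 ^ 2 + θz) / (n.α1 ^ 2 + θz + 1) *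
        flow1 S (withHFT (affineProfile J p0 σv σ1 θz n) j f G) ω) +
      n.β22 * (flow1p S (withHFT (affineProfile J p0 σv σ1 θz n) j f G) ω -
        orderX1 S (withHFT (affineProfile J p0 σv σ1 θz n) j f G) k ω) +
      n.β23 * orderX1 S (withHFT (affineProfile J p0 σv σ1 θz n) j f G) k ω := by
    simp [orderX2, withHFT, Function.update_of_ne hk, affineProfile]
  rw [h1, hM.orderX1_withHFT_of_ne j f G ω hk, signal, hM.orderI1_eq (n := n) rfl j,
    hM.flow1_eq (n := n) rfl j, hM.ε_eq]
  simp only [Shocks.comb, Coeffs.slope]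
  ring

lemma orderI2_withHFT : orderI2 S (withHFT (affineProfile J p0 σv σ1 θz n) j f G) ω =
    σ1 * (S.standardize p0 σv σ1).comb n.α1 θz j ⟨n.α21, n.α22, 0, 0, 0, 0, 0⟩ ω := by
  have hv := hM.σv_pos
  have h1 := hM.σ1_pos
  have hQ := hM.Q_pos n.α1
  have : orderI2 S (withHFT (affineProfile J p0 σv σ1 θz n) j f G) ω =
      n.α21 * (σ1 / σv) * (S.v ω - (p0 + σv / σ1 * (n.α1 / (n.α1 ^ 2 + θz + 1)) *
        flow1 S (withHFT (affineProfile J p0 σv σ1 θz n) j f G) ω)) +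
      n.α22 * (orderI1 S (withHFT (affineProfile J p0 σv σ1 θz n) j f G) ω -
        (n.α1 ^ 2 + θz) / (n.α1 ^ 2 + θz + 1) *
          flow1 S (withHFT (affineProfile J p0 σv σ1 θz n) j f G) ω) := rfl
  rw [this, hM.orderI1_eq (n := n) rfl j, hM.flow1_eq (n := n) rfl j, hM.v_eq]
  simp only [Shocks.comb]
  field_simp
  ring

lemma flow2_withHFT : flow2 S (withHFT (affineProfile J p0 σv σ1 θz n) j f G) ω =
    orderX2 S (withHFT (affineProfile J p0 σv σ1 θz n) j f G) j ω +
      (J - 1) * n.β22 * flow1p S (withHFT (affineProfile J p0 σv σ1 θz n) j f G) ω +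
      σ1 * (S.standardize p0 σv σ1).comb n.α1 θz j
        ⟨n.α21, n.α22 + (J - 1) * n.slope, 0, 0, 1, n.slope, 0⟩ ω := by
  rw [flow2, sum_eq_add_others j fun k hk => hM.orderX2_withHFT_of_ne j f G ω hk, hM.u2_eq,
    hM.orderI2_withHFT]
  simp only [Shocks.comb]
  ring

lemma v_sub_price1_withHFT :
    S.v ω - price1 S (withHFT (affineProfile J p0 σv σ1 θz n) j f G) ω =
      σv * (S.standardize p0 σv σ1).comb n.α1 θz j (n.error1 θz) ω := by
  have hv := hM.σv_pos
  have h1 := hM.σ1_pos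
  have : price1 S (withHFT (affineProfile J p0 σv σ1 θz n) j f G) ω =
      p0 + n.lam1 * (σv / σ1) *
        flow1 S (withHFT (affineProfile J p0 σv σ1 θz n) j f G) ω := rfl
  rw [this, hM.flow1_withHFT, hM.v_eq]
  simp only [Shocks.comb, Coeffs.error1, firstFlow]
  field_simp
  ring

lemma v_sub_price1p_withHFT :
    S.v ω - price1p S (withHFT (affineProfile J p0 σv σ1 θz n) j f G) ω =
      σv * (S.standardize p0 σv σ1).comb n.α1 θz j (n.error1p J θz) ω -
        σv / σ1 * n.lam1p *
          orderX1 S (withHFT (affineProfile J p0 σv σ1 θz n) j f G) j ω := by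
  have h1 := hM.σ1_pos
  have : price1p S (withHFT (affineProfile J p0 σv σ1 θz n) j f G) ω =
      price1 S (withHFT (affineProfile J p0 σv σ1 θz n) j f G) ω + n.lam1p * (σv / σ1) *
        flow1p S (withHFT (affineProfile J p0 σv σ1 θz n) j f G) ω := rfl
  rw [this, ← sub_sub, hM.v_sub_price1_withHFT, hM.flow1p_withHFT]
  simp only [Shocks.comb, Coeffs.error1, Coeffs.error1p, Coeffs.others]
  field_simp
  ring

/-- The own first order moves `p2` directly through `lam21` and also through the reaction of the
other `J - 1` HFTs to `y1+`; together these make up `impact`. The own second order acts through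
`lam22` alone. -/
lemma v_sub_price2_withHFT :
    S.v ω - price2 S (withHFT (affineProfile J p0 σv σ1 θz n) j f G) ω =
      σv * (S.standardize p0 σv σ1).comb n.α1 θz j (n.error2 J θz) ω -
        σv / σ1 * n.impact J *
          orderX1 S (withHFT (affineProfile J p0 σv σ1 θz n) j f G) j ω -
        σv / σ1 * n.lam22 *
          orderX2 S (withHFT (affineProfile J p0 σv σ1 θz n) j f G) j ω := by
  have h1 := hM.σ1_pos
  have : price2 S (withHFT (affineProfile J p0 σv σ1 θz n) j f G) ω =
      price1 S (withHFT (affineProfile J p0 σv σ1 θz n) j f G) ω + n.lam21 * (σv / σ1) *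
        flow1p S (withHFT (affineProfile J p0 σv σ1 θz n) j f G) ω + n.lam22 * (σv / σ1) *
        flow2 S (withHFT (affineProfile J p0 σv σ1 θz n) j f G) ω := rfl
  rw [this, ← sub_sub, ← sub_sub, hM.v_sub_price1_withHFT, hM.flow2_withHFT, hM.flow1p_withHFT]
  simp only [Shocks.comb, Coeffs.error1, Coeffs.error2, Coeffs.others, Coeffs.impact]
  field_simp
  ring

omit hM in
lemma withHFT_self (s : Profile J) : withHFT s j (s.x1 j) (s.x2 j) = s := by
  simp [withHFT]

end HFT

/-! ### Play when the informed trader deviates -/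

section IT

variable (j : Fin J) (f : ℝ → ℝ → ℝ) (g : ℝ → ℝ → ℝ → ℝ) (ω : Ω)

/-- The gap splits into noise that the informed trader cannot predict, a part she knows when
choosing her second order, and the impact of that order. Her first order affects the HFTs' total
trading through `leak`. -/
lemma v_sub_price2_withI2 :
    S.v ω - price2 S (withI2 (withI1 (affineProfile J p0 σv σ1 θz n) f) g) ω =
      σv * (S.standardize p0 σv σ1).comb n.α1 θz j (n.noise J) ω +
      (S.v ω - p0 - σv / σ1 * n.lam1 *
          flow1 S (withI2 (withI1 (affineProfile J p0 σv σ1 θz n) f) g) ω -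
        σv / σ1 * n.leak J * (orderI1 S (withI2 (withI1 (affineProfile J p0 σv σ1 θz n) f) g) ω -
          (n.α1 ^ 2 + θz) / (n.α1 ^ 2 + θz + 1) *
            flow1 S (withI2 (withI1 (affineProfile J p0 σv σ1 θz n) f) g) ω)) -
      σv / σ1 * n.lam22 *
        orderI2 S (withI2 (withI1 (affineProfile J p0 σv σ1 θz n) f) g) ω := by
  have h1 := hM.σ1_pos
  set t := withI2 (withI1 (affineProfile J p0 σv σ1 θz n) f) g with ht
  -- The HFTs keep the regression slope of the conjectured profile, so after a deviation `ι` need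
  -- not be a regression residual.
  set ι := orderI1 S t ω - (n.α1 ^ 2 + θz) / (n.α1 ^ 2 + θz + 1) * flow1 S t ω with hι
  have hx1 : ∀ k, orderX1 S t k ω =
      n.β11 * ι + n.β11 * σ1 * (S.standardize p0 σv σ1).ε k ω := fun k => by
    have : orderX1 S t k ω = n.β11 * (signal S t k ω -
      (n.α1 ^ 2 + θz) / (n.α1 ^ 2 + θz + 1) * flow1 S t ω) := rfl
    rw [this, signal, hM.ε_eq, hι]
    ring
  have hx2 : ∀ k, orderX2 S t k ω = (n.slope * ι + n.β22 * flow1p S t ω) +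
      n.slope * σ1 * (S.standardize p0 σv σ1).ε k ω := fun k => by
    have : orderX2 S t k ω = n.β21 * (signal S t k ω -
        (n.α1 ^ 2 + θz) / (n.α1 ^ 2 + θz + 1) * flow1 S t ω) +
        n.β22 * (flow1p S t ω - orderX1 S t k ω) + n.β23 * orderX1 S t k ω := rfl
    rw [this, signal, hM.ε_eq, hx1, hι, Coeffs.slope]
    ring
  have hp : price2 S t ω = (p0 + n.lam1 * (σv / σ1) * flow1 S t ω) +
      n.lam21 * (σv / σ1) * flow1p S t ω + n.lam22 * (σv / σ1) * flow2 S t ω := rfl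
  have hy2 : flow2 S t ω = orderI2 S t ω + (∑ k, orderX2 S t k ω) + S.u2 ω := rfl
  have hy1p : flow1p S t ω = (∑ k, orderX1 S t k ω) + S.u1p ω := rfl
  rw [hp, hy2, sum_eq_add_others j fun k _ => hx2 k, hx2 j, hy1p,
    sum_eq_add_others j fun k _ => hx1 k, hx1 j, hM.u1p_eq, hM.u2_eq]
  simp only [Shocks.comb, Coeffs.noise, Coeffs.leak, Coeffs.slope]
  field_simp
  ring

end IT

end StandardModel

/-! ### Weights along the profile and first-order conditions -/

namespace Coeffs

variable (n : Coeffs)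

/-- The order flow at time `1₊` when all traders follow their strategies. -/
def flow1pWeights (J : ℝ) : Weights := ⟨0, n.β11 * J, 0, 1, 0, n.β11, n.β11⟩

/-- The order flow at time `2` when all traders follow their strategies. -/
def flow2Weights (J : ℝ) : Weights :=
  ⟨n.α21, n.α22 + J * n.slope + J * n.β22 * (n.β11 * J), 0, J * n.β22, 1,
    n.slope + J * n.β22 * n.β11, n.slope + J * n.β22 * n.β11⟩

/-- Value minus the price at time `1₊` when all traders follow their strategies. -/
noncomputable def pathError1p (J θz : ℝ) : Weights :=
  ⟨1, -n.lam1p * (n.β11 * J), n.α1 / (n.α1 ^ 2 + θz + 1) - n.lam1, -n.lam1p, 0,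
    -n.lam1p * n.β11, -n.lam1p * n.β11⟩

/-- Value minus the second price when all traders follow their strategies. -/
noncomputable def pathError2 (J θz : ℝ) : Weights :=
  ⟨1 - n.lam22 * n.α21,
    -n.lam21 * (n.β11 * J) - n.lam22 * (n.α22 + J * n.slope + J * n.β22 * (n.β11 * J)),
    n.α1 / (n.α1 ^ 2 + θz + 1) - n.lam1, -n.lam21 - n.lam22 * (J * n.β22), -n.lam22,
    -n.lam21 * n.β11 - n.lam22 * (n.slope + J * n.β22 * n.β11),
    -n.lam21 * n.β11 - n.lam22 * (n.slope + J * n.β22 * n.β11)⟩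

/-- First-order condition of the second order of an HFT. -/
noncomputable def foc2 (J θz : ℝ) : Weights :=
  ⟨1 - n.lam22 * n.α21,
    -n.lam22 * (n.α22 + (J - 1) * n.slope) -
      (n.impact J + 2 * n.lam22 * n.β22) * (n.β11 * (J - 1)) - 2 * n.lam22 * n.β21,
    n.α1 / (n.α1 ^ 2 + θz + 1) - n.lam1, -(n.impact J + 2 * n.lam22 * n.β22), -n.lam22,
    -n.lam22 * n.slope - (n.impact J + 2 * n.lam22 * n.β22) * n.β11, -2 * n.lam22 * n.β21⟩

/-- Second-order expression of the first order of an HFT. -/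
def soc1 (J : ℝ) : ℝ := n.lam1p + (n.impact J + n.lam22 * n.β23) * n.β23

/-- First-order condition of the first order of an HFT. -/
noncomputable def foc1 (J θz : ℝ) : Weights :=
  let E := n.error2 J θz
  let x := n.lam1p + n.β23 * (n.impact J + n.lam22 * n.β22) +
    (n.impact J + n.lam22 * n.β23) * n.β22
  let r := -(n.impact J + n.lam22 * n.β23) * n.β21 - n.β23 * n.lam22 * n.β21 -
    2 * n.soc1 J * n.β11
  ⟨1 + n.β23 * E.n,
    n.β23 * (-n.lam22 * (n.α22 + (J - 1) * n.slope)) - x * (n.β11 * (J - 1)) + r,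
    (1 + n.β23) * (n.α1 / (n.α1 ^ 2 + θz + 1) - n.lam1), -x, -n.β23 * n.lam22,
    -n.β23 * n.lam22 * n.slope - x * n.β11, r⟩

/-- The effect of IT's first order on her second order. -/
noncomputable def carry (θz : ℝ) : ℝ :=
  -n.α21 * (n.α1 / (n.α1 ^ 2 + θz + 1)) +
    n.α22 * (1 - (n.α1 ^ 2 + θz) / (n.α1 ^ 2 + θz + 1))

/-- The effect of the first noise order on IT's second order. -/
noncomputable def carryNoise (θz : ℝ) : ℝ :=
  -n.α21 * (n.α1 / (n.α1 ^ 2 + θz + 1)) - n.α22 * ((n.α1 ^ 2 + θz) / (n.α1 ^ 2 + θz + 1))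

end Coeffs

namespace StandardModel

variable {Ω : Type*} [mΩ : MeasurableSpace Ω] {J : ℕ} {μ : Measure Ω}
  {S : Shocks Ω J}
  {p0 σv σ1 θz θ1p θ2 θε : ℝ} (hM : StandardModel μ S p0 σv σ1 θz θ1p θ2 θε) {n : Coeffs}
include hM

/-! ### Weak efficiency as vanishing covariances -/

section Dealers

variable (j : Fin J) (ω : Ω)

lemma flow1_affine : flow1 S (affineProfile J p0 σv σ1 θz n) ω =
    σ1 * (S.standardize p0 σv σ1).comb n.α1 θz j firstFlow ω := hM.flow1_eq rfl j ω

/-- Prescribed play is the trivial deviation (`withHFT_self`), so the formulas for deviations can be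
specialised. -/
lemma orderX1_affine : orderX1 S (affineProfile J p0 σv σ1 θz n) j ω =
    σ1 * (n.β11 * (S.standardize p0 σv σ1).comb n.α1 θz j ownResidual ω) := by
  have h := hM.ownResidual_withHFT (n := n) j ((affineProfile J p0 σv σ1 θz n).x1 j)
    ((affineProfile J p0 σv σ1 θz n).x2 j) ω
  rw [withHFT_self] at h
  have h2 : orderX1 S (affineProfile J p0 σv σ1 θz n) j ω =
    n.β11 * (signal S (affineProfile J p0 σv σ1 θz n) j ω -
      (n.α1 ^ 2 + θz) / (n.α1 ^ 2 + θz + 1) * flow1 S (affineProfile J p0 σv σ1 θz n) ω) := rfl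
  rw [h2, ← h]
  ring

lemma flow1p_affine : flow1p S (affineProfile J p0 σv σ1 θz n) ω =
    σ1 * (S.standardize p0 σv σ1).comb n.α1 θz j (n.flow1pWeights J) ω := by
  have h := hM.flow1p_withHFT (n := n) j ((affineProfile J p0 σv σ1 θz n).x1 j)
    ((affineProfile J p0 σv σ1 θz n).x2 j) ω
  rw [withHFT_self, hM.orderX1_affine] at h
  rw [h]
  simp only [Shocks.comb, ownResidual, Coeffs.others, Coeffs.flow1pWeights]
  ring

lemma orderX2_affine : orderX2 S (affineProfile J p0 σv σ1 θz n) j ω =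
    σ1 * ((n.β21 + (n.β23 - n.β22) * n.β11) *
        (S.standardize p0 σv σ1).comb n.α1 θz j ownResidual ω +
      n.β22 * (S.standardize p0 σv σ1).comb n.α1 θz j (n.flow1pWeights J) ω) := by
  have h := hM.ownResidual_withHFT (n := n) j ((affineProfile J p0 σv σ1 θz n).x1 j)
    ((affineProfile J p0 σv σ1 θz n).x2 j) ω
  rw [withHFT_self] at h
  have h2 : orderX2 S (affineProfile J p0 σv σ1 θz n) j ω =
    n.β21 * (signal S (affineProfile J p0 σv σ1 θz n) j ω -
      (n.α1 ^ 2 + θz) / (n.α1 ^ 2 + θz + 1) * flow1 S (affineProfile J p0 σv σ1 θz n) ω) +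
    n.β22 * (flow1p S (affineProfile J p0 σv σ1 θz n) ω -
      orderX1 S (affineProfile J p0 σv σ1 θz n) j ω) +
    n.β23 * orderX1 S (affineProfile J p0 σv σ1 θz n) j ω := rfl
  rw [h2, ← h, hM.flow1p_affine j, hM.orderX1_affine]
  ring

lemma flow2_affine : flow2 S (affineProfile J p0 σv σ1 θz n) ω =
    σ1 * (S.standardize p0 σv σ1).comb n.α1 θz j (n.flow2Weights J) ω := by
  have h := hM.flow2_withHFT (n := n) j ((affineProfile J p0 σv σ1 θz n).x1 j)
    ((affineProfile J p0 σv σ1 θz n).x2 j) ω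
  rw [withHFT_self, hM.orderX2_affine, hM.flow1p_affine j] at h
  rw [h]
  simp only [Shocks.comb, ownResidual, Coeffs.slope, Coeffs.flow1pWeights, Coeffs.flow2Weights]
  ring

lemma v_sub_price1_affine : S.v ω = price1 S (affineProfile J p0 σv σ1 θz n) ω +
    σv * (S.standardize p0 σv σ1).comb n.α1 θz j (n.error1 θz) ω := by
  have h := hM.v_sub_price1_withHFT (n := n) j ((affineProfile J p0 σv σ1 θz n).x1 j)
    ((affineProfile J p0 σv σ1 θz n).x2 j) ω
  rw [withHFT_self] at h
  linarith

lemma v_sub_price1p_affine : S.v ω = price1p S (affineProfile J p0 σv σ1 θz n) ω +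
    σv * (S.standardize p0 σv σ1).comb n.α1 θz j (n.pathError1p J θz) ω := by
  have h := hM.v_sub_price1p_withHFT (n := n) j ((affineProfile J p0 σv σ1 θz n).x1 j)
    ((affineProfile J p0 σv σ1 θz n).x2 j) ω
  have h1 := hM.σ1_pos
  rw [withHFT_self, hM.orderX1_affine, sub_eq_iff_eq_add'] at h
  rw [h]
  congr 1
  simp only [Shocks.comb, ownResidual, Coeffs.error1p, Coeffs.pathError1p]
  field_simp
  ring

lemma v_sub_price2_affine : S.v ω = price2 S (affineProfile J p0 σv σ1 θz n) ω +
    σv * (S.standardize p0 σv σ1).comb n.α1 θz j (n.pathError2 J θz) ω := by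
  have h := hM.v_sub_price2_withHFT (n := n) j ((affineProfile J p0 σv σ1 θz n).x1 j)
    ((affineProfile J p0 σv σ1 θz n).x2 j) ω
  have h1 := hM.σ1_pos
  rw [withHFT_self, hM.orderX1_affine, hM.orderX2_affine, sub_eq_iff_eq_add'] at h
  rw [h]
  congr 1
  simp only [Shocks.comb, ownResidual, Coeffs.error2, Coeffs.pathError2, Coeffs.impact,
    Coeffs.slope, Coeffs.flow1pWeights]
  field_simp
  ring

lemma measurable_flow1_affine (j : Fin J) : Measurable (flow1 S (affineProfile J p0 σv σ1 θz n)) := by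
  rw [show flow1 S _ = fun ω => _ from funext (hM.flow1_affine (n := n) j)]
  exact (measurable_comb hM.basis _ _ _).const_mul _

lemma measurable_flow1p_affine (j : Fin J) : Measurable (flow1p S (affineProfile J p0 σv σ1 θz n)) := by
  rw [show flow1p S _ = fun ω => _ from funext (hM.flow1p_affine (n := n) j)]
  exact (measurable_comb hM.basis _ _ _).const_mul _

lemma measurable_flow2_affine (j : Fin J) : Measurable (flow2 S (affineProfile J p0 σv σ1 θz n)) := by
  rw [show flow2 S _ = fun ω => _ from funext (hM.flow2_affine (n := n) j)]
  exact (measurable_comb hM.basis _ _ _).const_mul _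

/-- Weak efficiency of the prices in terms of covariances. -/
lemma dealers_iff (j : Fin J) [StandardBorelSpace Ω] :
    DealersEfficient μ S (affineProfile J p0 σv σ1 θz n) ↔
      (n.error1 θz).dot J θz θ1p θ2 θε n.α1 firstFlow = 0 ∧
      ((n.pathError1p J θz).dot J θz θ1p θ2 θε n.α1 firstFlow = 0 ∧
        (n.pathError1p J θz).dot J θz θ1p θ2 θε n.α1 (n.flow1pWeights J) = 0) ∧
      ((n.pathError2 J θz).dot J θz θ1p θ2 θε n.α1 firstFlow = 0 ∧
        (n.pathError2 J θz).dot J θz θ1p θ2 θε n.α1 (n.flow1pWeights J) = 0 ∧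
        (n.pathError2 J θz).dot J θz θ1p θ2 θε n.α1 (n.flow2Weights J) = 0) := by
  have m1 := hM.measurable_flow1_affine (n := n) j
  have m1p := hM.measurable_flow1p_affine (n := n) j
  have m2 := hM.measurable_flow2_affine (n := n) j
  have hs := measurable_affineProfile J p0 σv σ1 θz n
  have hv := hM.integrable_v j
  refine and_congr ?_ (and_congr ?_ ?_)
  · rw [← condExp_comb_eq_zero_iff_one hM.basis n.α1 hM.θz_nonneg j hM.σ1_pos.ne'
      (hM.flow1_affine (n := n) j)]
    exact hM.ae_eq_condExp_iff (info := flow1 S (affineProfile J p0 σv σ1 θz n)) n.α1 j m1 hs.p1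
      hM.σv_pos.ne' hv (hM.v_sub_price1_affine j)
  · rw [← condExp_comb_eq_zero_iff_two hM.basis n.α1 hM.θz_nonneg j hM.σ1_pos.ne'
      (info := fun ω => (flow1 S (affineProfile J p0 σv σ1 θz n) ω,
        flow1p S (affineProfile J p0 σv σ1 θz n) ω))
      (fun ω => by rw [hM.flow1_affine j, hM.flow1p_affine j])]
    exact hM.ae_eq_condExp_iff (info := fun ω => (flow1 S (affineProfile J p0 σv σ1 θz n) ω,
        flow1p S (affineProfile J p0 σv σ1 θz n) ω)) n.α1 j (m1.prodMk m1p) hs.p1p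
      hM.σv_pos.ne' hv (hM.v_sub_price1p_affine j)
  · rw [← condExp_comb_eq_zero_iff_three hM.basis n.α1 hM.θz_nonneg j hM.σ1_pos.ne'
      (info := fun ω => (flow1 S (affineProfile J p0 σv σ1 θz n) ω,
        flow1p S (affineProfile J p0 σv σ1 θz n) ω, flow2 S (affineProfile J p0 σv σ1 θz n) ω))
      (f := fun _ _ => 0) measurable_const
      (fun ω => by rw [hM.flow1_affine j, hM.flow1p_affine j, hM.flow2_affine j, zero_add])]
    exact hM.ae_eq_condExp_iff (info := fun ω => (flow1 S (affineProfile J p0 σv σ1 θz n) ω,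
        flow1p S (affineProfile J p0 σv σ1 θz n) ω, flow2 S (affineProfile J p0 σv σ1 θz n) ω))
      n.α1 j (m1.prodMk (m1p.prodMk m2)) hs.p2 hM.σv_pos.ne' hv (hM.v_sub_price2_affine j)

end Dealers

/-! ### Optimality of the HFTs' orders -/

section HFTDecisions

variable (j : Fin J)

/-- Optimality of the second order of an HFT after a given first order. -/
lemma hft_second_iff_of_first [StandardBorelSpace Ω] [IsProbabilityMeasure μ] {f : ℝ → ℝ → ℝ}
    (hf : Measurable fun a : ℝ × ℝ => f a.1 a.2) :
    (∀ g : ℝ → ℝ → ℝ → ℝ, Measurable (fun a : ℝ × ℝ × ℝ => g a.1 a.2.1 a.2.2) →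
      let t := withX1 (affineProfile J p0 σv σ1 θz n) j f
      let t' := withX2 t j g
      ∀ᵐ ω ∂μ, orderX2 S t' j ω ≠ orderX2 S t j ω →
        condMean μ (infoX2 S t j)
            (fun ω' => profitX2 S t' j ω' - penalty S t' (fun _ => 0) j ω') ω <
          condMean μ (infoX2 S t j)
            (fun ω' => profitX2 S t j ω' - penalty S t (fun _ => 0) j ω') ω) ↔
      0 < n.lam22 ∧ ∀ᵐ ω ∂μ, σ1 * (μ[(S.standardize p0 σv σ1).comb n.α1 θz j (n.foc2 J θz) |
          MeasurableSpace.comap (infoX2 S (withX1 (affineProfile J p0 σv σ1 θz n) j f) j)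
            inferInstance]) ω -
        (n.impact J + 2 * n.lam22 * n.β23) *
          f (signal S (affineProfile J p0 σv σ1 θz n) j ω)
            (flow1 S (affineProfile J p0 σv σ1 θz n) ω) = 0 := by
  have hσv := hM.σv_pos
  have hσ1 := hM.σ1_pos
  set s := affineProfile J p0 σv σ1 θz n with hs
  set G : ℝ → ℝ → ℝ → ℝ → ℝ := s.x2 j with hG
  have ht : withX1 s j f = withHFT s j f G := by simp [withX1, withHFT, hG]
  have ht' : ∀ g, withX2 (withX1 s j f) j g = withHFT s j f fun a b c _ => g a b c := fun g => rfl
  have hf' : Measurable fun a : ℝ × ℝ × ℝ => f a.1 a.2.1 :=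
    hf.comp (f := fun a : ℝ × ℝ × ℝ => (a.1, a.2.1)) (by fun_prop)
  let gs : ℝ × ℝ × ℝ → ℝ := fun a => G a.1 a.2.1 a.2.2 (f a.1 a.2.1)
  have hgs : Measurable gs := by
    simp only [gs, hG, hs, affineProfile]; fun_prop
  have hgs_eq : ∀ a b c, gs (a, b, c) =
      n.β21 * (a - (n.α1 ^ 2 + θz) / (n.α1 ^ 2 + θz + 1) * b) + n.β22 * (c - f a b) +
        n.β23 * f a b := fun _ _ _ => rfl
  -- These are the terms carrying the own first order: its impact on `p2` and the `β23` part of the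
  -- prescribed second order. All other parts of the first-order condition are collected in `foc2`.
  let φ : ℝ × ℝ × ℝ → ℝ := fun a =>
    -(σv / σ1) * (n.impact J + 2 * n.lam22 * n.β23) * f a.1 a.2.1
  have hφ : Measurable φ := by simp only [φ]; fun_prop
  have hφ_eq : ∀ a b c, φ (a, b, c) =
      -(σv / σ1) * (n.impact J + 2 * n.lam22 * n.β23) * f a b := fun _ _ _ => rfl
  set info := infoX2 S (withX1 s j f) j with hinfo
  have hinfo_eq : ∀ ω, info ω = (σ1 * (S.standardize p0 σv σ1).comb n.α1 θz j
      (ownSignal n.α1 θz) ω, σ1 * (S.standardize p0 σv σ1).comb n.α1 θz j firstFlow ω,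
      f (σ1 * (S.standardize p0 σv σ1).comb n.α1 θz j (ownSignal n.α1 θz) ω)
        (σ1 * (S.standardize p0 σv σ1).comb n.α1 θz j firstFlow ω) +
      σ1 * (S.standardize p0 σv σ1).comb n.α1 θz j (n.others J) ω) := fun ω => by
    rw [hinfo, ht, infoX2, hM.flow1p_withHFT, orderX1_withHFT, hM.signal_withHFT,
      hM.flow1_withHFT]
  have hmeas : Measurable info := by
    have m1 := measurable_comb (θz := θz) hM.basis n.α1 j (ownSignal n.α1 θz)
    have m2 := measurable_comb (θz := θz) hM.basis n.α1 j firstFlow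
    have m3 := measurable_comb (θz := θz) hM.basis n.α1 j (n.others J)
    rw [show info = fun ω => _ from funext hinfo_eq]
    exact (m1.const_mul _).prodMk ((m2.const_mul _).prodMk
      ((hf.comp ((m1.const_mul _).prodMk (m2.const_mul _))).add (m3.const_mul _)))
  -- Expanding around the prescribed order `gs` puts the profit into the form that
  -- `unique_max_condMean_iff` requires.
  have profit : ∀ (H : ℝ → ℝ → ℝ → ℝ → ℝ) ω, profitX2 S (withHFT s j f H) j ω =
      orderX2 S (withHFT s j f H) j ω *
        (σv * (S.standardize p0 σv σ1).comb n.α1 θz j (n.foc2 J θz) ω +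
          2 * (σv / σ1 * n.lam22) * gs (info ω) + φ (info ω)) -
        σv / σ1 * n.lam22 * orderX2 S (withHFT s j f H) j ω ^ 2 := by
    intro H ω
    have e1 := hM.ownResidual_withHFT (n := n) j f H ω
    rw [hM.signal_withHFT, hM.flow1_withHFT] at e1
    rw [profitX2, hM.v_sub_price2_withHFT, orderX1_withHFT, hM.signal_withHFT, hM.flow1_withHFT,
      hinfo_eq, hgs_eq, hφ_eq, ← e1, add_sub_cancel_left]
    simp only [Shocks.comb, Coeffs.foc2, Coeffs.error2, ownResidual, Coeffs.others]
    field_simp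
    ring
  let P : (ℝ × ℝ × ℝ → ℝ) → Ω → ℝ := fun g ω =>
    profitX2 S (withHFT s j f fun a b c _ => g (a, b, c)) j ω
  have horder : ∀ g : ℝ × ℝ × ℝ → ℝ, ∀ ω,
      orderX2 S (withHFT s j f fun a b c _ => g (a, b, c)) j ω = g (info ω) := fun g ω => by
    rw [orderX2_withHFT]; rfl
  have hPgs : ∀ ω, P gs ω = profitX2 S (withHFT s j f G) j ω := fun ω => by
    have : orderX2 S (withHFT s j f G) j ω = gs (info ω) := by
      rw [orderX2_withHFT, orderX1_withHFT, hinfo, ht]; rfl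
    simp only [P]
    rw [profit, profit, horder, this]
  have key := unique_max_condMean_iff (μ := μ) hmeas
    (integrable_comb (θz := θz) hM.basis n.α1 j (n.foc2 J θz)) σv (σv / σ1 * n.lam22) hgs hφ
    (n := 0) (fun i => i.elim0) (Y := fun i => i.elim0) (fun i => i.elim0) (P := P)
    (fun g ω => by simp only [P]; rw [profit, horder]; simp)
  have hpos : 0 < σv / σ1 * n.lam22 ↔ 0 < n.lam22 := by
    rw [mul_pos_iff_of_pos_left (by positivity)]
  rw [hpos] at key
  have hlast : (∀ᵐ ω ∂μ, σv * (μ[(S.standardize p0 σv σ1).comb n.α1 θz j (n.foc2 J θz) |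
      MeasurableSpace.comap info inferInstance]) ω + φ (info ω) = 0) ↔
      ∀ᵐ ω ∂μ, σ1 * (μ[(S.standardize p0 σv σ1).comb n.α1 θz j (n.foc2 J θz) |
          MeasurableSpace.comap info inferInstance]) ω -
        (n.impact J + 2 * n.lam22 * n.β23) * f (signal S s j ω) (flow1 S s ω) = 0 := by
    refine Filter.eventually_congr (Filter.Eventually.of_forall fun ω => ?_)
    have : φ (info ω) = -(σv / σ1) * (n.impact J + 2 * n.lam22 * n.β23) *
      f (signal S s j ω) (flow1 S s ω) := rfl
    rw [this]
    generalize (μ[(S.standardize p0 σv σ1).comb n.α1 θz j (n.foc2 J θz) |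
      MeasurableSpace.comap info inferInstance]) ω = x
    generalize f (signal S s j ω) (flow1 S s ω) = y
    rw [show σv * x + -(σv / σ1) * (n.impact J + 2 * n.lam22 * n.β23) * y =
      σv / σ1 * (σ1 * x - (n.impact J + 2 * n.lam22 * n.β23) * y) by field_simp; ring,
      mul_eq_zero, or_iff_right (by positivity)]
  rw [hlast] at key
  rw [← key]
  have hpen : ∀ t : Profile J, (fun ω' => profitX2 S t j ω' - penalty S t (fun _ => 0) j ω') =
      profitX2 S t j := fun t => by funext ω; simp [penalty]
  have hPgs' : profitX2 S (withX1 s j f) j = P gs := by rw [ht]; exact (funext hPgs).symm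
  have horder' : ∀ ω, orderX2 S (withX1 s j f) j ω = gs (info ω) := fun ω => by
    rw [hinfo, ht, orderX2_withHFT, orderX1_withHFT]; rfl
  simp only [hpen]
  simp only [hPgs']
  constructor
  · intro h g hg
    filter_upwards [h (fun a b c => g (a, b, c)) hg] with ω h hne
    exact h (by rw [ht', horder, horder']; exact hne)
  · intro h g hg
    filter_upwards [h (fun a => g a.1 a.2.1 a.2.2) hg] with ω h hne
    exact h fun h' => hne ((horder (fun a => g a.1 a.2.1 a.2.2) ω).trans
      (h'.trans (horder' ω).symm))

/-- The covariance conditions are the same after every first order, because the information is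
equivalent. The own first order enters the first-order condition only with the factor `impact + 2 *
lam22 * β23`, so demanding optimality after all first orders splits the condition in two. -/
lemma hft_second_iff [StandardBorelSpace Ω] [IsProbabilityMeasure μ] :
    HFTSecondOptimal μ S (fun _ => 0) (affineProfile J p0 σv σ1 θz n) j ↔
      0 < n.lam22 ∧ n.impact J + 2 * n.lam22 * n.β23 = 0 ∧
      (n.foc2 J θz).dot J θz θ1p θ2 θε n.α1 (ownSignal n.α1 θz) = 0 ∧
      (n.foc2 J θz).dot J θz θ1p θ2 θε n.α1 firstFlow = 0 ∧
      (n.foc2 J θz).dot J θz θ1p θ2 θε n.α1 (n.others J) = 0 := by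
  have hσ1 := hM.σ1_pos
  have hcond : ∀ f : ℝ → ℝ → ℝ, Measurable (fun a : ℝ × ℝ => f a.1 a.2) →
      (μ[(S.standardize p0 σv σ1).comb n.α1 θz j (n.foc2 J θz) |
          MeasurableSpace.comap (infoX2 S (withX1 (affineProfile J p0 σv σ1 θz n) j f) j)
            inferInstance] =ᵐ[μ] 0 ↔ _) := fun f hf =>
    condExp_comb_eq_zero_iff_three hM.basis n.α1 hM.θz_nonneg j hσ1.ne' (a := n.foc2 J θz)
      (b₁ := ownSignal n.α1 θz) (b₂ := firstFlow) (b₃ := n.others J) hf fun ω => by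
        have ht : withX1 (affineProfile J p0 σv σ1 θz n) j f =
          withHFT (affineProfile J p0 σv σ1 θz n) j f ((affineProfile J p0 σv σ1 θz n).x2 j) := by
          simp [withX1, withHFT]
        rw [ht, infoX2, hM.flow1p_withHFT, orderX1_withHFT, hM.signal_withHFT, hM.flow1_withHFT]
  have hall : HFTSecondOptimal μ S (fun _ => 0) (affineProfile J p0 σv σ1 θz n) j ↔ _ :=
    forall₂_congr fun f hf => hM.hft_second_iff_of_first j hf
  rw [hall]
  constructor
  · intro h
    obtain ⟨hK, h0⟩ := h (fun _ _ => 0) measurable_const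
    have hd := (hcond (fun _ _ => 0) measurable_const).1 (by
      filter_upwards [h0] with ω h0
      simpa [hσ1.ne'] using h0)
    refine ⟨hK, ?_, hd⟩
    -- With the conditional mean of `foc2` known to vanish, the constant first order 1 leaves
    -- exactly the reaction coefficient.
    obtain ⟨ω, h1, h2⟩ := ((h (fun _ _ => 1) measurable_const).2.and
      ((hcond (fun _ _ => 1) measurable_const).2 hd)).exists
    rw [h2] at h1
    simp only [Pi.zero_apply] at h1
    linarith
  · rintro ⟨hK, hκ, hd⟩ f hf
    refine ⟨hK, ?_⟩
    filter_upwards [(hcond f hf).2 hd] with ω h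
    rw [h, hκ]
    simp

/-- Since the second order follows the fixed linear strategy, the total profit is quadratic in the
first order; its curvature `soc1` combines the impact on `p1+` with the effect on `p2` through the
induced change of the second order. -/
lemma hft_first_iff [StandardBorelSpace Ω] [IsProbabilityMeasure μ] :
    HFTFirstOptimal μ S (fun _ => 0) (affineProfile J p0 σv σ1 θz n) j ↔
      0 < n.soc1 J ∧
      (n.foc1 J θz).dot J θz θ1p θ2 θε n.α1 (ownSignal n.α1 θz) = 0 ∧
      (n.foc1 J θz).dot J θz θ1p θ2 θε n.α1 firstFlow = 0 := by
  have hσv := hM.σv_pos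
  have hσ1 := hM.σ1_pos
  set s := affineProfile J p0 σv σ1 θz n with hs
  set G : ℝ → ℝ → ℝ → ℝ → ℝ := s.x2 j with hG
  have ht : ∀ f, withX1 s j f = withHFT s j f G := fun f => by simp [withX1, withHFT, hG]
  set info := infoX1 S s j with hinfo
  have hinfo_eq : ∀ ω, info ω = (σ1 * (S.standardize p0 σv σ1).comb n.α1 θz j
      (ownSignal n.α1 θz) ω, σ1 * (S.standardize p0 σv σ1).comb n.α1 θz j firstFlow ω) :=
    fun ω => by
      rw [hinfo, infoX1, hM.flow1_affine j, hM.signal_eq (n := n) rfl j]; rfl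
  have hmeas : Measurable info := by
    have m1 := measurable_comb (θz := θz) hM.basis n.α1 j (ownSignal n.α1 θz)
    have m2 := measurable_comb (θz := θz) hM.basis n.α1 j firstFlow
    rw [show info = fun ω => _ from funext hinfo_eq]
    exact (m1.const_mul _).prodMk (m2.const_mul _)
  rw [← condExp_comb_eq_zero_iff_two hM.basis n.α1 hM.θz_nonneg j hσ1.ne' hinfo_eq]
  let gs : ℝ × ℝ → ℝ := fun a => s.x1 j a.1 a.2
  have hgs : Measurable gs := by simp only [gs, hs, affineProfile]; fun_prop
  have hgs_eq : ∀ a b, gs (a, b) =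
      n.β11 * (a - (n.α1 ^ 2 + θz) / (n.α1 ^ 2 + θz + 1) * b) := fun _ _ => rfl
  -- `U` is the part of the second order that does not react to the own first order. The profit `Y`
  -- it earns apart from the first order's effects is a product of square-integrable variables and
  -- drops out of the comparison.
  let U : Ω → ℝ := (S.standardize p0 σv σ1).comb n.α1 θz j
    ⟨0, n.β21 + n.β22 * (n.β11 * (J - 1)), 0, n.β22, 0, n.β22 * n.β11, n.β21⟩
  let Y : Ω → ℝ := fun ω => U ω *
    ((S.standardize p0 σv σ1).comb n.α1 θz j (n.error2 J θz) ω - n.lam22 * U ω)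
  have hY : Integrable Y μ := (memLp_comb hM.basis _ _ _).integrable_mul
    ((memLp_comb hM.basis _ _ _).sub ((memLp_comb hM.basis _ _ _).const_mul _))
  have horder : ∀ f : ℝ × ℝ → ℝ, ∀ ω,
      orderX1 S (withHFT s j (fun a b => f (a, b)) G) j ω = f (info ω) := fun f ω => by
    rw [orderX1_withHFT]; rfl
  have hpen : ∀ t : Profile J, (fun ω' => profitX1 S t j ω' + profitX2 S t j ω' -
      penalty S t (fun _ => 0) j ω') = fun ω' => profitX1 S t j ω' + profitX2 S t j ω' :=
    fun t => by funext ω; simp [penalty]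
  let P : (ℝ × ℝ → ℝ) → Ω → ℝ := fun f ω =>
    profitX1 S (withHFT s j (fun a b => f (a, b)) G) j ω +
      profitX2 S (withHFT s j (fun a b => f (a, b)) G) j ω
  have hP : ∀ f ω, P f ω = f (info ω) *
      (σv * (S.standardize p0 σv σ1).comb n.α1 θz j (n.foc1 J θz) ω +
        2 * (σv / σ1 * n.soc1 J) * gs (info ω) + 0) -
      σv / σ1 * n.soc1 J * f (info ω) ^ 2 + ∑ _i : Fin 1, σv * σ1 * Y ω := by
    intro f ω
    have e1 := hM.ownResidual_withHFT (n := n) j (fun a b => f (a, b)) G ω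
    have e2 : orderX2 S (withHFT s j (fun a b => f (a, b)) G) j ω =
        n.β21 * (σ1 * (S.standardize p0 σv σ1).comb n.α1 θz j ownResidual ω) +
        n.β22 * (σ1 * (S.standardize p0 σv σ1).comb n.α1 θz j (n.others J) ω) +
        n.β23 * f (info ω) := by
      have : orderX2 S (withHFT s j (fun a b => f (a, b)) G) j ω =
          n.β21 * (signal S (withHFT s j (fun a b => f (a, b)) G) j ω -
            (n.α1 ^ 2 + θz) / (n.α1 ^ 2 + θz + 1) *
              flow1 S (withHFT s j (fun a b => f (a, b)) G) ω) +
          n.β22 * (flow1p S (withHFT s j (fun a b => f (a, b)) G) ω -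
            orderX1 S (withHFT s j (fun a b => f (a, b)) G) j ω) +
          n.β23 * orderX1 S (withHFT s j (fun a b => f (a, b)) G) j ω := by
        rw [orderX2_withHFT]; rfl
      rw [this, hM.flow1p_withHFT, add_sub_cancel_left, ← e1, horder]
    rw [hM.signal_withHFT, hM.flow1_withHFT] at e1
    simp only [P, profitX1, profitX2]
    rw [hM.v_sub_price1p_withHFT, hM.v_sub_price2_withHFT, e2, horder, Fin.sum_univ_one]
    have e3 : gs (info ω) =
        n.β11 * (σ1 * (S.standardize p0 σv σ1).comb n.α1 θz j ownResidual ω) := by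
      rw [hinfo_eq, hgs_eq, ← e1]
    rw [e3]
    simp only [Y, U]
    generalize f (info ω) = F
    simp only [Shocks.comb, Coeffs.foc1, Coeffs.soc1, Coeffs.error2, Coeffs.error1p,
      ownResidual, Coeffs.others]
    field_simp
    ring
  have key := unique_max_condMean_iff (μ := μ) hmeas
    (integrable_comb (θz := θz) hM.basis n.α1 j (n.foc1 J θz)) σv (σv / σ1 * n.soc1 J) hgs
    (φ := fun _ => 0) measurable_const (n := 1) (fun _ _ => σv * σ1) (Y := fun _ => Y)
    (fun _ => hY) (P := P) hP
  have hpos : 0 < σv / σ1 * n.soc1 J ↔ 0 < n.soc1 J := by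
    rw [mul_pos_iff_of_pos_left (by positivity)]
  rw [hpos] at key
  have hlast : (∀ᵐ ω ∂μ, σv * (μ[(S.standardize p0 σv σ1).comb n.α1 θz j (n.foc1 J θz) |
      MeasurableSpace.comap info inferInstance]) ω + 0 = 0) ↔
      μ[(S.standardize p0 σv σ1).comb n.α1 θz j (n.foc1 J θz) |
          MeasurableSpace.comap info inferInstance] =ᵐ[μ] 0 := by
    refine Filter.eventually_congr (Filter.Eventually.of_forall fun ω => ?_)
    simp [hσv.ne']
  rw [hlast] at key
  rw [← key]
  have hs' : withHFT s j (fun a b => gs (a, b)) G = s := withHFT_self j s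
  have hPgs : (fun ω' => profitX1 S s j ω' + profitX2 S s j ω') = P gs := by
    simp only [P, hs']
  have horder' : ∀ ω, orderX1 S s j ω = gs (info ω) := fun ω => rfl
  unfold HFTFirstOptimal
  simp only [hpen]
  simp only [hPgs, ht]
  constructor
  · intro h g hg
    filter_upwards [h (fun a b => g (a, b)) hg] with ω h hne
    exact h (by rw [horder, horder']; exact hne)
  · intro h g hg
    filter_upwards [h (fun a => g a.1 a.2) hg] with ω h hne
    exact h fun h' => hne ((horder (fun a => g a.1 a.2) ω).trans (h'.trans (horder' ω).symm))

end HFTDecisions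

end StandardModel

/-! ### Optimality of the informed trader's orders -/

namespace StandardModel

variable {Ω : Type*} [mΩ : MeasurableSpace Ω] {J : ℕ} {μ : Measure Ω}
  {S : Shocks Ω J}
  {p0 σv σ1 θz θ1p θ2 θε : ℝ} (hM : StandardModel μ S p0 σv σ1 θz θ1p θ2 θε) {n : Coeffs}
include hM

-- The original shocks are recovered from the residual coordinates by adding back fitted values,
-- using `z = i1 - A v` and `u1 = y1 - i1`. The identities hold for every `A`.
omit hM mΩ in
lemma comb_v (A : ℝ) (j : Fin J) (ω : Ω) : (S.standardize p0 σv σ1).comb A θz j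
    ⟨1, 0, A / (A ^ 2 + θz + 1), 0, 0, 0, 0⟩ ω = (S.standardize p0 σv σ1).v ω := by
  simp only [Shocks.comb]; ring

omit hM mΩ in
lemma comb_z (A : ℝ) (j : Fin J) (ω : Ω) : (S.standardize p0 σv σ1).comb A θz j
    ⟨-A, 1, (A ^ 2 + θz) / (A ^ 2 + θz + 1) - A * (A / (A ^ 2 + θz + 1)), 0, 0, 0, 0⟩ ω =
      (S.standardize p0 σv σ1).z ω := by
  simp only [Shocks.comb]; ring

omit hM mΩ in
lemma comb_u1 (A : ℝ) (j : Fin J) (ω : Ω) : (S.standardize p0 σv σ1).comb A θz j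
    ⟨0, -1, 1 - (A ^ 2 + θz) / (A ^ 2 + θz + 1), 0, 0, 0, 0⟩ ω =
      (S.standardize p0 σv σ1).u1 ω := by
  simp only [Shocks.comb]; ring

/-- The value and the first noise order are linearly independent. -/
lemma eq_zero_of_v_u1 (j : Fin J) {a b : ℝ}
    (h : ∀ᵐ ω ∂μ, a * (S.standardize p0 σv σ1).v ω + b * (S.standardize p0 σv σ1).u1 ω = 0) :
    a = 0 ∧ b = 0 := by
  -- With `A = 0` the value is its own residual, and the second moment of the combination is `a ^ 2
  -- + b ^ 2`.
  have h1 := dot_self_eq_zero_of_comb hM.basis 0 hM.θz_nonneg j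
    (w := ⟨a, -b, b * (1 - (0 ^ 2 + θz) / (0 ^ 2 + θz + 1)), 0, 0, 0, 0⟩) (by
      filter_upwards [h] with ω h
      simp only [Shocks.comb]
      linear_combination h)
  have hQ := hM.Q_pos 0
  simp only [Weights.dot] at h1
  have h2 : a ^ 2 + b ^ 2 = 0 := by
    rw [← h1]
    field_simp
    ring
  constructor <;> nlinarith [sq_nonneg a, sq_nonneg b]

section Second

/-- Optimality of IT's second order after a given first order. -/
lemma it_second_iff_of_first [StandardBorelSpace Ω] [IsProbabilityMeasure μ] (j : Fin J)
    {f : ℝ → ℝ → ℝ} (hf : Measurable fun a : ℝ × ℝ => f a.1 a.2) :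
    (∀ g : ℝ → ℝ → ℝ → ℝ, Measurable (fun a : ℝ × ℝ × ℝ => g a.1 a.2.1 a.2.2) →
      let t := withI1 (affineProfile J p0 σv σ1 θz n) f
      ∀ᵐ ω ∂μ, orderI2 S (withI2 t g) ω ≠ orderI2 S t ω →
        condMean μ (infoI2 S t) (profitI2 S (withI2 t g)) ω <
          condMean μ (infoI2 S t) (profitI2 S t) ω) ↔
      0 < n.lam22 ∧ ∀ᵐ ω ∂μ,
        (1 - 2 * n.lam22 * n.α21) * σ1 * (S.standardize p0 σv σ1).v ω -
        (n.leak J + 2 * n.lam22 * n.α22) * f (S.v ω) (S.z ω) +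
        ((n.leak J + 2 * n.lam22 * n.α22) * ((n.α1 ^ 2 + θz) / (n.α1 ^ 2 + θz + 1)) +
          2 * n.lam22 * n.α21 * (n.α1 / (n.α1 ^ 2 + θz + 1)) - n.lam1) *
          (f (S.v ω) (S.z ω) + σ1 * (S.standardize p0 σv σ1).u1 ω) = 0 := by
  have hσv := hM.σv_pos
  have hσ1 := hM.σ1_pos
  set s := affineProfile J p0 σv σ1 θz n with hs
  set t := withI1 s f with ht
  set info := infoI2 S t with hinfo
  have hinfo_eq : ∀ ω, info ω = (S.v ω, f (S.v ω) (S.z ω),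
      f (S.v ω) (S.z ω) + σ1 * (S.standardize p0 σv σ1).u1 ω) := fun ω => by
    rw [← hM.u1_eq]; rfl
  have hu1 := hM.measurable_u1
  have hv := hM.measurable_v
  have hz := hM.measurable_z
  have hfv : Measurable fun ω => f (S.v ω) (S.z ω) := hf.comp (hv.prodMk hz)
  have hmeas : Measurable info := hv.prodMk (hfv.prodMk (hfv.add hu1))
  let gs : ℝ × ℝ × ℝ → ℝ := fun a => s.i2 a.1 a.2.1 a.2.2
  have hgs : Measurable gs := by simp only [gs, hs, affineProfile]; fun_prop
  have hgs_eq : ∀ a b c, gs (a, b, c) =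
      n.α21 * (σ1 / σv) * (a - (p0 + σv / σ1 * (n.α1 / (n.α1 ^ 2 + θz + 1)) * c)) +
        n.α22 * (b - (n.α1 ^ 2 + θz) / (n.α1 ^ 2 + θz + 1) * c) := fun _ _ _ => rfl
  let φ : ℝ × ℝ × ℝ → ℝ := fun a => (a.1 - p0 - σv / σ1 * n.lam1 * a.2.2 -
    σv / σ1 * n.leak J * (a.2.1 - (n.α1 ^ 2 + θz) / (n.α1 ^ 2 + θz + 1) * a.2.2)) -
    2 * (σv / σ1 * n.lam22) * gs a
  have hφ : Measurable φ := by simp only [φ]; fun_prop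
  let P : (ℝ × ℝ × ℝ → ℝ) → Ω → ℝ := fun g => profitI2 S (withI2 t fun a b c => g (a, b, c))
  have horder : ∀ (g : ℝ × ℝ × ℝ → ℝ) ω,
      orderI2 S (withI2 t fun a b c => g (a, b, c)) ω = g (info ω) := fun _ _ => rfl
  have key := unique_max_condMean_iff (μ := μ) hmeas
    (integrable_comb (θz := θz) hM.basis n.α1 j (n.noise J)) σv (σv / σ1 * n.lam22) hgs hφ
    (n := 0) (fun i => i.elim0) (Y := fun i => i.elim0) (fun i => i.elim0) (P := P)
    (fun g ω => by
      simp only [P, profitI2]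
      rw [ht, hs, hM.v_sub_price2_withI2 j, ← hs, ← ht, horder]
      have e1 : flow1 S (withI2 t fun a b c => g (a, b, c)) ω = (info ω).2.2 := rfl
      have e2 : orderI1 S (withI2 t fun a b c => g (a, b, c)) ω = (info ω).2.1 := rfl
      have e3 : S.v ω = (info ω).1 := rfl
      rw [e1, e2, e3]
      simp only [φ]
      simp
      ring)
  have hpos : 0 < σv / σ1 * n.lam22 ↔ 0 < n.lam22 := by
    rw [mul_pos_iff_of_pos_left (by positivity)]
  rw [hpos] at key
  -- The noise involves only `u1+`, `u2` and the signal noises. It is independent of `(v, z, u1)`,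
  -- which determine the information even when `f` is not linear.
  have hnoise := condExp_comb_eq_zero hM.basis n.α1 hM.θz_nonneg j (a := n.noise J)
    (b := ![⟨1, 0, n.α1 / (n.α1 ^ 2 + θz + 1), 0, 0, 0, 0⟩,
      ⟨-n.α1, 1, (n.α1 ^ 2 + θz) / (n.α1 ^ 2 + θz + 1) - n.α1 * (n.α1 / (n.α1 ^ 2 + θz + 1)),
        0, 0, 0, 0⟩, ⟨0, -1, 1 - (n.α1 ^ 2 + θz) / (n.α1 ^ 2 + θz + 1), 0, 0, 0, 0⟩])
    (info := info)
    (fun x => (p0 + σv * x 0, f (p0 + σv * x 0) (σ1 * x 1),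
      f (p0 + σv * x 0) (σ1 * x 1) + σ1 * x 2))
    (by
      have : Measurable fun x : Fin 3 → ℝ => f (p0 + σv * x 0) (σ1 * x 1) :=
        hf.comp (f := fun x : Fin 3 → ℝ => (p0 + σv * x 0, σ1 * x 1)) (by fun_prop)
      fun_prop)
    (fun ω => by
      rw [hinfo_eq]
      simp only [Matrix.cons_val, comb_v, comb_z, comb_u1, hM.v_eq, hM.z_eq])
    (fun k => by fin_cases k <;> simp [Weights.dot, Coeffs.noise])
  have hlast : (∀ᵐ ω ∂μ, σv * (μ[(S.standardize p0 σv σ1).comb n.α1 θz j (n.noise J) |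
      MeasurableSpace.comap info inferInstance]) ω + φ (info ω) = 0) ↔
      ∀ᵐ ω ∂μ, (1 - 2 * n.lam22 * n.α21) * σ1 * (S.standardize p0 σv σ1).v ω -
        (n.leak J + 2 * n.lam22 * n.α22) * f (S.v ω) (S.z ω) +
        ((n.leak J + 2 * n.lam22 * n.α22) * ((n.α1 ^ 2 + θz) / (n.α1 ^ 2 + θz + 1)) +
          2 * n.lam22 * n.α21 * (n.α1 / (n.α1 ^ 2 + θz + 1)) - n.lam1) *
          (f (S.v ω) (S.z ω) + σ1 * (S.standardize p0 σv σ1).u1 ω) = 0 := by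
    refine Filter.eventually_congr ?_
    filter_upwards [hnoise] with ω h
    rw [h, hinfo_eq]
    simp only [φ, hgs_eq, Pi.zero_apply]
    generalize f (S.v ω) (S.z ω) = F
    rw [hM.v_eq]
    generalize (S.standardize p0 σv σ1).v ω = V
    generalize (S.standardize p0 σv σ1).u1 ω = u
    generalize n.α1 / (n.α1 ^ 2 + θz + 1) = av
    generalize (n.α1 ^ 2 + θz) / (n.α1 ^ 2 + θz + 1) = ai
    have e : σv * 0 + (p0 + σv * V - p0 - σv / σ1 * n.lam1 * (F + σ1 * u) -
        σv / σ1 * n.leak J * (F - ai * (F + σ1 * u)) - 2 * (σv / σ1 * n.lam22) *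
          (n.α21 * (σ1 / σv) * (p0 + σv * V - (p0 + σv / σ1 * av * (F + σ1 * u))) +
            n.α22 * (F - ai * (F + σ1 * u)))) =
        σv / σ1 * ((1 - 2 * n.lam22 * n.α21) * σ1 * V -
          (n.leak J + 2 * n.lam22 * n.α22) * F +
          ((n.leak J + 2 * n.lam22 * n.α22) * ai + 2 * n.lam22 * n.α21 * av - n.lam1) *
            (F + σ1 * u)) := by
      field_simp
      ring
    rw [e, mul_eq_zero, or_iff_right (by positivity)]
  rw [hlast] at key
  rw [← key]
  constructor
  · intro h g hg
    exact h (fun a b c => g (a, b, c)) hg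
  · intro h g hg
    exact h (fun a => g a.1 a.2.1 a.2.2) hg

/-- After the constant first order 0, linear independence of `v` and `u1` annihilates two
coefficients; the constant order 1 then annihilates the reaction to `i1`. What is left of the `u1`
coefficient says that `lam1` is the regression slope, so efficiency of `p1` is already implied. -/
lemma it_second_iff [StandardBorelSpace Ω] [IsProbabilityMeasure μ] (j : Fin J) :
    ITSecondOptimal μ S (affineProfile J p0 σv σ1 θz n) ↔
      0 < n.lam22 ∧ 2 * n.lam22 * n.α21 = 1 ∧ n.leak J + 2 * n.lam22 * n.α22 = 0 ∧
        n.lam1 = n.α1 / (n.α1 ^ 2 + θz + 1) := by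
  have hσ1 := hM.σ1_pos
  have hall : ITSecondOptimal μ S (affineProfile J p0 σv σ1 θz n) ↔ _ :=
    forall₂_congr fun f hf => hM.it_second_iff_of_first j hf
  rw [hall]
  constructor
  · intro h
    obtain ⟨hK, h0⟩ := h (fun _ _ => 0) measurable_const
    obtain ⟨-, h1⟩ := h (fun _ _ => 1) measurable_const
    obtain ⟨e1, e2⟩ := hM.eq_zero_of_v_u1 j (a := (1 - 2 * n.lam22 * n.α21) * σ1)
      (b := ((n.leak J + 2 * n.lam22 * n.α22) * ((n.α1 ^ 2 + θz) / (n.α1 ^ 2 + θz + 1)) +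
        2 * n.lam22 * n.α21 * (n.α1 / (n.α1 ^ 2 + θz + 1)) - n.lam1) * σ1) (by
      filter_upwards [h0] with ω h0
      rw [← h0]
      ring)
    have e1 : 1 - 2 * n.lam22 * n.α21 = 0 := (mul_eq_zero_iff_right hσ1.ne').1 e1
    have e2 := (mul_eq_zero_iff_right hσ1.ne').1 e2
    obtain ⟨ω, h1⟩ := h1.exists
    rw [e1, e2] at h1
    have e3 : n.leak J + 2 * n.lam22 * n.α22 = 0 := by linarith
    rw [e3, show 2 * n.lam22 * n.α21 = 1 by linarith] at e2
    exact ⟨hK, by linarith, e3, by linarith⟩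
  · rintro ⟨hK, e1, e2, e3⟩ f -
    refine ⟨hK, Filter.Eventually.of_forall fun ω => ?_⟩
    rw [e1, e2, e3]
    ring

end Second

section First

variable [StandardBorelSpace Ω] [IsProbabilityMeasure μ]

/-- IT's conditional expected total profit from a pure first order, if her second order is
optimal. -/
lemma condMean_it_first (j : Fin J) (h1 : 2 * n.lam22 * n.α21 = 1)
    (h2 : n.leak J + 2 * n.lam22 * n.α22 = 0) (h3 : n.lam1 = n.α1 / (n.α1 ^ 2 + θz + 1)) :
    ∃ C : Ω → ℝ, ∀ f : ℝ → ℝ,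
      condMean μ S.v (fun ω =>
          profitI1 S (withI1 (affineProfile J p0 σv σ1 θz n) fun v _ => f v) ω +
          profitI2 S (withI1 (affineProfile J p0 σv σ1 θz n) fun v _ => f v) ω) =ᵐ[μ]
        fun ω => f (S.v ω) * ((1 + n.carry θz) * (S.v ω - p0)) -
          σv / σ1 * (n.lam1 - n.lam22 * n.carry θz ^ 2) * f (S.v ω) ^ 2 + C ω := by
  have hσv := hM.σv_pos
  have hσ1 := hM.σ1_pos
  set N := S.standardize p0 σv σ1 with hN
  set q := n.carry θz with hq
  set q' := n.carryNoise θz with hq'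
  -- `k` is the total coefficient of `u1` in the terms proportional to the first order; together
  -- with the unpredictable noise it forms `w`, whose mean given `v` is zero.
  let k := -n.lam1 + 2 * n.lam22 * q * q'
  let w : Weights := ⟨0, -k, k * (1 - (n.α1 ^ 2 + θz) / (n.α1 ^ 2 + θz + 1)),
    q * (n.noise J).p, q * (n.noise J).q, q * (n.noise J).o, q * (n.noise J).e⟩
  have hw : ∀ ω, N.comb n.α1 θz j w ω = k * N.u1 ω + q * N.comb n.α1 θz j (n.noise J) ω :=
    fun ω => by
      simp only [Shocks.comb, w, Coeffs.noise]
      ring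
  let a : Weights := ⟨n.α21, -q', n.α21 * (n.α1 / (n.α1 ^ 2 + θz + 1)) +
    q' * (1 - (n.α1 ^ 2 + θz) / (n.α1 ^ 2 + θz + 1)), 0, 0, 0, 0⟩
  have ha : ∀ ω, N.comb n.α1 θz j a ω = n.α21 * N.v ω + q' * N.u1 ω := fun ω => by
    simp only [Shocks.comb, a]
    ring
  let Y : Ω → ℝ := fun ω => N.comb n.α1 θz j a ω *
    (N.comb n.α1 θz j (n.noise J) ω + n.lam22 * N.comb n.α1 θz j a ω)
  have hY : Integrable Y μ := (memLp_comb hM.basis _ _ _).integrable_mul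
    ((memLp_comb hM.basis _ _ _).add ((memLp_comb hM.basis _ _ _).const_mul _))
  have hzero : μ[N.comb n.α1 θz j w | MeasurableSpace.comap S.v inferInstance] =ᵐ[μ] 0 := by
    refine condExp_comb_eq_zero hM.basis n.α1 hM.θz_nonneg j
      (b := fun _ : Fin 1 => ⟨1, 0, n.α1 / (n.α1 ^ 2 + θz + 1), 0, 0, 0, 0⟩)
      (fun x => p0 + σv * x 0) (by fun_prop) (hM.v_eq_comb n.α1 j) fun _ => ?_
    have hQ := hM.Q_pos n.α1
    simp only [Weights.dot, w]
    field_simp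
    ring
  -- The terms without `f` form one and the same `C` for every first order, so they play no part in
  -- comparisons.
  refine ⟨fun ω => ∑ _i : Fin 1, σv * σ1 * (μ[Y | MeasurableSpace.comap S.v inferInstance]) ω,
    fun f => ?_⟩
  have hcm := condMean_quadratic (μ := μ) (info := S.v) hM.measurable_v
    (integrable_comb (θz := θz) hM.basis n.α1 j w) σv
    (σv / σ1 * (n.lam1 - n.lam22 * q ^ 2)) (fun _ => 0) (fun v => (1 + q) * (v - p0))
    (n := 1) (fun _ _ => σv * σ1) (Y := fun _ => Y) (fun _ => hY) f
    (P := fun ω => profitI1 S (withI1 (affineProfile J p0 σv σ1 θz n) fun v _ => f v) ω +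
          profitI2 S (withI1 (affineProfile J p0 σv σ1 θz n) fun v _ => f v) ω) (fun ω => by
      set t := withI1 (affineProfile J p0 σv σ1 θz n) fun v _ => f v with ht
      have e0 : S.v ω - price2 S t ω = _ := hM.v_sub_price2_withI2 (n := n) j (fun v _ => f v)
        (affineProfile J p0 σv σ1 θz n).i2 ω
      have e1 : orderI1 S t ω = f (S.v ω) := rfl
      have e2 : flow1 S t ω = f (S.v ω) + σ1 * N.u1 ω := by rw [← hM.u1_eq]; rfl
      have e3 : orderI2 S t ω = σ1 * N.comb n.α1 θz j a ω + q * f (S.v ω) := by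
        have : orderI2 S t ω =
          n.α21 * (σ1 / σv) * (S.v ω - (p0 + σv / σ1 * (n.α1 / (n.α1 ^ 2 + θz + 1)) *
            flow1 S t ω)) +
          n.α22 * (orderI1 S t ω - (n.α1 ^ 2 + θz) / (n.α1 ^ 2 + θz + 1) * flow1 S t ω) := rfl
        rw [this, e1, e2, ha, hM.v_eq, hq, hq']
        simp only [Coeffs.carry, Coeffs.carryNoise]
        generalize n.α1 / (n.α1 ^ 2 + θz + 1) = av
        generalize (n.α1 ^ 2 + θz) / (n.α1 ^ 2 + θz + 1) = ai
        field_simp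
        ring
      -- At the optimum the predictable gap before her own impact is twice that impact, so exactly
      -- one impact remains. The second-stage profit thus becomes noise times the order plus a
      -- multiple of the squared order.
      have e4 : S.v ω - price2 S t ω = σv * N.comb n.α1 θz j (n.noise J) ω +
          σv / σ1 * n.lam22 * orderI2 S t ω := by
        have hi : orderI2 S (withI2 (withI1 (affineProfile J p0 σv σ1 θz n) fun v _ => f v)
          (affineProfile J p0 σv σ1 θz n).i2) ω =
          n.α21 * (σ1 / σv) * (S.v ω - (p0 + σv / σ1 * (n.α1 / (n.α1 ^ 2 + θz + 1)) *
            flow1 S t ω)) +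
          n.α22 * (orderI1 S t ω - (n.α1 ^ 2 + θz) / (n.α1 ^ 2 + θz + 1) * flow1 S t ω) := rfl
        have hi' : orderI2 S t ω =
          n.α21 * (σ1 / σv) * (S.v ω - (p0 + σv / σ1 * (n.α1 / (n.α1 ^ 2 + θz + 1)) *
            flow1 S t ω)) +
          n.α22 * (orderI1 S t ω - (n.α1 ^ 2 + θz) / (n.α1 ^ 2 + θz + 1) * flow1 S t ω) := rfl
        have hy : flow1 S (withI2 (withI1 (affineProfile J p0 σv σ1 θz n) fun v _ => f v)
          (affineProfile J p0 σv σ1 θz n).i2) ω = flow1 S t ω := rfl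
        have ho : orderI1 S (withI2 (withI1 (affineProfile J p0 σv σ1 θz n) fun v _ => f v)
          (affineProfile J p0 σv σ1 θz n).i2) ω = orderI1 S t ω := rfl
        rw [e0, hi, hy, ho, hi', h3, show n.leak J = -(2 * n.lam22 * n.α22) by linarith]
        generalize n.α1 / (n.α1 ^ 2 + θz + 1) = av
        generalize (n.α1 ^ 2 + θz) / (n.α1 ^ 2 + θz + 1) = ai
        field_simp
        linear_combination (-(S.v ω - p0) * σ1 + σv * av * flow1 S t ω) * h1
      have e5 : price1 S t ω = p0 + n.lam1 * (σv / σ1) * flow1 S t ω := rfl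
      rw [profitI1, profitI2, e4, e5, e3, e2, e1, hw, Fin.sum_univ_one]
      simp only [Y]
      generalize N.comb n.α1 θz j (n.noise J) ω = z
      rw [ha, hM.v_eq]
      generalize f _ = F
      simp only [k]
      field_simp
      linear_combination (σ1 * F * N.v ω * σv * q) * h1)
  filter_upwards [hcm, hzero] with ω h hz
  rw [h, hz]
  simp only [Pi.zero_apply]
  ring

/-- A quadratic in the order is constant exactly when its linear and quadratic coefficients both
vanish; constant first orders are enough to detect this. -/
lemma it_first_indifferent_iff (j : Fin J) (h1 : 2 * n.lam22 * n.α21 = 1)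
    (h2 : n.leak J + 2 * n.lam22 * n.α22 = 0) (h3 : n.lam1 = n.α1 / (n.α1 ^ 2 + θz + 1)) :
    ITFirstIndifferent μ S (affineProfile J p0 σv σ1 θz n) ↔
      1 + n.carry θz = 0 ∧ n.lam1 = n.lam22 * n.carry θz ^ 2 := by
  have hσv := hM.σv_pos
  have hσ1 := hM.σ1_pos
  obtain ⟨C, hC⟩ := hM.condMean_it_first j h1 h2 h3
  constructor
  · intro h
    -- Each constant order `c` is compared with 0; the values `c = 1` and `c = -1` separate the
    -- linear from the quadratic coefficient.
    have hcd : ∀ c : ℝ, ∀ᵐ ω ∂μ, c * ((1 + n.carry θz) * (S.v ω - p0)) -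
        σv / σ1 * (n.lam1 - n.lam22 * n.carry θz ^ 2) * c ^ 2 = 0 := fun c => by
      filter_upwards [h (fun _ => c) (fun _ => 0) measurable_const measurable_const,
        hC fun _ => c, hC fun _ => 0] with ω e1 e2 e3
      rw [e2, e3] at e1
      linarith
    have e1 := (hM.eq_zero_of_v_u1 j (a := 1 + n.carry θz) (b := 0) (by
      filter_upwards [hcd 1, hcd (-1)] with ω e1 e2
      rw [hM.v_eq] at e1 e2
      have : σv * ((1 + n.carry θz) * (S.standardize p0 σv σ1).v ω) = 0 := by linarith
      simpa [hσv.ne'] using this)).1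
    refine ⟨e1, ?_⟩
    obtain ⟨ω, e2⟩ := (hcd 1).exists
    rw [e1] at e2
    have e3 : σv / σ1 * (n.lam1 - n.lam22 * n.carry θz ^ 2) = 0 := by linarith
    rw [mul_eq_zero, or_iff_right (by positivity)] at e3
    linarith
  · rintro ⟨e1, e2⟩ f g - -
    filter_upwards [hC f, hC g] with ω hf hg
    rw [hf, hg, e1, e2]
    ring

/-- Without randomisation the prescribed order is almost surely `α1 (σ1 / σv) (v - p0)`, and
matching it with the vertex of the quadratic in `condMean_it_first` gives the equation. -/
lemma it_first_optimal_iff (j : Fin J) (hz : θz = 0) (h1 : 2 * n.lam22 * n.α21 = 1)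
    (h2 : n.leak J + 2 * n.lam22 * n.α22 = 0) (h3 : n.lam1 = n.α1 / (n.α1 ^ 2 + θz + 1)) :
    ITFirstOptimal μ S (affineProfile J p0 σv σ1 θz n) ↔
      0 < n.lam1 - n.lam22 * n.carry θz ^ 2 ∧
        1 + n.carry θz = 2 * (n.lam1 - n.lam22 * n.carry θz ^ 2) * n.α1 := by
  have hσv := hM.σv_pos
  have hσ1 := hM.σ1_pos
  obtain ⟨C, hC⟩ := hM.condMean_it_first j h1 h2 h3
  set s := affineProfile J p0 σv σ1 θz n with hs
  -- The standardised `z` has variance zero, hence its law is the point mass at 0.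
  have hz0 : ∀ᵐ ω ∂μ, S.z ω = 0 := by
    have hd := map_comb hM.basis 0 hM.θz_nonneg j
      ⟨-0, 1, (0 ^ 2 + θz) / (0 ^ 2 + θz + 1) - 0 * (0 / (0 ^ 2 + θz + 1)), 0, 0, 0, 0⟩
    rw [show (S.standardize p0 σv σ1).comb 0 θz j _ = (S.standardize p0 σv σ1).z from
      funext (comb_z 0 j)] at hd
    have : Weights.dot J θz θ1p θ2 θε 0
      ⟨-0, 1, (0 ^ 2 + θz) / (0 ^ 2 + θz + 1) - 0 * (0 / (0 ^ 2 + θz + 1)), 0, 0, 0, 0⟩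
      ⟨-0, 1, (0 ^ 2 + θz) / (0 ^ 2 + θz + 1) - 0 * (0 / (0 ^ 2 + θz + 1)), 0, 0, 0, 0⟩ = 0 := by
      simp [Weights.dot, hz]
    rw [this, Real.toNNReal_zero, gaussianReal_zero_var] at hd
    have h0 : ∀ᵐ x ∂(μ.map (S.standardize p0 σv σ1).z), x = 0 := by
      rw [hd, ae_dirac_eq]
      rfl
    have hmz : Measurable (S.standardize p0 σv σ1).z := hM.basis.meas (Sum.inl 1)
    replace h0 := ae_of_ae_map hmz.aemeasurable h0
    filter_upwards [h0] with ω h0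
    rw [hM.z_eq, h0, mul_zero]
  let gs : ℝ → ℝ := fun v => n.α1 * (σ1 / σv) * (v - p0)
  have hgs : Measurable gs := by simp only [gs]; fun_prop
  have horder : ∀ᵐ ω ∂μ, orderI1 S s ω = gs (S.v ω) := by
    filter_upwards [hz0] with ω h
    have : orderI1 S s ω = gs (S.v ω) + S.z ω := rfl
    rw [this, h, add_zero]
  -- The profile still refers to `z`; its payoff agrees almost surely with that of the pure rule
  -- `gs`, to which the quadratic formula applies.
  have hcs : condMean μ S.v (fun ω => profitI1 S s ω + profitI2 S s ω) =ᵐ[μ]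
      condMean μ S.v (fun ω => profitI1 S (withI1 s fun v _ => gs v) ω +
        profitI2 S (withI1 s fun v _ => gs v) ω) := by
    refine condMean_congr_ae μ hM.measurable_v ?_
    filter_upwards [horder] with ω h
    have h' : orderI1 S s ω = orderI1 S (withI1 s fun v _ => gs v) ω := h
    simp only [profitI1, profitI2, price1, price2, orderI2, flow2, orderX2, flow1p, orderX1,
      signal, flow1, h']
    rfl
  have key := quadratic_unique_max_iff (μ := μ) (info := S.v)
    (α := fun v => (1 + n.carry θz) * (v - p0)) (gs := gs) (by fun_prop) hgs
    (σv / σ1 * (n.lam1 - n.lam22 * n.carry θz ^ 2))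
  have hpos : 0 < σv / σ1 * (n.lam1 - n.lam22 * n.carry θz ^ 2) ↔
      0 < n.lam1 - n.lam22 * n.carry θz ^ 2 := by
    rw [mul_pos_iff_of_pos_left (by positivity)]
  rw [hpos] at key
  have hlast : (∀ᵐ ω ∂μ, (1 + n.carry θz) * (S.v ω - p0) =
      2 * (σv / σ1 * (n.lam1 - n.lam22 * n.carry θz ^ 2)) * gs (S.v ω)) ↔
      1 + n.carry θz = 2 * (n.lam1 - n.lam22 * n.carry θz ^ 2) * n.α1 := by
    constructor
    · intro h
      have := (hM.eq_zero_of_v_u1 j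
        (a := σv * (1 + n.carry θz - 2 * (n.lam1 - n.lam22 * n.carry θz ^ 2) * n.α1))
        (b := 0) (by
          filter_upwards [h] with ω h
          simp only [gs, hM.v_eq] at h
          field_simp at h
          linear_combination h)).1
      rw [mul_eq_zero, or_iff_right hσv.ne'] at this
      linarith
    · intro h
      refine Filter.Eventually.of_forall fun ω => ?_
      simp only [gs, h]
      field_simp
  rw [hlast] at key
  rw [← key]
  constructor
  · rintro ⟨-, h⟩ g hg
    filter_upwards [h g hg, hC g, hC gs, hcs, horder] with ω h e1 e2 e3 e4 hne
    have h := h (by rw [e4]; exact hne)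
    rw [e1, e3, e2] at h
    linarith
  · intro h
    refine ⟨⟨gs, hgs, horder⟩, fun g hg => ?_⟩
    filter_upwards [h g hg, hC g, hC gs, hcs, horder] with ω h e1 e2 e3 e4 hne
    rw [e4] at hne
    have h := h hne
    rw [e1, e3, e2]
    linarith

end First

end StandardModel

/-! ### Gram determinants and Cramer's rule -/

section DotProduct

variable {J θz θ1p θ2 θε A : ℝ}

lemma Weights.dot_self_nonneg (hJ : 1 ≤ J) (hz : 0 ≤ θz) (h1 : 0 ≤ θ1p) (h2 : 0 ≤ θ2)
    (hε : 0 ≤ θε) (w : Weights) : 0 ≤ w.dot J θz θ1p θ2 θε A w := by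
  have hQ : 0 < A ^ 2 + θz + 1 := by positivity
  have hJ' : 0 ≤ J - 1 := by linarith
  have e : w.dot J θz θ1p θ2 θε A w =
      (w.n ^ 2 * θz + w.i ^ 2 * θz + (w.n + w.i * A) ^ 2) / (A ^ 2 + θz + 1) +
      w.y ^ 2 * (A ^ 2 + θz + 1) + w.p ^ 2 * θ1p + w.q ^ 2 * θ2 + w.o ^ 2 * ((J - 1) * θε) +
      w.e ^ 2 * θε := by
    simp only [Weights.dot]
    field_simp
    ring
  rw [e]
  positivity

/-- The form is nonnegative at `a y - b x` with `a = x·x` and `b = x·y`; dividing by `a > 0` gives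
the inequality. -/
lemma Weights.cauchy_schwarz (hJ : 1 ≤ J) (hz : 0 ≤ θz) (h1 : 0 ≤ θ1p) (h2 : 0 ≤ θ2)
    (hε : 0 ≤ θε) {x : Weights} (hx : 0 < x.dot J θz θ1p θ2 θε A x) (y : Weights) :
    x.dot J θz θ1p θ2 θε A y ^ 2 ≤
      x.dot J θz θ1p θ2 θε A x * y.dot J θz θ1p θ2 θε A y := by
  set a := x.dot J θz θ1p θ2 θε A x with ha
  set b := x.dot J θz θ1p θ2 θε A y with hb
  have h := dot_self_nonneg (A := A) hJ hz h1 h2 hε ⟨a * y.n - b * x.n, a * y.i - b * x.i,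
    a * y.y - b * x.y, a * y.p - b * x.p, a * y.q - b * x.q, a * y.o - b * x.o,
    a * y.e - b * x.e⟩
  have e : Weights.dot J θz θ1p θ2 θε A ⟨a * y.n - b * x.n, a * y.i - b * x.i,
      a * y.y - b * x.y, a * y.p - b * x.p, a * y.q - b * x.q, a * y.o - b * x.o,
      a * y.e - b * x.e⟩ ⟨a * y.n - b * x.n, a * y.i - b * x.i,
      a * y.y - b * x.y, a * y.p - b * x.p, a * y.q - b * x.q, a * y.o - b * x.o,
      a * y.e - b * x.e⟩ = a ^ 2 * y.dot J θz θ1p θ2 θε A y -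
        2 * a * b * x.dot J θz θ1p θ2 θε A y + b ^ 2 * x.dot J θz θ1p θ2 θε A x := by
    simp only [Weights.dot]
    ring
  rw [e, ← ha, ← hb] at h
  have h' : 0 ≤ a * (a * y.dot J θz θ1p θ2 θε A y - b ^ 2) := by linarith
  have := nonneg_of_mul_nonneg_right h' hx
  linarith

/-- The Gram determinant is positive if the second vector has a component that the first lacks. -/
lemma Weights.gram_pos (hJ : 1 ≤ J) (hz : 0 ≤ θz) (h1 : 0 < θ1p) (h2 : 0 < θ2)
    (hε : 0 ≤ θε) {x y : Weights} (hx : 0 < x.dot J θz θ1p θ2 θε A x)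
    (h : x.p = 0 ∧ y.p = 1 ∨ x.q = 0 ∧ y.q = 1) :
    x.dot J θz θ1p θ2 θε A y ^ 2 <
      x.dot J θz θ1p θ2 θε A x * y.dot J θz θ1p θ2 θε A y := by
  obtain ⟨hp, hp'⟩ | ⟨hq, hq'⟩ := h
  -- Deleting from `y` the component absent from `x` leaves `x·y` unchanged but lowers `y·y` by a
  -- positive variance, which makes Cauchy–Schwarz strict.
  · have hc := cauchy_schwarz hJ hz h1.le h2.le hε hx { y with p := 0 }
    have e1 : x.dot J θz θ1p θ2 θε A { y with p := 0 } = x.dot J θz θ1p θ2 θε A y := by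
      simp [Weights.dot, hp]
    have e2 : Weights.dot J θz θ1p θ2 θε A { y with p := 0 } { y with p := 0 } =
        y.dot J θz θ1p θ2 θε A y - θ1p := by
      simp only [Weights.dot, hp']; ring
    rw [e1, e2] at hc
    nlinarith [mul_pos hx h1]
  · have hc := cauchy_schwarz hJ hz h1.le h2.le hε hx { y with q := 0 }
    have e1 : x.dot J θz θ1p θ2 θε A { y with q := 0 } = x.dot J θz θ1p θ2 θε A y := by
      simp [Weights.dot, hq]
    have e2 : Weights.dot J θz θ1p θ2 θε A { y with q := 0 } { y with q := 0 } =
        y.dot J θz θ1p θ2 θε A y - θ2 := by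
      simp only [Weights.dot, hq']; ring
    rw [e1, e2] at hc
    nlinarith [mul_pos hx h2]

/-- Cramer's rule for a homogeneous pair of equations. -/
lemma pair_eq_zero_iff {a b c x y : ℝ} (h : b ^ 2 < a * c) :
    x = 0 ∧ y = 0 ↔ x * c - y * b = 0 ∧ y * a - x * b = 0 := by
  refine ⟨by rintro ⟨rfl, rfl⟩; simp, fun ⟨e1, e2⟩ => ?_⟩
  have h' : a * c - b ^ 2 ≠ 0 := by linarith
  constructor <;> refine (mul_eq_zero.1 ?_).resolve_left h'
  · linear_combination a * e1 + b * e2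
  · linear_combination c * e2 + b * e1

end DotProduct

/-! ### Reduction to a finite system of conditions -/

/-- The equilibrium conditions that do not involve IT's first order. -/
structure Coeffs.CommonConditions (n : Coeffs) (J θz θ1p θ2 θε : ℝ) : Prop where
  lam22_pos : 0 < n.lam22
  it_second : 2 * n.lam22 * n.α21 = 1
  it_leak : n.leak J + 2 * n.lam22 * n.α22 = 0
  lam1 : n.lam1 = n.α1 / (n.α1 ^ 2 + θz + 1)
  impact : n.impact J + 2 * n.lam22 * n.β23 = 0
  price1p : (n.pathError1p J θz).dot J θz θ1p θ2 θε n.α1 (n.flow1pWeights J) = 0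
  price2 : (n.pathError2 J θz).dot J θz θ1p θ2 θε n.α1 (n.flow1pWeights J) = 0 ∧
    (n.pathError2 J θz).dot J θz θ1p θ2 θε n.α1 (n.flow2Weights J) = 0
  hft_second : (n.foc2 J θz).dot J θz θ1p θ2 θε n.α1 ownResidual = 0 ∧
    (n.foc2 J θz).dot J θz θ1p θ2 θε n.α1 (n.others J) = 0
  soc1_pos : 0 < n.soc1 J
  hft_first : (n.foc1 J θz).dot J θz θ1p θ2 θε n.α1 ownResidual = 0

/-- Once `lam1` is the regression slope, every error has weight zero on `y1`. Covariances with `y1`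
then vanish, and the own signal can be replaced by its residual. The conditions are the same for
every HFT, so one index suffices in one direction and symmetry gives the other. -/
lemma StandardModel.isCommonEquilibrium_iff {Ω : Type*} [MeasurableSpace Ω]
    [StandardBorelSpace Ω] {J : ℕ} {μ : Measure Ω} [IsProbabilityMeasure μ] {S : Shocks Ω J}
    {p0 σv σ1 θz θ1p θ2 θε : ℝ} (hM : StandardModel μ S p0 σv σ1 θz θ1p θ2 θε) {n : Coeffs}
    (hJ : 0 < J) :
    IsCommonEquilibrium μ S (fun _ => 0) (affineProfile J p0 σv σ1 θz n) ↔
      n.CommonConditions J θz θ1p θ2 θε := by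
  have y0 (h : n.lam1 = n.α1 / (n.α1 ^ 2 + θz + 1)) {w : Weights} (hw : w.y = 0) :
      w.dot J θz θ1p θ2 θε n.α1 firstFlow = 0 ∧
      w.dot J θz θ1p θ2 θε n.α1 (ownSignal n.α1 θz) =
        w.dot J θz θ1p θ2 θε n.α1 ownResidual := by
    simp [Weights.dot, firstFlow, ownSignal, ownResidual, hw]
  constructor
  · rintro ⟨-, hd, hi, h2, h1⟩
    obtain ⟨e1, e2, e3, e4⟩ := (hM.it_second_iff ⟨0, hJ⟩).1 hi
    obtain ⟨-, ⟨-, d1⟩, -, d2, d3⟩ := (hM.dealers_iff ⟨0, hJ⟩).1 hd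
    obtain ⟨-, s1, s2, -, s3⟩ := (hM.hft_second_iff ⟨0, hJ⟩).1 (h2 _)
    obtain ⟨f1, f2, -⟩ := (hM.hft_first_iff ⟨0, hJ⟩).1 (h1 _)
    rw [(y0 e4 (w := n.foc2 J θz) (by simp [Coeffs.foc2, e4])).2] at s2
    rw [(y0 e4 (w := n.foc1 J θz) (by simp [Coeffs.foc1, e4])).2] at f2
    exact ⟨e1, e2, e3, e4, s1, d1, ⟨d2, d3⟩, ⟨s2, s3⟩, f1, f2⟩
  · rintro ⟨e1, e2, e3, e4, s1, d1, ⟨d2, d3⟩, ⟨s2, s3⟩, f1, f2⟩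
    have y2 := y0 e4 (w := n.foc2 J θz) (by simp [Coeffs.foc2, e4])
    have y1 := y0 e4 (w := n.foc1 J θz) (by simp [Coeffs.foc1, e4])
    refine ⟨measurable_affineProfile .., (hM.dealers_iff ⟨0, hJ⟩).2
      ⟨(y0 e4 (by simp [Coeffs.error1, e4])).1, ⟨(y0 e4 (by simp [Coeffs.pathError1p, e4])).1, d1⟩,
        (y0 e4 (by simp [Coeffs.pathError2, e4])).1, d2, d3⟩,
      (hM.it_second_iff ⟨0, hJ⟩).2 ⟨e1, e2, e3, e4⟩,
      fun j => (hM.hft_second_iff j).2 ⟨e1, s1, y2.2.trans s2, y2.1, s3⟩,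
      fun j => (hM.hft_first_iff j).2 ⟨f1, y1.2.trans f2, y1.1⟩⟩

namespace Coeffs

variable {J θz θ1p θ2 θε : ℝ} {n : Coeffs}

/-- The informed trader's optimal second order closes half of the gap she can predict, which
accounts for the weights `1 / 2` and `-leak / 2`. -/
lemma pathError2_eq (hJ : J ≠ 0) (h1 : 2 * n.lam22 * n.α21 = 1)
    (h2 : n.leak J + 2 * n.lam22 * n.α22 = 0) (h3 : n.lam1 = n.α1 / (n.α1 ^ 2 + θz + 1)) :
    n.pathError2 J θz = ⟨1 / 2, -n.leak J / 2, 0, -n.lam21 - n.lam22 * (J * n.β22), -n.lam22,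
      -n.leak J / J, -n.leak J / J⟩ := by
  have e : n.lam21 * n.β11 + n.lam22 * (n.slope + J * n.β22 * n.β11) = n.leak J / J := by
    rw [eq_div_iff hJ]
    simp only [leak, slope]
    ring
  simp only [pathError2, h3, Weights.mk.injEq]
  refine ⟨by linarith, ?_, by ring, trivial, trivial, by rw [neg_div, ← e]; ring,
    by rw [neg_div, ← e]; ring⟩
  simp only [leak, slope] at h2 ⊢
  linear_combination -h2 / 2

/-- The sensitivity of the HFTs' total second order to their residual signals. -/
def total (n : Coeffs) (J : ℝ) : ℝ := n.β21 + n.β23 * n.β11 + (J - 1) * n.β22 * n.β11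

lemma leak_eq (n : Coeffs) (J : ℝ) :
    n.leak J = n.lam21 * J * n.β11 + n.lam22 * J * n.total J := rfl

lemma flow2Weights_eq (n : Coeffs) (J : ℝ) :
    n.flow2Weights J = ⟨n.α21, n.α22 + J * n.total J, 0, J * n.β22, 1, n.total J, n.total J⟩ := by
  simp only [flow2Weights, total, slope, Weights.mk.injEq]
  refine ⟨trivial, by ring, trivial, trivial, trivial, by ring, by ring⟩

/-- `lam1p` is the regression coefficient of the value residual on `y1+`: covariance over variance,
both multiplied by `α1 ^ 2 + θz + 1`. -/
lemma price1p_iff (hJ : 1 ≤ J) (hz : 0 ≤ θz) (h1 : 0 < θ1p) (hε : 0 ≤ θε) :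
    (n.pathError1p J θz).dot J θz θ1p θ2 θε n.α1 (n.flow1pWeights J) = 0 ↔
      n.lam1p = n.α1 * n.β11 * J / (n.β11 ^ 2 * J * (θε * (n.α1 ^ 2 + θz + 1) +
        J * (n.α1 ^ 2 + θz)) + θ1p * (n.α1 ^ 2 + θz + 1)) := by
  have hQ : 0 < n.α1 ^ 2 + θz + 1 := by positivity
  have hJ0 : 0 ≤ J := by linarith
  have hW : 0 < n.β11 ^ 2 * J * (θε * (n.α1 ^ 2 + θz + 1) +
        J * (n.α1 ^ 2 + θz)) + θ1p * (n.α1 ^ 2 + θz + 1) := by positivity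
  rw [eq_div_iff hW.ne', ← sub_eq_zero (b := n.α1 * n.β11 * J)]
  have e : n.lam1p * (n.β11 ^ 2 * J * (θε * (n.α1 ^ 2 + θz + 1) +
        J * (n.α1 ^ 2 + θz)) + θ1p * (n.α1 ^ 2 + θz + 1)) - n.α1 * n.β11 * J =
      -(n.α1 ^ 2 + θz + 1) *
        (n.pathError1p J θz).dot J θz θ1p θ2 θε n.α1 (n.flow1pWeights J) := by
    simp only [Weights.dot, pathError1p, flow1pWeights]
    field_simp
    ring
  rw [e, mul_eq_zero, or_iff_right (by linarith)]

lemma soc1_eq (h : n.impact J + 2 * n.lam22 * n.β23 = 0) :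
    n.soc1 J = n.lam1p - n.lam22 * n.β23 ^ 2 := by
  simp only [soc1]
  linear_combination n.β23 * h

/-- The first-order condition of an HFT's first order, given that of her second order. -/
lemma hft_first_iff (hz : 0 ≤ θz)
    (h4 : n.impact J + 2 * n.lam22 * n.β23 = 0)
    (h5 : (n.foc2 J θz).dot J θz θ1p θ2 θε n.α1 ownResidual = 0) :
    (n.foc1 J θz).dot J θz θ1p θ2 θε n.α1 ownResidual = 0 ↔
      2 * (n.lam1p - n.lam22 * n.β23 ^ 2) * (n.α1 ^ 2 + θz + θε * (n.α1 ^ 2 + θz + 1)) * n.β11 =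
        n.α1 - (n.lam1p - 2 * n.lam22 * n.β22 * n.β23) * n.β11 * (J - 1) * (n.α1 ^ 2 + θz) +
        2 * n.lam22 * n.β23 * n.β21 * (n.α1 ^ 2 + θz + θε * (n.α1 ^ 2 + θz + 1)) := by
  have hQ : 0 < n.α1 ^ 2 + θz + 1 := by positivity
  -- By the envelope principle, subtracting `β23` times the second-stage condition removes the
  -- effect of the induced change in the second order.
  have e : n.α1 - (n.lam1p - 2 * n.lam22 * n.β22 * n.β23) * n.β11 * (J - 1) * (n.α1 ^ 2 + θz) +
        2 * n.lam22 * n.β23 * n.β21 * (n.α1 ^ 2 + θz + θε * (n.α1 ^ 2 + θz + 1)) -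
      2 * (n.lam1p - n.lam22 * n.β23 ^ 2) * (n.α1 ^ 2 + θz + θε * (n.α1 ^ 2 + θz + 1)) * n.β11 =
      (n.α1 ^ 2 + θz + 1) * ((n.foc1 J θz).dot J θz θ1p θ2 θε n.α1 ownResidual -
        n.β23 * (n.foc2 J θz).dot J θz θ1p θ2 θε n.α1 ownResidual) := by
    have h4' : n.impact J = -2 * n.lam22 * n.β23 := by linarith
    simp only [Weights.dot, foc1, foc2, soc1, error2, ownResidual, h4']
    field_simp
    ring
  rw [h5, mul_zero, sub_zero] at e
  constructor
  · intro h
    rw [h] at e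
    linarith
  · intro h
    rw [h, sub_self] at e
    exact (mul_eq_zero.1 e.symm).resolve_left hQ.ne'

end Coeffs

/-! ### The polynomials as Cramer numerators -/

namespace Coeffs

variable {J θz θ1p θ2 θε : ℝ} {n : Coeffs}

/-- The Gram matrix of the two later flows is nonsingular: `y1+` has positive variance because of
`u1+`, and `y2` contains `u2`, which `y1+` lacks. -/
lemma price2_iff (hJ : 1 ≤ J) (hz : 0 ≤ θz) (h1 : 0 < θ1p) (h2 : 0 < θ2) (hε : 0 ≤ θε)
    (w : Weights) :
    w.dot J θz θ1p θ2 θε n.α1 (n.flow1pWeights J) = 0 ∧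
      w.dot J θz θ1p θ2 θε n.α1 (n.flow2Weights J) = 0 ↔
    w.dot J θz θ1p θ2 θε n.α1 (n.flow1pWeights J) *
        (n.flow2Weights J).dot J θz θ1p θ2 θε n.α1 (n.flow2Weights J) -
      w.dot J θz θ1p θ2 θε n.α1 (n.flow2Weights J) *
        (n.flow1pWeights J).dot J θz θ1p θ2 θε n.α1 (n.flow2Weights J) = 0 ∧
    w.dot J θz θ1p θ2 θε n.α1 (n.flow2Weights J) *
        (n.flow1pWeights J).dot J θz θ1p θ2 θε n.α1 (n.flow1pWeights J) -
      w.dot J θz θ1p θ2 θε n.α1 (n.flow1pWeights J) *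
        (n.flow1pWeights J).dot J θz θ1p θ2 θε n.α1 (n.flow2Weights J) = 0 := by
  refine pair_eq_zero_iff (Weights.gram_pos hJ hz h1 h2 hε ?_ (Or.inr ⟨rfl, rfl⟩))
  have hJ' : 0 ≤ J - 1 := by linarith
  have : 0 < n.α1 ^ 2 + θz + 1 := by positivity
  have e : (n.flow1pWeights J).dot J θz θ1p θ2 θε n.α1 (n.flow1pWeights J) =
      (n.β11 * J) ^ 2 * ((n.α1 ^ 2 + θz) / (n.α1 ^ 2 + θz + 1)) + θ1p +
        n.β11 ^ 2 * ((J - 1) * θε) + n.β11 ^ 2 * θε := by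
    simp only [Weights.dot, flow1pWeights]
    ring
  rw [e]
  positivity

/-- The others' flow contains `u1+`, which the own signal lacks. A nonzero `α1` is needed for the
residual signal to have positive variance when `θz` and `θε` both vanish. -/
lemma hft_second_iff (hJ : 1 ≤ J) (hz : 0 ≤ θz) (h1 : 0 < θ1p) (h2 : 0 < θ2) (hε : 0 ≤ θε)
    (hA : n.α1 ≠ 0) (w : Weights) :
    w.dot J θz θ1p θ2 θε n.α1 ownResidual = 0 ∧
      w.dot J θz θ1p θ2 θε n.α1 (n.others J) = 0 ↔
    w.dot J θz θ1p θ2 θε n.α1 ownResidual *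
        (n.others J).dot J θz θ1p θ2 θε n.α1 (n.others J) -
      w.dot J θz θ1p θ2 θε n.α1 (n.others J) *
        ownResidual.dot J θz θ1p θ2 θε n.α1 (n.others J) = 0 ∧
    w.dot J θz θ1p θ2 θε n.α1 (n.others J) *
        ownResidual.dot J θz θ1p θ2 θε n.α1 ownResidual -
      w.dot J θz θ1p θ2 θε n.α1 ownResidual *
        ownResidual.dot J θz θ1p θ2 θε n.α1 (n.others J) = 0 := by
  refine pair_eq_zero_iff (Weights.gram_pos hJ hz h1 h2 hε ?_ (Or.inl ⟨rfl, rfl⟩))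
  have : 0 < (n.α1 ^ 2 + θz) / (n.α1 ^ 2 + θz + 1) := by positivity
  simp only [Weights.dot, ownResidual]
  linarith

/-- The values of the coefficients that IT's optimality imposes in a mixed-strategy equilibrium. -/
structure MixedIT (n : Coeffs) (J θz : ℝ) : Prop where
  α1_pos : 0 < n.α1
  β11_ne : n.β11 ≠ 0
  lam1 : n.lam1 = n.α1 / (n.α1 ^ 2 + θz + 1)
  lam22 : n.lam22 = n.α1 / (n.α1 ^ 2 + θz + 1)
  lam21 : n.lam21 = (n.α1 - n.α1 * J * n.total J / (n.α1 ^ 2 + θz + 1)) / (n.β11 * J)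
  α21 : n.α21 = (n.α1 ^ 2 + θz + 1) / (2 * n.α1)
  α22 : n.α22 = -((n.α1 ^ 2 + θz + 1) / 2)

/-- The closed form of `lam21` is precisely the solution of this equation. -/
lemma MixedIT.leak_eq (h : n.MixedIT J θz) (hJ : J ≠ 0) : n.leak J = n.α1 := by
  have := h.β11_ne
  rw [Coeffs.leak_eq, h.lam21, h.lam22]
  field_simp
  ring

lemma MixedIT.pathError2_eq (h : n.MixedIT J θz) (hJ : J ≠ 0) (hz : 0 ≤ θz) :
    n.pathError2 J θz = ⟨1 / 2, -n.α1 / 2, 0,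
      -n.lam21 - n.α1 / (n.α1 ^ 2 + θz + 1) * (J * n.β22), -(n.α1 / (n.α1 ^ 2 + θz + 1)),
      -n.α1 / J, -n.α1 / J⟩ := by
  have := h.α1_pos
  rw [Coeffs.pathError2_eq hJ ?_ ?_ h.lam1, h.leak_eq hJ, h.lam22]
  · rw [h.lam22, h.α21]
    field_simp
  · rw [h.lam22, h.α22, h.leak_eq hJ]
    field_simp
    ring

/-- The factor arises from clearing denominators in the Cramer numerator and is nonzero, since `α1`,
`J` and `β11` are. -/
lemma MixedIT.mixed1_eq (h : n.MixedIT J θz) (hJ : J ≠ 0) (hz : 0 ≤ θz) :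
    mixed1 J θ1p θ2 θε n.α1 θz n.β11 n.β21 n.β22 n.β23 =
      -4 * n.α1 * J * n.β11 * (n.α1 ^ 2 + θz + 1) ^ 2 *
      ((n.pathError2 J θz).dot J θz θ1p θ2 θε n.α1 (n.flow1pWeights J) *
        (n.flow2Weights J).dot J θz θ1p θ2 θε n.α1 (n.flow2Weights J) -
      (n.pathError2 J θz).dot J θz θ1p θ2 θε n.α1 (n.flow2Weights J) *
        (n.flow1pWeights J).dot J θz θ1p θ2 θε n.α1 (n.flow2Weights J)) := by
  have hA := h.α1_pos.ne'
  have hβ := h.β11_ne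
  have hQ : n.α1 ^ 2 + θz + 1 ≠ 0 := by positivity
  rw [h.pathError2_eq hJ hz, n.flow2Weights_eq, flow1pWeights, h.lam21, h.α21, h.α22, total]
  generalize n.α1 = A at *
  -- Eliminating `θz` makes the common denominator a single variable, which keeps the polynomial
  -- identity manageable.
  obtain ⟨Q, rfl⟩ : ∃ Q, θz = Q - A ^ 2 - 1 := ⟨A ^ 2 + θz + 1, by ring⟩
  have hQ' : A ^ 2 + (Q - A ^ 2 - 1) + 1 = Q := by ring
  simp only [Weights.dot, hQ'] at *
  simp only [mixed1, mixed1_coeff0, mixed1_coeff1_β22, mixed1_coeff1_β23, mixed1_coeff2_J,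
    mixed1_coeff2_θε, mixed1_coeff3]
  field_simp
  ring

lemma MixedIT.mixed2_eq (h : n.MixedIT J θz) (hJ : J ≠ 0) (hz : 0 ≤ θz) :
    mixed2 J θ1p θ2 θε n.α1 θz n.β11 n.β21 n.β22 n.β23 =
      -4 * n.α1 * (n.α1 ^ 2 + θz + 1) ^ 2 *
      ((n.pathError2 J θz).dot J θz θ1p θ2 θε n.α1 (n.flow2Weights J) *
        (n.flow1pWeights J).dot J θz θ1p θ2 θε n.α1 (n.flow1pWeights J) -
      (n.pathError2 J θz).dot J θz θ1p θ2 θε n.α1 (n.flow1pWeights J) *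
        (n.flow1pWeights J).dot J θz θ1p θ2 θε n.α1 (n.flow2Weights J)) := by
  have hA := h.α1_pos.ne'
  have hβ := h.β11_ne
  have hQ : n.α1 ^ 2 + θz + 1 ≠ 0 := by positivity
  rw [h.pathError2_eq hJ hz, n.flow2Weights_eq, flow1pWeights, h.lam21, h.α21, h.α22, total]
  generalize n.α1 = A at *
  obtain ⟨Q, rfl⟩ : ∃ Q, θz = Q - A ^ 2 - 1 := ⟨A ^ 2 + θz + 1, by ring⟩
  have hQ' : A ^ 2 + (Q - A ^ 2 - 1) + 1 = Q := by ring
  simp only [Weights.dot, hQ'] at *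
  simp only [mixed2]
  field_simp
  ring

/-- The positive part of `J - 2` differs from `J - 2` only at `J = 1`, where the accompanying factor
`J - 1` vanishes; `hm` expresses this. -/
lemma MixedIT.mixed3_eq (h : n.MixedIT J θz) (hJ : J ≠ 0) (hz : 0 ≤ θz)
    (hm : (J - 1) * max (J - 2) 0 = (J - 1) * (J - 2)) :
    mixed3 J θ1p θε n.α1 θz n.β11 n.β21 n.β22 n.β23 =
      -2 * (n.α1 ^ 2 + θz + 1) ^ 2 *
      ((n.foc2 J θz).dot J θz θ1p θ2 θε n.α1 ownResidual *
        (n.others J).dot J θz θ1p θ2 θε n.α1 (n.others J) -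
      (n.foc2 J θz).dot J θz θ1p θ2 θε n.α1 (n.others J) *
        ownResidual.dot J θz θ1p θ2 θε n.α1 (n.others J)) := by
  have hA := h.α1_pos.ne'
  have hβ := h.β11_ne
  have hQ : n.α1 ^ 2 + θz + 1 ≠ 0 := by positivity
  rw [foc2, others, ownResidual, impact, slope, h.lam22, h.lam21, h.α21, h.α22, total]
  generalize n.α1 = A at *
  obtain ⟨Q, rfl⟩ : ∃ Q, θz = Q - A ^ 2 - 1 := ⟨A ^ 2 + θz + 1, by ring⟩
  have hQ' : A ^ 2 + (Q - A ^ 2 - 1) + 1 = Q := by ring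
  simp only [Weights.dot, hQ'] at *
  simp only [mixed3]
  generalize max (J - 2) 0 = m at *
  rw [show 2 * A * n.β11 * n.β22 * (J - 1) * θ1p * (A ^ 2 + (Q - A ^ 2 - 1)) * m =
    2 * A * n.β11 * n.β22 * ((J - 1) * m) * θ1p * (A ^ 2 + (Q - A ^ 2 - 1)) by ring, hm]
  field_simp
  ring

lemma MixedIT.mixed4_eq (h : n.MixedIT J θz) (hJ : J ≠ 0) (hz : 0 ≤ θz)
    (hm : (J - 1) * max (J - 2) 0 = (J - 1) * (J - 2)) :
    mixed4 J θ1p θε n.α1 θz n.β11 n.β21 n.β22 n.β23 =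
      -2 * J * n.β11 * (n.α1 ^ 2 + θz + 1) ^ 2 *
      ((n.foc2 J θz).dot J θz θ1p θ2 θε n.α1 (n.others J) *
        ownResidual.dot J θz θ1p θ2 θε n.α1 ownResidual -
      (n.foc2 J θz).dot J θz θ1p θ2 θε n.α1 ownResidual *
        ownResidual.dot J θz θ1p θ2 θε n.α1 (n.others J)) := by
  have hA := h.α1_pos.ne'
  have hβ := h.β11_ne
  have hQ : n.α1 ^ 2 + θz + 1 ≠ 0 := by positivity
  rw [foc2, others, ownResidual, impact, slope, h.lam22, h.lam21, h.α21, h.α22, total]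
  generalize n.α1 = A at *
  obtain ⟨Q, rfl⟩ : ∃ Q, θz = Q - A ^ 2 - 1 := ⟨A ^ 2 + θz + 1, by ring⟩
  have hQ' : A ^ 2 + (Q - A ^ 2 - 1) + 1 = Q := by ring
  rw [mixed4]
  simp only [Weights.dot, hQ'] at *
  generalize max (J - 2) 0 = m at *
  rw [show 2 * A * n.β11 ^ 3 * n.β22 * θε * (J - 1) * J * m *
      (θε * Q + J * (A ^ 2 + (Q - A ^ 2 - 1))) =
    2 * A * n.β11 ^ 3 * n.β22 * θε * ((J - 1) * m) * J *
      (θε * Q + J * (A ^ 2 + (Q - A ^ 2 - 1))) by ring, hm]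
  field_simp
  ring

/-- The values of the coefficients that the optimality of the second orders imposes in a
pure-strategy equilibrium. -/
structure PureIT (n : Coeffs) (J : ℝ) : Prop where
  lam22_pos : 0 < n.lam22
  lam1 : n.lam1 = n.α1 / (n.α1 ^ 2 + 1)
  α21 : n.α21 = 1 / (2 * n.lam22)
  α22 : n.α22 = -(n.leak J / (2 * n.lam22))
  β23 : n.β23 = -(n.impact J / (2 * n.lam22))

lemma PureIT.pathError2_eq (h : n.PureIT J) (hJ : J ≠ 0) :
    n.pathError2 J 0 = ⟨1 / 2, -n.leak J / 2, 0,
      -n.lam21 - n.lam22 * (J * n.β22), -n.lam22, -n.leak J / J, -n.leak J / J⟩ := by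
  have := h.lam22_pos
  refine Coeffs.pathError2_eq hJ ?_ ?_ (by rw [add_zero]; exact h.lam1)
  · rw [h.α21]
    field_simp
  · rw [h.α22]
    field_simp
    ring

/-- Here `lam21` and `lam22` stay free, so the only denominators come from `lam22` and `α1 ^ 2 + 1`,
and the factor is positive. -/
lemma PureIT.pure1_eq (h : n.PureIT J) (hJ : J ≠ 0) :
    pure1 J θ1p θ2 θε n.lam21 n.lam22 n.α1 n.β11 n.β21 n.β22 =
      16 * n.lam22 ^ 4 * (n.α1 ^ 2 + 1) *
      ((n.pathError2 J 0).dot J 0 θ1p θ2 θε n.α1 (n.flow1pWeights J) *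
        (n.flow2Weights J).dot J 0 θ1p θ2 θε n.α1 (n.flow2Weights J) -
      (n.pathError2 J 0).dot J 0 θ1p θ2 θε n.α1 (n.flow2Weights J) *
        (n.flow1pWeights J).dot J 0 θ1p θ2 θε n.α1 (n.flow2Weights J)) := by
  have hL := h.lam22_pos.ne'
  have hQ : n.α1 ^ 2 + 1 ≠ 0 := by positivity
  rw [h.pathError2_eq hJ, n.flow2Weights_eq, flow1pWeights, h.α22, h.α21, leak_eq, total,
    h.β23, impact]
  generalize n.α1 = A at *
  simp only [Weights.dot, add_zero, zero_add, pure1, pure1_coeff0, pure1_coeff1, pure1_coeff2]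
  field_simp
  ring

lemma PureIT.pure2_eq (h : n.PureIT J) (hJ : J ≠ 0) :
    pure2 J θ1p θ2 θε n.lam21 n.lam22 n.α1 n.β11 n.β21 n.β22 =
      16 * n.lam22 ^ 3 * (n.α1 ^ 2 + 1) *
      ((n.pathError2 J 0).dot J 0 θ1p θ2 θε n.α1 (n.flow2Weights J) *
        (n.flow1pWeights J).dot J 0 θ1p θ2 θε n.α1 (n.flow1pWeights J) -
      (n.pathError2 J 0).dot J 0 θ1p θ2 θε n.α1 (n.flow1pWeights J) *
        (n.flow1pWeights J).dot J 0 θ1p θ2 θε n.α1 (n.flow2Weights J)) := by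
  have hL := h.lam22_pos.ne'
  have hQ : n.α1 ^ 2 + 1 ≠ 0 := by positivity
  rw [h.pathError2_eq hJ, n.flow2Weights_eq, flow1pWeights, h.α22, h.α21, leak_eq, total,
    h.β23, impact]
  generalize n.α1 = A at *
  simp only [Weights.dot, add_zero, zero_add, pure2]
  field_simp
  ring

lemma PureIT.pure4_eq (h : n.PureIT J)
    (hm : (J - 1) * max (J - 2) 0 = (J - 1) * (J - 2)) :
    pure4 J θ1p θε n.lam21 n.lam22 n.α1 n.β11 n.β21 n.β22 =
      -4 * n.lam22 * (n.α1 ^ 2 + 1) *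
      ((n.foc2 J 0).dot J 0 θ1p θ2 θε n.α1 ownResidual *
        (n.others J).dot J 0 θ1p θ2 θε n.α1 (n.others J) -
      (n.foc2 J 0).dot J 0 θ1p θ2 θε n.α1 (n.others J) *
        ownResidual.dot J 0 θ1p θ2 θε n.α1 (n.others J)) := by
  have hL := h.lam22_pos.ne'
  have hQ : n.α1 ^ 2 + 1 ≠ 0 := by positivity
  rw [foc2, others, ownResidual, slope, h.α22, h.α21, leak_eq, total, h.β23, impact]
  generalize n.α1 = A at *
  simp only [Weights.dot, add_zero, zero_add, pure4]
  rw [show 4 * A ^ 2 * n.β11 * n.β22 * (J - 1) * n.lam22 ^ 2 * θ1p * max (J - 2) 0 =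
    4 * A ^ 2 * n.β11 * n.β22 * ((J - 1) * max (J - 2) 0) * n.lam22 ^ 2 * θ1p by ring, hm]
  field_simp
  ring

lemma PureIT.pure5_eq (h : n.PureIT J)
    (hm : (J - 1) * max (J - 2) 0 = (J - 1) * (J - 2)) :
    pure5 J θ1p θε n.lam21 n.lam22 n.α1 n.β11 n.β21 n.β22 =
      -4 * n.lam22 * (n.α1 ^ 2 + 1) *
      ((n.foc2 J 0).dot J 0 θ1p θ2 θε n.α1 (n.others J) *
        ownResidual.dot J 0 θ1p θ2 θε n.α1 ownResidual -
      (n.foc2 J 0).dot J 0 θ1p θ2 θε n.α1 ownResidual *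
        ownResidual.dot J 0 θ1p θ2 θε n.α1 (n.others J)) := by
  have hL := h.lam22_pos.ne'
  have hQ : n.α1 ^ 2 + 1 ≠ 0 := by positivity
  rw [foc2, others, ownResidual, slope, h.α22, h.α21, leak_eq, total, h.β23, impact]
  generalize n.α1 = A at *
  simp only [Weights.dot, add_zero, zero_add, pure5]
  rw [show 4 * n.β11 ^ 2 * n.β22 * θε * (J - 1) * n.lam22 ^ 2 * max (J - 2) 0 *
      (A ^ 2 * θε + A ^ 2 * J + θε) =
    4 * n.β11 ^ 2 * n.β22 * θε * ((J - 1) * max (J - 2) 0) * n.lam22 ^ 2 *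
      (A ^ 2 * θε + A ^ 2 * J + θε) by ring, hm]
  field_simp
  ring

end Coeffs

lemma and_mul_eq_zero_iff {a b x y : ℝ} (ha : a ≠ 0) (hb : b ≠ 0) :
    a * x = 0 ∧ b * y = 0 ↔ x = 0 ∧ y = 0 := by
  simp [ha, hb]

/-! ### Equivalence with the mixed and pure systems -/

namespace Coeffs

variable {J θz θ1p θ2 θε : ℝ} {n : Coeffs}

lemma MixedIT.impact_eq (h : n.MixedIT J θz) (hJ : J ≠ 0) (hz : 0 ≤ θz) :
    n.α1 ^ 3 + n.α1 * (n.β11 * n.β23 * J - n.β21 * J + θz + 1) =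
      n.β11 * J * (n.α1 ^ 2 + θz + 1) * (n.impact J + 2 * n.lam22 * n.β23) := by
  have hβ := h.β11_ne
  have hQ : n.α1 ^ 2 + θz + 1 ≠ 0 := by positivity
  rw [impact, h.lam21, h.lam22, total]
  field_simp
  ring

/-- The displayed equation is the HFT's first-order condition solved for `β11`; dividing is
legitimate because the second-order expression is positive. -/
lemma MixedIT.mixed6_iff (hz : 0 < θz) (hε : 0 ≤ θε) (h : n.MixedIT J θz)
    (h1 : n.lam1p = n.α1 * n.β11 * J / (n.β11 ^ 2 * J * (θε * (n.α1 ^ 2 + θz + 1) +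
        J * (n.α1 ^ 2 + θz)) + θ1p * (n.α1 ^ 2 + θz + 1)))
    (hS : 0 < n.lam1p - n.lam22 * n.β23 ^ 2) :
    0 = n.β11 - mixed6_num J θ1p θε n.α1 θz n.β11 n.β21 n.β22 n.β23 /
        (2 * (n.α1 ^ 2 * (θε + 1) + θε * θz + θε + θz) *
          (n.lam1p - n.lam22 * n.β23 ^ 2)) ↔
      2 * (n.lam1p - n.lam22 * n.β23 ^ 2) * (n.α1 ^ 2 + θz + θε * (n.α1 ^ 2 + θz + 1)) * n.β11 =
        n.α1 - (n.lam1p - 2 * n.lam22 * n.β22 * n.β23) * n.β11 * (J - 1) * (n.α1 ^ 2 + θz) +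
        2 * n.lam22 * n.β23 * n.β21 * (n.α1 ^ 2 + θz + θε * (n.α1 ^ 2 + θz + 1)) := by
  have hQ : 0 < n.α1 ^ 2 + θz + 1 := by positivity
  have e : mixed6_num J θ1p θε n.α1 θz n.β11 n.β21 n.β22 n.β23 =
      n.α1 - (n.lam1p - 2 * n.lam22 * n.β22 * n.β23) * n.β11 * (J - 1) * (n.α1 ^ 2 + θz) +
        2 * n.lam22 * n.β23 * n.β21 * (n.α1 ^ 2 + θz + θε * (n.α1 ^ 2 + θz + 1)) := by
    rw [mixed6_num, h1, h.lam22]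
    generalize n.β11 ^ 2 * J * (θε * (n.α1 ^ 2 + θz + 1) +
        J * (n.α1 ^ 2 + θz)) + θ1p * (n.α1 ^ 2 + θz + 1) = W
    field_simp
    ring
  have hD : 0 < 2 * (n.α1 ^ 2 * (θε + 1) + θε * θz + θε + θz) *
      (n.lam1p - n.lam22 * n.β23 ^ 2) := mul_pos (by positivity) hS
  rw [e, eq_comm, sub_eq_zero, eq_div_iff hD.ne']
  refine Eq.congr ?_ rfl
  ring

/-- Both sides entail the closed forms collected in `MixedIT`, and under these the conditions match
one by one. -/
lemma mixed_equilibrium_iff (hJ : 1 ≤ J) (hm : (J - 1) * max (J - 2) 0 = (J - 1) * (J - 2))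
    (hz : 0 < θz) (h1p : 0 < θ1p) (h2 : 0 < θ2) (hε : 0 ≤ θε) :
    (n.CommonConditions J θz θ1p θ2 θε ∧
      1 + n.carry θz = 0 ∧ n.lam1 = n.lam22 * n.carry θz ^ 2) ↔
    MixedSystem J θ1p θ2 θε n.α1 θz n.β11 n.β21 n.β22 n.β23 ∧
      MixedClosedForms J θ1p θε n.α1 θz n.β11 n.β21 n.β22 n.β23 n.lam1 n.lam1p n.lam21 n.lam22
        n.α21 n.α22 := by
  have hJ0 : 0 < J := by linarith
  have hQ : 0 < n.α1 ^ 2 + θz + 1 := by positivity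
  have hSOC (e22 : n.lam22 = n.α1 / (n.α1 ^ 2 + θz + 1))
      (e1p : n.lam1p = n.α1 * n.β11 * J / (n.β11 ^ 2 * J * (θε * (n.α1 ^ 2 + θz + 1) +
        J * (n.α1 ^ 2 + θz)) + θ1p * (n.α1 ^ 2 + θz + 1))) :
      mixedSOC J θ1p θε n.α1 θz n.β11 n.β23 = n.lam1p - n.lam22 * n.β23 ^ 2 := by
    rw [mixedSOC, e22, e1p]
    ring
  -- If `β11` were zero, `lam1p` would vanish and the second-order expression would be at most zero.
  -- This justifies the division by `β11 * J` in the formula for `lam21`.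
  have hβpos (hA : 0 < n.α1) (hlam : 0 < n.lam22)
      (e1p : n.lam1p = n.α1 * n.β11 * J / (n.β11 ^ 2 * J * (θε * (n.α1 ^ 2 + θz + 1) +
        J * (n.α1 ^ 2 + θz)) + θ1p * (n.α1 ^ 2 + θz + 1)))
      (hS : 0 < n.lam1p - n.lam22 * n.β23 ^ 2) : n.β11 ≠ 0 := by
    intro h0
    rw [h0] at e1p
    simp only [mul_zero, zero_mul, zero_div] at e1p
    nlinarith [mul_nonneg hlam.le (sq_nonneg n.β23)]
  -- the equivalence once the closed forms are known
  have core (h : n.MixedIT J θz)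
      (e1p : n.lam1p = n.α1 * n.β11 * J / (n.β11 ^ 2 * J * (θε * (n.α1 ^ 2 + θz + 1) +
        J * (n.α1 ^ 2 + θz)) + θ1p * (n.α1 ^ 2 + θz + 1))) :
      n.CommonConditions J θz θ1p θ2 θε ↔
        MixedSystem J θ1p θ2 θε n.α1 θz n.β11 n.β21 n.β22 n.β23 := by
    have hA := h.α1_pos
    have hβ := h.β11_ne
    have d1 : (n.pathError2 J θz).dot J θz θ1p θ2 θε n.α1 (n.flow1pWeights J) = 0 ∧
        (n.pathError2 J θz).dot J θz θ1p θ2 θε n.α1 (n.flow2Weights J) = 0 ↔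
        mixed1 J θ1p θ2 θε n.α1 θz n.β11 n.β21 n.β22 n.β23 = 0 ∧
          mixed2 J θ1p θ2 θε n.α1 θz n.β11 n.β21 n.β22 n.β23 = 0 := by
      rw [price2_iff hJ hz.le h1p h2 hε, h.mixed1_eq hJ0.ne' hz.le, h.mixed2_eq hJ0.ne' hz.le,
        and_mul_eq_zero_iff (by simp [hA.ne', hJ0.ne', hβ, hQ.ne'])
          (by simp [hA.ne', hQ.ne'])]
    have d2 : (n.foc2 J θz).dot J θz θ1p θ2 θε n.α1 ownResidual = 0 ∧
        (n.foc2 J θz).dot J θz θ1p θ2 θε n.α1 (n.others J) = 0 ↔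
        mixed3 J θ1p θε n.α1 θz n.β11 n.β21 n.β22 n.β23 = 0 ∧
          mixed4 J θ1p θε n.α1 θz n.β11 n.β21 n.β22 n.β23 = 0 := by
      -- `θ2` has to be supplied: it is absent from these polynomials, because `u2` is uncorrelated
      -- with everything an HFT observes.
      rw [hft_second_iff hJ hz.le h1p h2 hε hA.ne', h.mixed3_eq (θ2 := θ2) hJ0.ne' hz.le hm,
        h.mixed4_eq (θ2 := θ2) hJ0.ne' hz.le hm,
        and_mul_eq_zero_iff (by simp [hQ.ne'])
          (by simp [hJ0.ne', hβ, hQ.ne'])]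
    have d3 : n.impact J + 2 * n.lam22 * n.β23 = 0 ↔
        n.α1 ^ 3 + n.α1 * (n.β11 * n.β23 * J - n.β21 * J + θz + 1) = 0 := by
      rw [h.impact_eq hJ0.ne' hz.le, mul_eq_zero,
        or_iff_right (by simp [hJ0.ne', hβ, hQ.ne'])]
    have hS := hSOC h.lam22 e1p
    unfold MixedSystem
    rw [hS]
    constructor
    · intro c
      have p := d1.1 c.price2
      have q := d2.1 c.hft_second
      have hs := c.soc1_pos
      rw [soc1_eq c.impact] at hs
      exact ⟨p.1.symm, p.2.symm, q.1.symm, q.2.symm, (d3.1 c.impact).symm,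
        (h.mixed6_iff hz hε e1p hs).2
          ((Coeffs.hft_first_iff hz.le c.impact c.hft_second.1).1 c.hft_first), hs, hA, hz⟩
    · rintro ⟨p1, p2, q1, q2, r, t, hs, -, -⟩
      have r' := d3.2 r.symm
      have q := d2.2 ⟨q1.symm, q2.symm⟩
      refine ⟨?_, ?_, ?_, h.lam1, r', (price1p_iff hJ hz.le h1p hε).2 e1p,
        d1.2 ⟨p1.symm, p2.symm⟩, q, by rwa [soc1_eq r'],
        (Coeffs.hft_first_iff hz.le r' q.1).2 ((h.mixed6_iff hz hε e1p hs).1 t)⟩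
      · rw [h.lam22]; positivity
      · rw [h.lam22, h.α21]; field_simp
      · rw [h.leak_eq hJ0.ne', h.lam22, h.α22]; field_simp; ring
  constructor
  · rintro ⟨c, i1, i2⟩
    -- Since `carry = -1`, the second indifference condition reads `lam1 = lam22`; the regression
    -- slope then fixes `lam22`, and its positivity yields `0 < α1`.
    have i1' : n.carry θz = -1 := by linarith
    have e22 : n.lam22 = n.α1 / (n.α1 ^ 2 + θz + 1) := by
      rw [← c.lam1, i2, i1']; ring
    have hA : 0 < n.α1 := by
      have := c.lam22_pos
      rw [e22] at this
      exact (div_pos_iff_of_pos_right hQ).1 this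
    have e1p := (price1p_iff hJ hz.le h1p hε).1 c.price1p
    have hs := c.soc1_pos
    rw [soc1_eq c.impact] at hs
    have hβ := hβpos hA c.lam22_pos e1p hs
    have e21 : n.α21 = (n.α1 ^ 2 + θz + 1) / (2 * n.α1) := by
      have := c.it_second
      rw [e22] at this
      field_simp at this ⊢
      linarith
    have e2 : n.α22 = -((n.α1 ^ 2 + θz + 1) / 2) := by
      rw [carry, e21] at i1'
      field_simp at i1' ⊢
      linarith
    have el : n.lam21 = (n.α1 - n.α1 * J * n.total J / (n.α1 ^ 2 + θz + 1)) / (n.β11 * J) := by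
      have := c.it_leak
      rw [leak_eq, e22, e2] at this
      field_simp at this ⊢
      linarith
    have h : n.MixedIT J θz := ⟨hA, hβ, c.lam1, e22, el, e21, e2⟩
    refine ⟨(core h e1p).1 c, c.lam1, e1p, ?_, e22.trans c.lam1.symm, ?_, e2⟩
    · rw [el, total]; ring
    · rw [e21, e22]; field_simp
  · rintro ⟨hs, e1, e1p, el, e22, e21, e2⟩
    have hA : 0 < n.α1 := hs.2.2.2.2.2.2.2.1
    have hS := hs.2.2.2.2.2.2.1
    have e22' := e22.trans e1
    rw [hSOC e22' e1p] at hS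
    have hβ := hβpos hA (by rw [e22']; positivity) e1p hS
    have h : n.MixedIT J θz := ⟨hA, hβ, e1, e22', by rw [el, total]; ring,
      by rw [e21, e22']; field_simp, e2⟩
    have hc : n.carry θz = -1 := by
      rw [carry, h.α21, h.α22]
      field_simp
      ring
    refine ⟨(core h e1p).2 hs, by rw [hc]; ring, by rw [hc, e22]; ring⟩

lemma PureIT.leak_eq (h : n.PureIT J) :
    n.leak J = J * n.β11 * n.impact J / 2 + J * n.lam22 * n.β21 := by
  have := h.lam22_pos
  rw [Coeffs.leak_eq, total, h.β23, impact]
  field_simp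
  ring

lemma PureIT.carry_eq (h : n.PureIT J) :
    n.carry 0 = -(2 * n.α1 + J * n.β11 * n.impact J + 2 * J * n.lam22 * n.β21) /
      (4 * n.lam22 * (n.α1 ^ 2 + 1)) := by
  have := h.lam22_pos
  rw [carry, h.α21, h.α22, h.leak_eq, add_zero]
  field_simp
  ring

/-- This identifies the expression with the curvature of the informed trader's total profit, in
standardised units. -/
lemma PureIT.pureSOC1_eq (h : n.PureIT J) :
    pureSOC1 J n.lam21 n.lam22 n.α1 n.β11 n.β21 n.β22 = n.lam1 - n.lam22 * n.carry 0 ^ 2 := by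
  have := h.lam22_pos
  rw [h.carry_eq, pureSOC1, h.lam1, impact]
  field_simp
  ring

/-- The numerator is `-4 * lam22 ^ 2 * (α1 ^ 2 + 1)` times `1 + carry`, so the equation is the
vertex condition divided by the positive curvature. -/
lemma PureIT.pure3_iff (h : n.PureIT J) (hT : 0 < n.lam1 - n.lam22 * n.carry 0 ^ 2) :
    0 = (-4 * n.α1 ^ 2 * n.lam22 ^ 2 + 2 * n.α1 * n.lam22 +
        n.β11 * J * (n.lam22 * (n.β22 * (J - 1) * n.lam22 + n.lam21)) +
        2 * n.lam22 ^ 2 * (n.β21 * J - 2)) /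
      (8 * (n.α1 ^ 2 + 1) * n.lam22 ^ 2 * (n.lam1 - n.lam22 * n.carry 0 ^ 2)) + n.α1 ↔
    1 + n.carry 0 = 2 * (n.lam1 - n.lam22 * n.carry 0 ^ 2) * n.α1 := by
  have hL := h.lam22_pos
  have e : -4 * n.α1 ^ 2 * n.lam22 ^ 2 + 2 * n.α1 * n.lam22 +
        n.β11 * J * (n.lam22 * (n.β22 * (J - 1) * n.lam22 + n.lam21)) +
        2 * n.lam22 ^ 2 * (n.β21 * J - 2) =
      -4 * n.lam22 ^ 2 * (n.α1 ^ 2 + 1) * (1 + n.carry 0) := by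
    rw [h.carry_eq, impact]
    field_simp
    ring
  rw [e]
  generalize n.lam1 - n.lam22 * n.carry 0 ^ 2 = T at *
  field_simp
  constructor <;> intro h <;> linarith

lemma PureIT.pureSOC2_eq (h : n.PureIT J)
    (h1 : n.lam1p = n.α1 * n.β11 * J / (n.β11 ^ 2 * J * (θε * (n.α1 ^ 2 + 1) +
        J * n.α1 ^ 2) + θ1p * (n.α1 ^ 2 + 1))) :
    pureSOC2 J θ1p θε n.lam21 n.lam22 n.α1 n.β11 n.β22 =
      4 * (n.lam1p - n.lam22 * n.β23 ^ 2) := by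
  have hL := h.lam22_pos
  rw [pureSOC2, h1, h.β23, impact, show n.β11 ^ 2 * J * (n.α1 ^ 2 * θε + n.α1 ^ 2 * J + θε) +
    (n.α1 ^ 2 + 1) * θ1p = n.β11 ^ 2 * J * (θε * (n.α1 ^ 2 + 1) + J * n.α1 ^ 2) +
      θ1p * (n.α1 ^ 2 + 1) by ring]
  generalize n.β11 ^ 2 * J * (θε * (n.α1 ^ 2 + 1) + J * n.α1 ^ 2) +
      θ1p * (n.α1 ^ 2 + 1) = W
  field_simp
  ring

lemma PureIT.pure6_iff (hε : 0 ≤ θε) (h : n.PureIT J) (hA : 0 < n.α1)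
    (h1 : n.lam1p = n.α1 * n.β11 * J / (n.β11 ^ 2 * J * (θε * (n.α1 ^ 2 + 1) +
        J * n.α1 ^ 2) + θ1p * (n.α1 ^ 2 + 1)))
    (hS : 0 < n.lam1p - n.lam22 * n.β23 ^ 2) :
    0 = n.β11 - pure6_num J θ1p θε n.lam21 n.lam22 n.α1 n.β11 n.β21 n.β22 /
        ((n.α1 ^ 2 * (θε + 1) + θε) * (4 * (n.lam1p - n.lam22 * n.β23 ^ 2))) ↔
      2 * (n.lam1p - n.lam22 * n.β23 ^ 2) * (n.α1 ^ 2 + 0 + θε * (n.α1 ^ 2 + 0 + 1)) * n.β11 =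
        n.α1 - (n.lam1p - 2 * n.lam22 * n.β22 * n.β23) * n.β11 * (J - 1) * (n.α1 ^ 2 + 0) +
        2 * n.lam22 * n.β23 * n.β21 * (n.α1 ^ 2 + 0 + θε * (n.α1 ^ 2 + 0 + 1)) := by
  have hL := h.lam22_pos
  have e : pure6_num J θ1p θε n.lam21 n.lam22 n.α1 n.β11 n.β21 n.β22 =
      2 * (n.α1 - (n.lam1p - 2 * n.lam22 * n.β22 * n.β23) * n.β11 * (J - 1) * (n.α1 ^ 2 + 0) +
        2 * n.lam22 * n.β23 * n.β21 * (n.α1 ^ 2 + 0 + θε * (n.α1 ^ 2 + 0 + 1))) := by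
    rw [pure6_num, h1, h.β23, impact,
      show n.β11 ^ 2 * J * (n.α1 ^ 2 * θε + n.α1 ^ 2 * J + θε) +
      (n.α1 ^ 2 + 1) * θ1p = n.β11 ^ 2 * J * (θε * (n.α1 ^ 2 + 1) + J * n.α1 ^ 2) +
        θ1p * (n.α1 ^ 2 + 1) by ring]
    generalize n.β11 ^ 2 * J * (θε * (n.α1 ^ 2 + 1) + J * n.α1 ^ 2) +
      θ1p * (n.α1 ^ 2 + 1) = W
    field_simp
    ring
  have hD : 0 < (n.α1 ^ 2 * (θε + 1) + θε) * (4 * (n.lam1p - n.lam22 * n.β23 ^ 2)) :=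
    mul_pos (by positivity) (by linarith)
  rw [e, eq_comm, sub_eq_zero, eq_div_iff hD.ne']
  constructor <;> intro h <;> linarith

/-- The closed forms only express optimality of the second orders and the regressions for `p1` and
`p1+`. Unlike in the mixed case, `lam21` and `lam22` remain unknowns, and no division by `β11`
occurs. -/
lemma pure_equilibrium_iff (hJ : 1 ≤ J) (hm : (J - 1) * max (J - 2) 0 = (J - 1) * (J - 2))
    (h1p : 0 < θ1p) (h2 : 0 < θ2) (hε : 0 ≤ θε) :
    (n.CommonConditions J 0 θ1p θ2 θε ∧ 0 < n.lam1 - n.lam22 * n.carry 0 ^ 2 ∧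
      1 + n.carry 0 = 2 * (n.lam1 - n.lam22 * n.carry 0 ^ 2) * n.α1) ↔
    PureSystem J θ1p θ2 θε n.lam21 n.lam22 n.α1 n.β11 n.β21 n.β22 ∧
      PureClosedForms J θ1p θε n.lam21 n.lam22 n.α1 n.β11 n.β21 n.β22 n.lam1 n.lam1p n.α21
        n.α22 n.β23 := by
  have hJ0 : 0 < J := by linarith
  have hQ : 0 < n.α1 ^ 2 + 1 := by positivity
  -- the equivalence once the closed forms are known
  have core (h : n.PureIT J)
      (e1p : n.lam1p = n.α1 * n.β11 * J / (n.β11 ^ 2 * J * (θε * (n.α1 ^ 2 + 1) +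
        J * n.α1 ^ 2) + θ1p * (n.α1 ^ 2 + 1))) :
      (n.CommonConditions J 0 θ1p θ2 θε ∧ 0 < n.lam1 - n.lam22 * n.carry 0 ^ 2 ∧
        1 + n.carry 0 = 2 * (n.lam1 - n.lam22 * n.carry 0 ^ 2) * n.α1) ↔
        PureSystem J θ1p θ2 θε n.lam21 n.lam22 n.α1 n.β11 n.β21 n.β22 := by
    have hL := h.lam22_pos
    -- Positive curvature gives `lam1 > lam22 * carry ^ 2 ≥ 0`, and `lam1` has the sign of `α1`.
    have hA (hT : 0 < n.lam1 - n.lam22 * n.carry 0 ^ 2) : 0 < n.α1 := by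
      have : 0 < n.lam1 := by nlinarith [mul_nonneg hL.le (sq_nonneg (n.carry 0))]
      rw [h.lam1] at this
      exact (div_pos_iff_of_pos_right hQ).1 this
    have d1 : (n.pathError2 J 0).dot J 0 θ1p θ2 θε n.α1 (n.flow1pWeights J) = 0 ∧
        (n.pathError2 J 0).dot J 0 θ1p θ2 θε n.α1 (n.flow2Weights J) = 0 ↔
        pure1 J θ1p θ2 θε n.lam21 n.lam22 n.α1 n.β11 n.β21 n.β22 = 0 ∧
          pure2 J θ1p θ2 θε n.lam21 n.lam22 n.α1 n.β11 n.β21 n.β22 = 0 := by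
      rw [price2_iff hJ le_rfl h1p h2 hε, h.pure1_eq hJ0.ne', h.pure2_eq hJ0.ne',
        and_mul_eq_zero_iff (by simp [hL.ne', hQ.ne'])
          (by simp [hL.ne', hQ.ne'])]
    have d2 (hA : 0 < n.α1) : (n.foc2 J 0).dot J 0 θ1p θ2 θε n.α1 ownResidual = 0 ∧
        (n.foc2 J 0).dot J 0 θ1p θ2 θε n.α1 (n.others J) = 0 ↔
        pure4 J θ1p θε n.lam21 n.lam22 n.α1 n.β11 n.β21 n.β22 = 0 ∧
          pure5 J θ1p θε n.lam21 n.lam22 n.α1 n.β11 n.β21 n.β22 = 0 := by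
      rw [hft_second_iff hJ le_rfl h1p h2 hε hA.ne', h.pure4_eq (θ2 := θ2) hm,
        h.pure5_eq (θ2 := θ2) hm,
        and_mul_eq_zero_iff (by simp [hL.ne', hQ.ne'])
          (by simp [hL.ne', hQ.ne'])]
    have him : n.impact J + 2 * n.lam22 * n.β23 = 0 := by
      rw [h.β23]
      field_simp
      ring
    unfold PureSystem
    rw [h.pureSOC1_eq, h.pureSOC2_eq e1p]
    constructor
    · rintro ⟨c, hT, i⟩
      have p := d1.1 c.price2
      have q := (d2 (hA hT)).1 c.hft_second
      have hs := c.soc1_pos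
      rw [soc1_eq c.impact] at hs
      exact ⟨p.1.symm, p.2.symm, (h.pure3_iff hT).2 i, q.1.symm, q.2.symm,
        (h.pure6_iff hε (hA hT) e1p hs).2
          ((Coeffs.hft_first_iff le_rfl c.impact c.hft_second.1).1 c.hft_first),
        hL, hT, by linarith⟩
    · rintro ⟨p1, p2, i, q1, q2, t, -, hT, hs⟩
      have hs : 0 < n.lam1p - n.lam22 * n.β23 ^ 2 := by linarith
      have q := (d2 (hA hT)).2 ⟨q1.symm, q2.symm⟩
      refine ⟨⟨hL, ?_, ?_, by rw [add_zero]; exact h.lam1, him,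
        (price1p_iff hJ le_rfl h1p hε).2 (by simpa only [add_zero] using e1p),
        d1.2 ⟨p1.symm, p2.symm⟩, q, by rwa [soc1_eq him],
        (Coeffs.hft_first_iff le_rfl him q.1).2 ((h.pure6_iff hε (hA hT) e1p hs).1 t)⟩, hT,
        (h.pure3_iff hT).1 i⟩
      · rw [h.α21]; field_simp
      · rw [h.α22]; field_simp; ring
  constructor
  · intro hc
    have c := hc.1
    have hL := c.lam22_pos
    have e1 := c.lam1
    rw [add_zero] at e1
    have e1p := (price1p_iff hJ le_rfl h1p hε).1 c.price1p
    simp only [add_zero] at e1p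
    have e21 : n.α21 = 1 / (2 * n.lam22) := by
      rw [eq_div_iff (by positivity)]
      linarith [c.it_second]
    have e2 : n.α22 = -(n.leak J / (2 * n.lam22)) := by
      rw [← neg_div, eq_div_iff (by positivity)]
      linarith [c.it_leak]
    have e3 : n.β23 = -(n.impact J / (2 * n.lam22)) := by
      rw [← neg_div, eq_div_iff (by positivity)]
      linarith [c.impact]
    have h : n.PureIT J := ⟨hL, e1, e21, e2, e3⟩
    refine ⟨(core h e1p).1 hc, e1, e1p, e21, ?_, ?_⟩
    · rw [e2, leak]; ring
    · rw [e3, impact]; ring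
  · rintro ⟨hs, e1, e1p, e21, e2, e3⟩
    have hL : 0 < n.lam22 := hs.2.2.2.2.2.2.1
    have h : n.PureIT J := ⟨hL, e1, e21, by rw [e2, leak]; ring, by rw [e3, impact]; ring⟩
    exact (core h e1p).2 hs

end Coeffs

/-! ### Assembly of the theorem -/

theorem mainTheorem3 {Ω : Type*} [MeasurableSpace Ω] [StandardBorelSpace Ω]
    (μ : Measure Ω) [IsProbabilityMeasure μ] (J : ℕ) (hJ : 1 ≤ J)
    (p0 σv σz σ1 σ1p σ2 σε : ℝ) (hσv : 0 < σv) (hσz : 0 ≤ σz) (hσ1 : 0 < σ1) (hσ1p : 0 < σ1p)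
    (hσ2 : 0 < σ2) (hσε : 0 ≤ σε)
    (S : Shocks Ω J) (hS : S.HasNormalLaws μ p0 σv σz σ1 σ1p σ2 σε)
    (c : Coeffs) (s : Profile J) (hs : IsLinearProfile μ S p0 c s)
    (θ1p θ2 θε θz Λ1 Λ1p Λ21 Λ22 A1 A21 : ℝ)
    (hθ1p : θ1p = σ1p ^ 2 / σ1 ^ 2) (hθ2 : θ2 = σ2 ^ 2 / σ1 ^ 2) (hθε : θε = σε ^ 2 / σ1 ^ 2)
    (hθz : θz = σz ^ 2 / σ1 ^ 2)
    (hΛ1 : Λ1 = c.lam1 / (σv / σ1)) (hΛ1p : Λ1p = c.lam1p / (σv / σ1))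
    (hΛ21 : Λ21 = c.lam21 / (σv / σ1)) (hΛ22 : Λ22 = c.lam22 / (σv / σ1))
    (hA1 : A1 = c.α1 / (σ1 / σv)) (hA21 : A21 = c.α21 / (σ1 / σv)) :
    (0 < σz →
      (IsMixedEquilibrium μ S (fun _ => 0) s ↔
        MixedSystem J θ1p θ2 θε A1 θz c.β11 c.β21 c.β22 c.β23 ∧
        MixedClosedForms J θ1p θε A1 θz c.β11 c.β21 c.β22 c.β23 Λ1 Λ1p Λ21 Λ22 A21 c.α22)) ∧
    (σz = 0 →
      (IsPureEquilibrium μ S (fun _ => 0) s ↔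
        PureSystem J θ1p θ2 θε Λ21 Λ22 A1 c.β11 c.β21 c.β22 ∧
        PureClosedForms J θ1p θε Λ21 Λ22 A1 c.β11 c.β21 c.β22 Λ1 Λ1p A21 c.α22 c.β23)) := by

  have hJ0 : 0 < J := hJ
  have hJR : (1 : ℝ) ≤ J := by exact_mod_cast hJ
  have hm : ((J : ℝ) - 1) * max ((J : ℝ) - 2) 0 = (J - 1) * (J - 2) := by
    obtain rfl | h2 : J = 1 ∨ 2 ≤ J := by omega
    · simp
    · have : (2 : ℝ) ≤ J := by exact_mod_cast h2
      rw [max_eq_left (by linarith)]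
  have h1p : 0 < θ1p := by rw [hθ1p]; positivity
  have h2 : 0 < θ2 := by rw [hθ2]; positivity
  have hε : 0 ≤ θε := by rw [hθε]; positivity
  have hz : 0 ≤ θz := by rw [hθz]; positivity
  have hM : StandardModel μ S p0 σv σ1 θz θ1p θ2 θε :=
    ⟨by rw [hθz, hθ1p, hθ2, hθε]; exact hS.isGaussianBasis hσv hσ1, hσv, hσ1, hz⟩
  -- All conditions above are stated for these dimensionless coefficients; rescaling them returns
  -- `c`.
  let n : Coeffs := ⟨Λ1, Λ1p, Λ21, Λ22, A1, A21, c.α22, c.β11, c.β21, c.β22, c.β23⟩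
  have hn : n.rescale σv σ1 = c := by
    have hr : σv / σ1 ≠ 0 := by positivity
    have hr' : σ1 / σv ≠ 0 := by positivity
    simp only [Coeffs.rescale, n, hΛ1, hΛ1p, hΛ21, hΛ22, hA1, hA21, div_mul_cancel₀ _ hr,
      div_mul_cancel₀ _ hr']
  rw [← hn] at hs
  rw [hM.eq_affineProfile hJ hs]
  have hcommon := hM.isCommonEquilibrium_iff (n := n) hJ0
  constructor
  · intro hσz
    have hz : 0 < θz := by rw [hθz]; positivity
    refine Iff.trans ?_ (Coeffs.mixed_equilibrium_iff (n := n) hJR hm hz h1p h2 hε)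
    rw [IsMixedEquilibrium, hcommon]
    exact and_congr_right fun h =>
      hM.it_first_indifferent_iff ⟨0, hJ0⟩ h.it_second h.it_leak h.lam1
  · intro hσz
    have hz : θz = 0 := by rw [hθz, hσz]; simp
    subst hz
    refine Iff.trans ?_ (Coeffs.pure_equilibrium_iff (n := n) hJR hm h1p h2 hε)
    rw [IsPureEquilibrium, hcommon]
    exact and_congr_right fun h =>
      hM.it_first_optimal_iff ⟨0, hJ0⟩ rfl h.it_second h.it_leak h.lam1
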